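/- Let $d\ge 1$ be an integer, $1\le p,\theta\le\infty$, $s>0$ (with $1/\infty:=0$). Let $L\in\mathbb N_0$ with $L+1>s$ and let $\Psi_0,\Psi_1\in C_0^\infty(\mathbb R)$ be complex-valued functions such that, for some $\varepsilon>0$, $\mathcal F\Psi_0(\xi)\ne 0$ for $|\xi|<\varepsilon$, $\mathcal F\Psi_1(\xi)\neq 0$ for $\varepsilon/2<|\xi|<2\varepsilon$, and $D^\alpha\mathcal F\Psi_1(0)=0$ for $0\le\alpha\le L$, where $\mathcal F g(\xi)=\int_{\mathbb R} g(y)e^{-2\pi i\xi y}\,dy$. Put $\Psi_j=2^{j-1}\Psi_1(2^{j-1}\,\cdot)$ for $j\ge1$ and $\Psi_m(x)=\prod_{i=1}^d\Psi_{m_i}(x_i)$ for $m\in\mathbb N_0^d$. For tempered distributions $f\in\mathcal S'(\mathbb R^d)$ let $$\|f\|_{\mathbf B^s_{p,\theta}}=\Big(\sum_{m\in\mathbb N_0^d}2^{s|m|_1\theta}\|\Psi_m*f\|_p^\theta\Big)^{1/\theta},\qquad \|f\|_{\mathbf F^s_{p,\theta}}=\Big\|\Big(\sum_{m\in\mathbb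 N_0^d}2^{s|m|_1\theta}|\Psi_m*f(\cdot)|^\theta\Big)^{1/\theta}\Big\|_p$$ (a supremum over $m$ if $\theta=\infty$; $p<\infty$ in the $\mathbf F$-case), where $\|\cdot\|_p$ is the norm of $L_p(\mathbb R^d)$, and let $\mathring{\mathbf B}^s_{p,\theta}$, $\mathring{\mathbf F}^s_{p,\theta}$ be the spaces of those $f$ with finite norm and $\operatorname{supp} f\subset[0,1]^d$. For a normed space $\mathbf F_d$ of continuous functions, let $I(f)=\int_{[0,1]^d}f(x)\,dx$. For a cubature rule $Q$ put $e(Q,\mathbf F_d)=\sup_{\|f\|_{\mathbf F_d}\le1}|I(f)-Q(f)|$, and let $\mathrm{Int}_n(\mathbf F_d)$ be the infimum of $e(Q,\mathbf F_d)$ over all rules $Q(f)=\sum_{i=1}^n\lambda_if(x^i)$ with arbitrary $x^i\in[0,1]^d$ and $\lambda_i\in\mathbb R$. Frolov's rule is $Q_n(f)=\frac1n\sum_{x\in\mathbb X_n\cap[0,1)^d}f(x)$ with $\mathbb X_n=T_n(\mathbb Z^d)$, $T_n=(n\det\widetilde T)^{-1/d}\,\widetilde T$, $\widetilde T=(\xi_i^{j-1})_{i,j=1}^d$,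 where $\xi_1<\dots<\xi_d$ are the roots of $\prod_{j=1}^d(t-2j+1)-1$; it does not depend on $s,p,\theta$. For sequences, $a_n\lesssim b_n$ means $a_n\le C\,b_n$ for all $n\ge2$ with a constant $C<\infty$ independent of $n$ (it may depend on $d,s,p,\theta,\Psi_0,\Psi_1$), and $a_n\asymp b_n$ means $a_n\lesssim b_n\lesssim a_n$. **Theorem.** Frolov's rule uses $|\mathbb X_n\cap[0,1)^d|\asymp n$ nodes, $n\ge 2$. Moreover: (B) If $s>1/p$, then every element of $\mathring{\mathbf B}^s_{p,\theta}$ is a continuous function, and $$\mathrm{Int}_n(\mathring{\mathbf B}^s_{p,\theta})\asymp n^{-s}(\log n)^{(d-1)(1-1/\theta)},\qquad e(Q_n,\mathring{\mathbf B}^s_{p,\theta})\lesssim n^{-s}(\log n)^{(d-1)(1-1/\theta)},\qquad n\ge2.$$ (F) If $p<\infty$ and $s>\max\{1/p,1/\theta\}$, then every element of $\mathring{\mathbf F}^s_{p,\theta}$ is a continuous function, and $$\mathrm{Int}_n(\mathring{\mathbf F}^s_{p,\theta})\asymp n^{-s}(\log n)^{(d-1)(1-1/\theta)},\qquad e(Q_n,\mathring{\mathbf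 F}^s_{p,\theta})\lesssim n^{-s}(\log n)^{(d-1)(1-1/\theta)},\qquad n\ge2.$$ -/

import Mathlib

open MeasureTheory
open scoped ENNReal NNReal SchwartzMap FourierTransform ContDiff

noncomputable section

namespace MixedSmoothness

/-- Points of `ℝ^d`, with the Euclidean norm and Lebesgue measure. -/
abbrev Pt (d : ℕ) : Type := EuclideanSpace ℝ (Fin d)

/-- The closed unit cube `[0,1]^d`. -/
def unitCube (d : ℕ) : Set (Pt d) := {x | ∀ i, x i ∈ Set.Icc (0 : ℝ) 1}

/-! ### Local means -/

/-- A pair of kernels `Ψ₀, Ψ₁ ∈ C₀^∞(ℝ)` with `|𝓕 Ψ₀| > 0` on `|ξ| < ε`, `|𝓕 Ψ₁| > 0` on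
`ε / 2 < |ξ| < 2 ε` for some `ε > 0`, and `D^α 𝓕 Ψ₁ (0) = 0` for `0 ≤ α ≤ L`.
Here `𝓕 f ξ = ∫ f(y) exp(-2 π i ξ y) dy`. -/
structure LocalMeanKernel (L : ℕ) where
  Ψ₀ : ℝ → ℂ
  Ψ₁ : ℝ → ℂ
  contDiff₀ : ContDiff ℝ ∞ Ψ₀
  contDiff₁ : ContDiff ℝ ∞ Ψ₁
  hasCompactSupport₀ : HasCompactSupport Ψ₀
  hasCompactSupport₁ : HasCompactSupport Ψ₁
  tauberian : ∃ ε : ℝ, 0 < ε ∧ (∀ ξ : ℝ, |ξ| < ε → 𝓕 Ψ₀ ξ ≠ 0) ∧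
    ∀ ξ : ℝ, ε / 2 < |ξ| → |ξ| < 2 * ε → 𝓕 Ψ₁ ξ ≠ 0
  moment : ∀ α : ℕ, α ≤ L → iteratedDeriv α (𝓕 Ψ₁) 0 = 0

namespace LocalMeanKernel

variable {L : ℕ} (K : LocalMeanKernel L)

/-- `Ψ_0` is the first kernel and `Ψ_j(t) = 2^{j-1} Ψ_1(2^{j-1} t)` for `j ≥ 1`. -/
def dilate : ℕ → ℝ → ℂ
  | 0 => K.Ψ₀
  | j + 1 => fun t => 2 ^ j * K.Ψ₁ (2 ^ j * t)

theorem contDiff_dilate (j : ℕ) : ContDiff ℝ ∞ (K.dilate j) := by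
  cases j with
  | zero => exact K.contDiff₀
  | succ j => exact contDiff_const.mul (K.contDiff₁.comp (contDiff_const.mul contDiff_id))

theorem hasCompactSupport_dilate (j : ℕ) : HasCompactSupport (K.dilate j) := by
  cases j with
  | zero => exact K.hasCompactSupport₀
  | succ j =>
    have h : HasCompactSupport (fun t : ℝ => K.Ψ₁ (2 ^ j * t)) :=
      K.hasCompactSupport₁.comp_homeomorph (Homeomorph.mulLeft₀ ((2 : ℝ) ^ j) (by positivity))
    exact h.mul_left

/-- The function `y ↦ Ψ_m(x - y)`, where `Ψ_m(z) = ∏ i, Ψ_{m_i}(z_i)`. -/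
def reflected {d : ℕ} (m : Fin d → ℕ) (x : Pt d) : Pt d → ℂ :=
  fun y => ∏ i, K.dilate (m i) (x i - y i)

theorem contDiff_reflected {d : ℕ} (m : Fin d → ℕ) (x : Pt d) :
    ContDiff ℝ ∞ (K.reflected m x) := by
  refine contDiff_prod fun i _ => (K.contDiff_dilate (m i)).comp ?_
  fun_prop

theorem hasCompactSupport_reflected {d : ℕ} (m : Fin d → ℕ) (x : Pt d) :
    HasCompactSupport (K.reflected m x) := by
  have hc : IsCompact ((WithLp.toLp 2 : (Fin d → ℝ) → Pt d) '' Set.univ.pi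
      fun i => (fun t : ℝ => x i - t) '' tsupport (K.dilate (m i))) :=
    (isCompact_univ_pi fun i => IsCompact.image (K.hasCompactSupport_dilate (m i))
      (by fun_prop)).image (PiLp.continuous_toLp 2 _)
  refine HasCompactSupport.intro hc fun y hy => ?_
  by_contra hne
  refine hy ⟨fun i => y i, fun i _ => ⟨x i - y i, subset_tsupport _ ?_, by ring⟩, rfl⟩
  exact (Finset.prod_ne_zero_iff.mp hne) i (Finset.mem_univ i)

/-- The function `y ↦ Ψ_m(x - y)` as a Schwartz function. -/
def reflectedSchwartz {d : ℕ} (m : Fin d → ℕ) (x : Pt d) : 𝓢(Pt d, ℂ) :=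
  (K.hasCompactSupport_reflected m x).toSchwartzMap (K.contDiff_reflected m x)

/-- The local mean `(Ψ_m * u)(x) = u(Ψ_m(x - ·))` of a tempered distribution `u`. -/
def localMean {d : ℕ} (u : 𝓢'(Pt d, ℂ)) (m : Fin d → ℕ) (x : Pt d) : ℂ :=
  u (K.reflectedSchwartz m x)

end LocalMeanKernel

/-! ### Besov and Triebel-Lizorkin spaces of dominating mixed smoothness -/

/-- The `ℓ_θ` norm of a family of elements of `[0,∞]`. -/
def seqNorm {ι : Type*} (θ : ℝ≥0∞) (a : ι → ℝ≥0∞) : ℝ≥0∞ :=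
  if θ = ⊤ then ⨆ i, a i else (∑' i, a i ^ θ.toReal) ^ (1 / θ.toReal)

/-- The weight `2^{s |m|₁}`. -/
def weight {d : ℕ} (s : ℝ) (m : Fin d → ℕ) : ℝ≥0∞ :=
  (2 : ℝ≥0∞) ^ (s * ((∑ i, m i : ℕ) : ℝ))

/-- The norm of `𝐁^s_{p,θ}(ℝ^d)` (equal to `∞` off the space). -/
def besovNorm {L : ℕ} (K : LocalMeanKernel L) (d : ℕ) (s : ℝ) (p θ : ℝ≥0∞)
    (u : 𝓢'(Pt d, ℂ)) : ℝ≥0∞ :=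
  seqNorm θ fun m : Fin d → ℕ => weight s m * eLpNorm (K.localMean u m) p volume

/-- The norm of `𝐅^s_{p,θ}(ℝ^d)` (equal to `∞` off the space). -/
def triebelLizorkinNorm {L : ℕ} (K : LocalMeanKernel L) (d : ℕ) (s : ℝ) (p θ : ℝ≥0∞)
    (u : 𝓢'(Pt d, ℂ)) : ℝ≥0∞ :=
  eLpNorm (fun x : Pt d => seqNorm θ fun m : Fin d → ℕ => weight s m * ‖K.localMean u m x‖ₑ)
    p volume

/-- The space of all tempered distributions with finite norm `N` whose support lies in
`[0,1]^d`. -/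
def supportedSpace {d : ℕ} (N : 𝓢'(Pt d, ℂ) → ℝ≥0∞) : Set 𝓢'(Pt d, ℂ) :=
  {u | N u < ⊤ ∧ Distribution.dsupport u ⊆ unitCube d}

/-- The tempered distribution `u` is given by the continuous function `f`. -/
def IsContinuousRep {d : ℕ} (u : 𝓢'(Pt d, ℂ)) (f : Pt d → ℂ) : Prop :=
  Continuous f ∧ ∀ φ : 𝓢(Pt d, ℂ), HasCompactSupport φ → u φ = ∫ x, f x * φ x

/-- The unit ball of `supportedSpace N`, its elements regarded as continuous functions. -/
def unitBall {d : ℕ} (N : 𝓢'(Pt d, ℂ) → ℝ≥0∞) : Set (Pt d → ℂ) :=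
  {f | ∃ u ∈ supportedSpace N, N u ≤ 1 ∧ IsContinuousRep u f}

/-! ### Cubature -/

/-- The worst-case error over `F` of a cubature rule `Q` for the integral over `[0,1]^d`. -/
def worstCaseError {d : ℕ} (Q : (Pt d → ℂ) → ℂ) (F : Set (Pt d → ℂ)) : ℝ≥0∞ :=
  ⨆ f ∈ F, ‖(∫ x in unitCube d, f x) - Q f‖ₑ

/-- The optimal worst-case error `Int_n` over `F`: the infimum over all nodes
`x^1, …, x^n ∈ [0,1]^d` and all real weights. -/
def optimalError {d : ℕ} (F : Set (Pt d → ℂ)) (n : ℕ) : ℝ≥0∞ :=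
  ⨅ (x : Fin n → unitCube d) (w : Fin n → ℝ),
    worstCaseError (fun f => ∑ i, (w i : ℂ) * f (x i)) F

/-- The polynomial `∏_{j=1}^d (t - 2 j + 1) - 1`. -/
def frolovPoly (d : ℕ) : Polynomial ℝ :=
  ∏ j ∈ Finset.Icc 1 d, (Polynomial.X - Polynomial.C (2 * (j : ℝ) - 1)) - 1

/-- The roots `ξ_1 < … < ξ_d` of `frolovPoly d`; there are exactly `d` of them, so that the default
value of `getD` is not used. -/
def frolovRoot (d : ℕ) (i : Fin d) : ℝ :=
  ((frolovPoly d).roots.sort (· ≤ ·)).getD i 0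

/-- The Vandermonde matrix `(ξ_i^{j-1})`. -/
def frolovVandermonde (d : ℕ) : Matrix (Fin d) (Fin d) ℝ :=
  Matrix.of fun i j => frolovRoot d i ^ (j : ℕ)

/-- The generator `T_n = (n det T)^{-1/d} T`, where `T` is the Vandermonde matrix; as the roots
increase, `det T > 0`, and `det T_n = 1 / n`. -/
def frolovMatrix (d n : ℕ) : Matrix (Fin d) (Fin d) ℝ :=
  ((n : ℝ) * (frolovVandermonde d).det) ^ (-(1 / (d : ℝ))) • frolovVandermonde d

/-- The Frolov nodes `T_n(ℤ^d) ∩ [0,1)^d`. -/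
def frolovNodes (d n : ℕ) : Set (Pt d) :=
  {x | (∃ k : Fin d → ℤ, x = WithLp.toLp 2 ((frolovMatrix d n).mulVec fun i => (k i : ℝ))) ∧
    ∀ i, x i ∈ Set.Ico (0 : ℝ) 1}

/-- Frolov's cubature rule: `1 / n` times the (finite) sum of `f` over the Frolov nodes. -/
def frolovRule (d n : ℕ) (f : Pt d → ℂ) : ℂ :=
  (1 / (n : ℂ)) * ∑ᶠ x ∈ frolovNodes d n, f x

/-! ### Orders of magnitude -/

/-- `a_n ≲ b_n`, `n ≥ 2`. -/
def Lesssim (a b : ℕ → ℝ≥0∞) : Prop := ∃ C : ℝ≥0, ∀ n : ℕ, 2 ≤ n → a n ≤ C * b n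

/-- `a_n ≍ b_n`, `n ≥ 2`. -/
def SameOrder (a b : ℕ → ℝ≥0∞) : Prop := Lesssim a b ∧ Lesssim b a

/-- The rate `n^{-s} (log n)^{(d-1)(1-1/θ)}`. -/
def rate (d : ℕ) (s : ℝ) (θ : ℝ≥0∞) (n : ℕ) : ℝ≥0∞ :=
  ENNReal.ofReal ((n : ℝ) ^ (-s) * Real.log n ^ (((d : ℝ) - 1) * (1 - (1 / θ).toReal)))

end MixedSmoothness

end

open MixedSmoothness

noncomputable section

namespace MixedSmoothness

/-! ### Algebra of the Frolov polynomial -/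

section FrolovPolynomial

open Polynomial

/-- `frolovPoly` over the integers. -/
def frolovPolyInt (d : ℕ) : ℤ[X] :=
  ∏ j ∈ Finset.Icc 1 d, (X - C (2 * (j : ℤ) - 1)) - 1

theorem frolovPolyInt_map (d : ℕ) :
    (frolovPolyInt d).map (Int.castRingHom ℝ) = frolovPoly d := by
  simp only [frolovPolyInt, frolovPoly, Polynomial.map_prod, Polynomial.map_sub, map_X, map_C,
    Polynomial.map_one]
  simp

theorem natDegree_prod_X_sub_odd (d : ℕ) :
    (∏ j ∈ Finset.Icc 1 d, (X - C (2 * (j : ℤ) - 1))).natDegree = d := by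
  rw [natDegree_prod_of_monic _ _ fun j _ => monic_X_sub_C _]
  simp only [natDegree_X_sub_C]
  simp

theorem frolovPolyInt_natDegree (d : ℕ) : (frolovPolyInt d).natDegree = d := by
  rw [frolovPolyInt, show (1 : ℤ[X]) = C 1 from rfl, natDegree_sub_C, natDegree_prod_X_sub_odd]

theorem frolovPolyInt_monic {d : ℕ} (hd : 1 ≤ d) : (frolovPolyInt d).Monic := by
  have hm : (∏ j ∈ Finset.Icc 1 d, (X - C (2 * (j : ℤ) - 1))).Monic :=
    monic_prod_of_monic _ _ fun j _ => monic_X_sub_C _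
  refine hm.sub_of_left ?_
  rw [degree_one, degree_eq_natDegree hm.ne_zero, natDegree_prod_X_sub_odd]
  exact_mod_cast hd

theorem frolovPolyInt_eval {d : ℕ} {j : ℕ} (h1 : 1 ≤ j) (h2 : j ≤ d) :
    (frolovPolyInt d).eval (2 * (j : ℤ) - 1) = -1 := by
  rw [frolovPolyInt, eval_sub, eval_prod, Finset.prod_eq_zero (i := j) (by simp [h1, h2]) (by simp)]
  simp

theorem frolovPolyInt_irreducible {d : ℕ} (hd : 1 ≤ d) : Irreducible (frolovPolyInt d) := by
  have hmon := frolovPolyInt_monic hd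
  have hdeg := frolovPolyInt_natDegree d
  refine (hmon.irreducible_iff_natDegree' ).2 ⟨?_, ?_⟩
  · intro h
    rw [h] at hdeg
    simp at hdeg
    omega
  · rintro f g hf hg hfg hmem
    rw [Finset.mem_Ioc, hdeg] at hmem
    have hsum : f.natDegree + g.natDegree = d := by
      rw [← hf.natDegree_mul hg, hfg, hdeg]
    have hzero : f + g = 0 := by
      refine eq_zero_of_natDegree_lt_card_of_eval_eq_zero' (f + g)
        ((Finset.Icc 1 d).image fun j : ℕ => 2 * (j : ℤ) - 1) ?_ ?_
      · intro x hx
        obtain ⟨j, hj, rfl⟩ := Finset.mem_image.1 hx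
        rw [Finset.mem_Icc] at hj
        have h := frolovPolyInt_eval hj.1 hj.2
        rw [← hfg, eval_mul] at h
        rw [eval_add]
        rcases Int.eq_one_or_neg_one_of_mul_eq_neg_one h with h' | h' <;> rw [h'] at h ⊢ <;> omega
      · rw [Finset.card_image_of_injective _ (fun a b h => by simpa using h)]
        refine lt_of_le_of_lt (natDegree_add_le _ _) ?_
        simp only [Nat.card_Icc]
        omega
    have hpos : 0 < (f + g).leadingCoeff := by
      rcases lt_trichotomy f.natDegree g.natDegree with h | h | h
      · rw [leadingCoeff_add_of_degree_lt (degree_lt_degree h), hg.leadingCoeff]; exact one_pos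
      · rw [leadingCoeff_add_of_degree_eq (by
          rw [degree_eq_natDegree hf.ne_zero, degree_eq_natDegree hg.ne_zero, h])
          (by rw [hf.leadingCoeff, hg.leadingCoeff]; norm_num), hf.leadingCoeff, hg.leadingCoeff]
        norm_num
      · rw [leadingCoeff_add_of_degree_lt' (degree_lt_degree h), hf.leadingCoeff]; exact one_pos
    rw [hzero] at hpos
    simp at hpos

theorem frolovPoly_eval (d : ℕ) (t : ℝ) :
    (frolovPoly d).eval t = ∏ i ∈ Finset.Icc 1 d, (t - (2 * (i : ℝ) - 1)) - 1 := by
  simp [frolovPoly, eval_prod]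

/-- Sign of the product at the even points. -/
theorem neg_one_pow_mul_prod {d j : ℕ} (_hj : j ≤ d) :
    (-1 : ℝ) ^ (d - j) * ∏ i ∈ Finset.Icc 1 d, (2 * (j : ℝ) - (2 * (i : ℝ) - 1)) =
      ∏ i ∈ Finset.Icc 1 d, |2 * (j : ℝ) - (2 * (i : ℝ) - 1)| := by
  have h1 : (-1 : ℝ) ^ (d - j) = ∏ i ∈ Finset.Icc 1 d, if j < i then (-1 : ℝ) else 1 := by
    rw [Finset.prod_ite]
    have : (Finset.Icc 1 d).filter (fun i => j < i) = Finset.Icc (j + 1) d := by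
      ext i; simp; omega
    simp [this]
  rw [h1, ← Finset.prod_mul_distrib]
  refine Finset.prod_congr rfl fun i _ => ?_
  split_ifs with h
  · have : (j : ℝ) + 1 ≤ i := by exact_mod_cast h
    rw [abs_of_neg (by linarith)]; ring
  · have : (i : ℝ) ≤ j := by exact_mod_cast not_lt.1 h
    rw [abs_of_pos (by linarith)]; ring

theorem one_le_abs_even_sub_odd (j i : ℕ) : 1 ≤ |2 * (j : ℝ) - (2 * (i : ℝ) - 1)| := by
  rcases lt_or_ge j i with h | h
  · have : (j : ℝ) + 1 ≤ i := by exact_mod_cast h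
    rw [abs_of_neg (by linarith)]; linarith
  · have : (i : ℝ) ≤ j := by exact_mod_cast h
    rw [abs_of_pos (by linarith)]; linarith

/-- Points at which `frolovPoly` takes alternating signs. -/
def signPoint (d j : ℕ) : ℝ := if j < d then 2 * (j : ℝ) else 2 * (d : ℝ) + 1

theorem signPoint_strictMono (d : ℕ) {j k : ℕ} (h : j < k) (hk : k ≤ d) :
    signPoint d j < signPoint d k := by
  have h1 : (j : ℝ) + 1 ≤ k := by exact_mod_cast h
  have h2 : (k : ℝ) ≤ d := by exact_mod_cast hk
  unfold signPoint
  rw [if_pos (by omega)]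
  split_ifs <;> linarith

theorem frolovPoly_sign {d j : ℕ} (hj : j ≤ d) (hd : 1 ≤ d) :
    0 < (-1 : ℝ) ^ (d - j) * (frolovPoly d).eval (signPoint d j) := by
  rw [frolovPoly_eval]
  rcases hj.lt_or_eq with h | rfl
  · rw [signPoint, if_pos h, mul_sub, neg_one_pow_mul_prod hj, mul_one]
    rcases Nat.even_or_odd (d - j) with he | ho
    · rw [he.neg_one_pow, sub_pos]
      have hd2 : j + 2 ≤ d := by
        rcases he with ⟨r, hr⟩; omega
      have hd3 : (j : ℝ) + 2 ≤ d := by exact_mod_cast hd2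
      rw [← Finset.mul_prod_erase _ _ (Finset.mem_Icc.2 ⟨hd, le_rfl⟩)]
      have h1 : (1 : ℝ) ≤ ∏ i ∈ (Finset.Icc 1 d).erase d, |2 * (j : ℝ) - (2 * (i : ℝ) - 1)| :=
        Finset.one_le_prod fun i _ => one_le_abs_even_sub_odd j i
      have h2 : (3 : ℝ) ≤ |2 * (j : ℝ) - (2 * (d : ℝ) - 1)| := by
        rw [abs_of_neg (by linarith)]; linarith
      nlinarith
    · rw [ho.neg_one_pow]
      have : (0 : ℝ) ≤ ∏ i ∈ Finset.Icc 1 d, |2 * (j : ℝ) - (2 * (i : ℝ) - 1)| := by positivity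
      linarith
  · rw [signPoint, if_neg (lt_irrefl _)]
    simp only [Nat.sub_self, pow_zero, one_mul, sub_pos]
    rw [← Finset.mul_prod_erase _ _ (Finset.mem_Icc.2 ⟨hd, le_rfl⟩)]
    have h1 : (1 : ℝ) ≤ ∏ i ∈ (Finset.Icc 1 j).erase j, (2 * (j : ℝ) + 1 - (2 * (i : ℝ) - 1)) := by
      refine Finset.one_le_prod fun i hi => ?_
      have : (i : ℝ) ≤ j := by
        exact_mod_cast (Finset.mem_Icc.1 (Finset.mem_of_mem_erase hi)).2
      linarith
    nlinarith

theorem exists_root_between {d j : ℕ} (hj : j < d) :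
    ∃ x ∈ Set.Ioo (signPoint d j) (signPoint d (j + 1)), (frolovPoly d).eval x = 0 := by
  have h1 := frolovPoly_sign (d := d) (j := j) hj.le (by omega)
  have h2 := frolovPoly_sign (d := d) (j := j + 1) hj (by omega)
  have hlt := signPoint_strictMono d (Nat.lt_succ_self j) hj
  have hc : ContinuousOn (fun x => (frolovPoly d).eval x)
      (Set.Icc (signPoint d j) (signPoint d (j + 1))) := (frolovPoly d).continuous.continuousOn
  rw [show d - j = d - (j + 1) + 1 by omega, pow_succ] at h1
  rcases neg_one_pow_eq_or ℝ (d - (j + 1)) with h | h <;> rw [h] at h1 h2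
  · obtain ⟨x, hx, h⟩ := intermediate_value_Ioo hlt.le hc (show (0 : ℝ) ∈ _ from
      ⟨by simpa using h1, by simpa using h2⟩)
    exact ⟨x, hx, h⟩
  · obtain ⟨x, hx, h⟩ := intermediate_value_Ioo' hlt.le hc (show (0 : ℝ) ∈ _ from
      ⟨by simpa using h2, by simpa using h1⟩)
    exact ⟨x, hx, h⟩

theorem frolovPoly_natDegree (d : ℕ) : (frolovPoly d).natDegree = d := by
  rw [← frolovPolyInt_map, natDegree_map_eq_of_injective (RingHom.injective_int _),
    frolovPolyInt_natDegree]

theorem frolovPoly_monic {d : ℕ} (hd : 1 ≤ d) : (frolovPoly d).Monic := by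
  rw [← frolovPolyInt_map]; exact (frolovPolyInt_monic hd).map _

theorem frolovPoly_roots {d : ℕ} (hd : 1 ≤ d) :
    (frolovPoly d).roots.card = d ∧ (frolovPoly d).roots.Nodup := by
  have hex : ∀ j : Fin d, ∃ x ∈ Set.Ioo (signPoint d j) (signPoint d (j + 1)),
      (frolovPoly d).eval x = 0 := fun j => exists_root_between j.2
  choose x hx hroot using hex
  have hmono : StrictMono x := by
    intro j k hjk
    have h : (j : ℕ) + 1 ≤ k := hjk
    refine (hx j).2.trans_le (le_trans ?_ (hx k).1.le)
    rcases h.eq_or_lt with h | h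
    · rw [h]
    · exact (signPoint_strictMono d h (by omega)).le
  have hne := (frolovPoly_monic hd).ne_zero
  have h1 : d ≤ (frolovPoly d).roots.toFinset.card := by
    calc d = (Finset.univ.image x).card := by
            rw [Finset.card_image_of_injective _ hmono.injective]; simp
      _ ≤ _ := Finset.card_le_card fun y hy => by
            obtain ⟨j, -, rfl⟩ := Finset.mem_image.1 hy
            rw [Multiset.mem_toFinset, mem_roots hne]
            exact hroot j
  have h2 : (frolovPoly d).roots.card ≤ d := by
    simpa [frolovPoly_natDegree] using (frolovPoly d).card_roots'
  have h3 := Multiset.toFinset_card_le (frolovPoly d).roots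
  refine ⟨by omega, Multiset.toFinset_card_eq_card_iff_nodup.1 (by omega)⟩

theorem frolovRoot_spec {d : ℕ} (hd : 1 ≤ d) :
    StrictMono (frolovRoot d) ∧ ∀ i, (frolovPoly d).eval (frolovRoot d i) = 0 := by
  obtain ⟨hc, hn⟩ := frolovPoly_roots hd
  have hlen : ((frolovPoly d).roots.sort (· ≤ ·)).length = d := by simp [hc]
  have hget : ∀ i : Fin d, frolovRoot d i =
      ((frolovPoly d).roots.sort (· ≤ ·))[(i : ℕ)]'(by omega) := fun i => by
    rw [frolovRoot, List.getD_eq_getElem]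
  have hs : ((frolovPoly d).roots.sort (· ≤ ·)).SortedLT :=
    List.sortedLT_iff_nodup_and_sortedLE.2 ⟨by
      rw [← Multiset.coe_nodup, Multiset.sort_eq]; exact hn, (Multiset.pairwise_sort _ _).sortedLE⟩
  constructor
  · intro i j hij
    rw [hget, hget]
    exact hs.strictMono_get (a := ⟨i, by omega⟩) (b := ⟨j, by omega⟩) hij
  · intro i
    have : frolovRoot d i ∈ (frolovPoly d).roots := by
      rw [← Multiset.mem_sort (r := (· ≤ ·)), hget]
      exact List.getElem_mem _
    exact (mem_roots'.1 this).2

theorem frolovVandermonde_eq (d : ℕ) :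
    frolovVandermonde d = Matrix.vandermonde (frolovRoot d) := rfl

theorem frolovVandermonde_det_pos {d : ℕ} (hd : 1 ≤ d) : 0 < (frolovVandermonde d).det := by
  rw [frolovVandermonde_eq, Matrix.det_vandermonde]
  refine Finset.prod_pos fun i _ => Finset.prod_pos fun j hj => ?_
  exact sub_pos.2 ((frolovRoot_spec hd).1 (Finset.mem_Ioi.1 hj))


theorem eval_frolovRoot_ne_zero {d : ℕ} (hd : 1 ≤ d) {q : ℤ[X]} (hq : q ≠ 0)
    (hdeg : q.natDegree < d) (i : Fin d) : q.aeval (frolovRoot d i) ≠ 0 := by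
  intro h
  have hP : (frolovPolyInt d).aeval (frolovRoot d i) = 0 := by
    rw [← eval_map_algebraMap, algebraMap_int_eq, frolovPolyInt_map]
    exact (frolovRoot_spec hd).2 i
  have hint : IsIntegral ℤ (frolovRoot d i) := ⟨_, frolovPolyInt_monic hd, by
    rwa [← aeval_def]⟩
  have h1 := minpoly.isIntegrallyClosed_dvd hint h
  have h2 := minpoly.isIntegrallyClosed_dvd hint hP
  have h3 : Associated (minpoly ℤ (frolovRoot d i)) (frolovPolyInt d) :=
    ((frolovPolyInt_irreducible hd).dvd_iff.1 h2).resolve_left (minpoly.not_isUnit _ _) |>.symm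
  have h4 := natDegree_le_of_dvd (h3.dvd_iff_dvd_left.1 h1) hq
  rw [frolovPolyInt_natDegree] at h4
  omega

/-- The companion matrix of `frolovPolyInt d`, acting on the rows of the Vandermonde matrix. -/
def frolovCompanion (d : ℕ) : Matrix (Fin d) (Fin d) ℤ :=
  Matrix.of fun i j => if (j : ℕ) + 1 < d then if (i : ℕ) = j + 1 then 1 else 0
    else -(frolovPolyInt d).coeff i

theorem vandermonde_mul_companion {d : ℕ} (hd : 1 ≤ d) :
    frolovVandermonde d * (frolovCompanion d).map (Int.castRingHom ℝ) =
      Matrix.diagonal (frolovRoot d) * frolovVandermonde d := by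
  ext a j
  rw [Matrix.diagonal_mul, Matrix.mul_apply]
  simp only [frolovVandermonde, frolovCompanion, Matrix.of_apply, Matrix.map_apply]
  rw [← pow_succ']
  split_ifs with h
  · rw [Finset.sum_eq_single ⟨j + 1, h⟩]
    · simp
    · intro b _ hb
      rw [if_neg fun hb' => hb (Fin.ext hb')]
      simp
    · simp
  · have hj : (j : ℕ) + 1 = d := by omega
    have hroot := (frolovRoot_spec hd).2 a
    rw [(frolovPoly_monic hd).as_sum, frolovPoly_natDegree] at hroot
    simp only [eval_add, eval_pow, eval_X, eval_finsetSum, eval_mul, eval_C] at hroot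
    rw [hj, eq_neg_of_add_eq_zero_left hroot, ← Fin.sum_univ_eq_sum_range
      (fun i => (frolovPoly d).coeff i * frolovRoot d a ^ i), ← Finset.sum_neg_distrib]
    refine Finset.sum_congr rfl fun i _ => ?_
    rw [← frolovPolyInt_map, coeff_map]
    simp
    ring

theorem vandermonde_mul_companion_pow {d : ℕ} (hd : 1 ≤ d) (m : ℕ) :
    frolovVandermonde d * ((frolovCompanion d) ^ m).map (Int.castRingHom ℝ) =
      Matrix.diagonal (frolovRoot d) ^ m * frolovVandermonde d := by
  induction m with
  | zero => simp
  | succ m ih =>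
    rw [pow_succ, Matrix.map_mul, ← Matrix.mul_assoc, ih, Matrix.mul_assoc,
      vandermonde_mul_companion hd, ← Matrix.mul_assoc, ← pow_succ]

theorem isUnit_det_frolovVandermonde {d : ℕ} (hd : 1 ≤ d) : IsUnit (frolovVandermonde d).det :=
  (frolovVandermonde_det_pos hd).ne'.isUnit

theorem diagonal_frolovRoot_pow {d : ℕ} (hd : 1 ≤ d) (m : ℕ) :
    Matrix.diagonal (fun i => frolovRoot d i ^ m) =
      frolovVandermonde d * ((frolovCompanion d) ^ m).map (Int.castRingHom ℝ) *
        (frolovVandermonde d)⁻¹ := by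
  rw [vandermonde_mul_companion_pow hd, Matrix.mul_assoc,
    Matrix.mul_nonsing_inv _ (isUnit_det_frolovVandermonde hd), Matrix.mul_one,
    Matrix.diagonal_pow]
  rfl

/-- Power sums of the roots are integers. -/
theorem frolovRoot_powerSum {d : ℕ} (hd : 1 ≤ d) (m : ℕ) :
    ∑ i, frolovRoot d i ^ m = (((frolovCompanion d) ^ m).trace : ℝ) := by
  rw [← Matrix.trace_diagonal, diagonal_frolovRoot_pow hd, Matrix.trace_mul_comm,
    ← Matrix.mul_assoc, Matrix.nonsing_inv_mul _ (isUnit_det_frolovVandermonde hd), Matrix.one_mul]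
  simp [Matrix.trace]

/-- The product of the coordinates of a vector in the Vandermonde lattice is an integer. -/
theorem prod_frolovVandermonde_mulVec {d : ℕ} (hd : 1 ≤ d) (k : Fin d → ℤ) :
    ∏ i, (frolovVandermonde d).mulVec (fun j => (k j : ℝ)) i =
      ((∑ j, k j • frolovCompanion d ^ (j : ℕ)).det : ℝ) := by
  have h1 : Matrix.diagonal ((frolovVandermonde d).mulVec (fun j => (k j : ℝ))) =
      frolovVandermonde d *
        (∑ j, k j • frolovCompanion d ^ (j : ℕ)).map (Int.castRingHom ℝ) *
        (frolovVandermonde d)⁻¹ := by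
    have : (∑ j, k j • frolovCompanion d ^ (j : ℕ)).map (Int.castRingHom ℝ) =
        ∑ j, (k j : ℝ) • ((frolovCompanion d ^ (j : ℕ)).map (Int.castRingHom ℝ)) := by
      ext a b
      simp only [Matrix.map_apply, Matrix.sum_apply, Matrix.smul_apply, smul_eq_mul, map_sum,
        map_mul, eq_intCast]
    rw [this, Finset.mul_sum, Finset.sum_mul]
    simp_rw [Matrix.mul_smul, Matrix.smul_mul, ← diagonal_frolovRoot_pow hd]
    ext a b
    rw [Matrix.sum_apply]
    simp only [Matrix.smul_apply, Matrix.diagonal_apply]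
    split_ifs with h
    · simp only [Matrix.mulVec, dotProduct, frolovVandermonde, Matrix.of_apply, smul_eq_mul]
      exact Finset.sum_congr rfl fun j _ => mul_comm _ _
    · simp
  rw [← Matrix.det_diagonal, h1, Matrix.det_mul_right_comm,
    Matrix.mul_nonsing_inv _ (isUnit_det_frolovVandermonde hd), Matrix.one_mul]
  exact (RingHom.map_det (Int.castRingHom ℝ) _).symm

theorem one_le_abs_prod_frolovVandermonde_mulVec {d : ℕ} (hd : 1 ≤ d) {k : Fin d → ℤ}
    (hk : k ≠ 0) : 1 ≤ |∏ i, (frolovVandermonde d).mulVec (fun j => (k j : ℝ)) i| := by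
  have hne : ∏ i, (frolovVandermonde d).mulVec (fun j => (k j : ℝ)) i ≠ 0 := by
    refine Finset.prod_ne_zero_iff.2 fun i _ => ?_
    set q : ℤ[X] := ∑ j : Fin d, C (k j) * X ^ (j : ℕ) with hq
    have hcoeff : ∀ j : Fin d, q.coeff j = k j := fun j => by
      rw [hq, finsetSum_coeff, Finset.sum_eq_single j]
      · simp
      · intro b _ hb
        rw [coeff_C_mul, coeff_X_pow, if_neg fun h => hb (Fin.ext h.symm), mul_zero]
      · simp
    have hq0 : q ≠ 0 := fun h => hk <| by
      ext j
      rw [← hcoeff, h]; simp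
    have hdeg : q.natDegree < d := by
      refine lt_of_le_of_lt (natDegree_sum_le_of_forall_le (n := d - 1) _ _ fun j _ => ?_)
        (by omega)
      exact (natDegree_C_mul_X_pow_le _ _).trans (by omega)
    convert eval_frolovRoot_ne_zero hd hq0 hdeg i using 1
    simp only [Matrix.mulVec, dotProduct, frolovVandermonde, Matrix.of_apply, hq, map_sum,
      map_mul, map_pow, aeval_C, aeval_X]
    exact Finset.sum_congr rfl fun j _ => by simp [mul_comm]
  rw [prod_frolovVandermonde_mulVec hd] at hne ⊢
  rw [← Int.cast_abs]
  exact_mod_cast Int.one_le_abs (by exact_mod_cast hne)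

/-- The Gram matrix of the Vandermonde matrix has integer entries. -/
def frolovGram (d : ℕ) : Matrix (Fin d) (Fin d) ℤ :=
  Matrix.of fun a b => (frolovCompanion d ^ ((a : ℕ) + b)).trace

theorem frolovGram_map {d : ℕ} (hd : 1 ≤ d) :
    (frolovGram d).map (Int.castRingHom ℝ) =
      (frolovVandermonde d).transpose * frolovVandermonde d := by
  ext a b
  rw [Matrix.mul_apply]
  simp only [frolovGram, frolovVandermonde, Matrix.map_apply, Matrix.of_apply,
    Matrix.transpose_apply, ← pow_add]
  exact (frolovRoot_powerSum hd _).symm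

theorem frolovGram_det_ne_zero {d : ℕ} (hd : 1 ≤ d) : (frolovGram d).det ≠ 0 := by
  intro h
  have h1 : ((frolovGram d).map (Int.castRingHom ℝ)).det = 0 := by
    have := RingHom.map_det (Int.castRingHom ℝ) (frolovGram d)
    rw [h, map_zero] at this
    exact this.symm
  rw [frolovGram_map hd, Matrix.det_mul, Matrix.det_transpose] at h1
  have := frolovVandermonde_det_pos hd
  nlinarith

/-- The Vandermonde lattice is contained, up to scaling, in its dual. -/
theorem le_abs_prod_dual_frolovVandermonde {d : ℕ} (hd : 1 ≤ d) {k : Fin d → ℤ} (hk : k ≠ 0) :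
    (|((frolovGram d).det : ℝ)| ^ d)⁻¹ ≤
      |∏ i, ((frolovVandermonde d)⁻¹.transpose).mulVec (fun j => (k j : ℝ)) i| := by
  set T := frolovVandermonde d with hT
  set S := frolovGram d with hS
  have hdet : ((S.det : ℤ) : ℝ) ≠ 0 := by exact_mod_cast frolovGram_det_ne_zero hd
  have hU := isUnit_det_frolovVandermonde hd
  have hadj : S.mulVec (S.adjugate.mulVec k) = S.det • k := by
    rw [Matrix.mulVec_mulVec, Matrix.mul_adjugate, Matrix.smul_mulVec, Matrix.one_mulVec]
  have hk' : S.adjugate.mulVec k ≠ 0 := fun h => by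
    rw [h, Matrix.mulVec_zero] at hadj
    exact (smul_ne_zero (frolovGram_det_ne_zero hd) hk) hadj.symm
  have hmain : T.mulVec (fun j => ((S.adjugate.mulVec k j : ℤ) : ℝ)) =
      (S.det : ℝ) • (T⁻¹.transpose).mulVec (fun j => (k j : ℝ)) := by
    have h1 : (T.transpose * T).mulVec (fun j => ((S.adjugate.mulVec k j : ℤ) : ℝ)) =
        (S.det : ℝ) • (fun j => (k j : ℝ)) := by
      rw [hT, ← frolovGram_map hd]
      ext j
      have := congrFun hadj j
      simp only [Matrix.mulVec, dotProduct, Matrix.map_apply, Pi.smul_apply, smul_eq_mul,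
        eq_intCast] at this ⊢
      exact_mod_cast this
    rw [← Matrix.mulVec_smul, ← h1, Matrix.mulVec_mulVec, ← Matrix.mul_assoc,
      ← Matrix.transpose_mul, Matrix.mul_nonsing_inv _ hU, Matrix.transpose_one, Matrix.one_mul]
  have h2 := one_le_abs_prod_frolovVandermonde_mulVec hd hk'
  rw [← hT, hmain] at h2
  simp only [Pi.smul_apply, smul_eq_mul, Finset.prod_mul_distrib, Finset.prod_const,
    Finset.card_univ, Fintype.card_fin, abs_mul, abs_pow] at h2
  rw [inv_le_iff_one_le_mul₀ (by positivity), mul_comm]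
  exact h2

/-! ### The scaled lattice -/

theorem frolovMatrix_scale_pow {d n : ℕ} (hd : 1 ≤ d) (hn : 1 ≤ n) :
    (((n : ℝ) * (frolovVandermonde d).det) ^ (-(1 / (d : ℝ)))) ^ d =
      ((n : ℝ) * (frolovVandermonde d).det)⁻¹ := by
  have h0 : 0 < (n : ℝ) * (frolovVandermonde d).det :=
    mul_pos (by exact_mod_cast hn) (frolovVandermonde_det_pos hd)
  have : (d : ℝ) ≠ 0 := by positivity
  rw [← Real.rpow_natCast, ← Real.rpow_mul h0.le, ← Real.rpow_neg_one]
  congr 1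
  field_simp

theorem frolovMatrix_scale_pos {d n : ℕ} (hd : 1 ≤ d) (hn : 1 ≤ n) :
    0 < ((n : ℝ) * (frolovVandermonde d).det) ^ (-(1 / (d : ℝ))) :=
  Real.rpow_pos_of_pos (mul_pos (by exact_mod_cast hn) (frolovVandermonde_det_pos hd)) _

theorem frolovMatrix_det {d n : ℕ} (hd : 1 ≤ d) (hn : 1 ≤ n) :
    (frolovMatrix d n).det = (n : ℝ)⁻¹ := by
  rw [frolovMatrix, Matrix.det_smul, Fintype.card_fin, frolovMatrix_scale_pow hd hn, mul_inv,
    mul_assoc, inv_mul_cancel₀ (frolovVandermonde_det_pos hd).ne', mul_one]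

theorem exists_frolovMatrix_admissible {d : ℕ} (hd : 1 ≤ d) :
    ∃ c : ℝ, 0 < c ∧ ∀ n : ℕ, 1 ≤ n → ∀ k : Fin d → ℤ, k ≠ 0 →
      c / n ≤ |∏ i, (frolovMatrix d n).mulVec (fun j => (k j : ℝ)) i| ∧
      c * n ≤ |∏ i, ((frolovMatrix d n)⁻¹.transpose).mulVec (fun j => (k j : ℝ)) i| := by
  have hD := frolovVandermonde_det_pos hd
  set D := (frolovVandermonde d).det with hDdef
  set g := (|((frolovGram d).det : ℝ)| ^ d)⁻¹ with hg
  have hgpos : 0 < g := by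
    have : ((frolovGram d).det : ℝ) ≠ 0 := by exact_mod_cast frolovGram_det_ne_zero hd
    positivity
  refine ⟨min D⁻¹ (g * D), by positivity, fun n hn k hk => ?_⟩
  have hn0 : (0 : ℝ) < n := by exact_mod_cast hn
  have hsp := frolovMatrix_scale_pos hd hn
  have hpow := frolovMatrix_scale_pow hd hn
  set τ := ((n : ℝ) * (frolovVandermonde d).det) ^ (-(1 / (d : ℝ))) with hτ
  have hinv : (frolovMatrix d n)⁻¹ = τ⁻¹ • (frolovVandermonde d)⁻¹ := by
    rw [frolovMatrix, ← hτ]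
    refine Matrix.inv_eq_left_inv ?_
    rw [Matrix.smul_mul, Matrix.mul_smul, smul_smul, inv_mul_cancel₀ hsp.ne', one_smul,
      Matrix.nonsing_inv_mul _ (isUnit_det_frolovVandermonde hd)]
  have habs : |τ| = τ := abs_of_pos hsp
  constructor
  · rw [frolovMatrix, ← hτ, Matrix.smul_mulVec]
    simp only [Pi.smul_apply, smul_eq_mul, Finset.prod_mul_distrib, Finset.prod_const,
      Finset.card_univ, Fintype.card_fin, abs_mul, abs_pow, habs]
    rw [hpow, mul_inv, ← hDdef, div_eq_mul_inv]
    have h1 := one_le_abs_prod_frolovVandermonde_mulVec hd hk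
    calc min D⁻¹ (g * D) * (n : ℝ)⁻¹ ≤ D⁻¹ * (n : ℝ)⁻¹ := by gcongr; exact min_le_left _ _
      _ = (n : ℝ)⁻¹ * D⁻¹ * 1 := by ring
      _ ≤ _ := by gcongr
  · rw [hinv, Matrix.transpose_smul, Matrix.smul_mulVec]
    simp only [Pi.smul_apply, smul_eq_mul, Finset.prod_mul_distrib, Finset.prod_const,
      Finset.card_univ, Fintype.card_fin, abs_mul, abs_pow, abs_inv, habs]
    rw [inv_pow, hpow, inv_inv, ← hDdef]
    have h1 := le_abs_prod_dual_frolovVandermonde hd hk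
    rw [← hg] at h1
    calc min D⁻¹ (g * D) * (n : ℝ) ≤ (g * D) * n := by gcongr; exact min_le_right _ _
      _ = n * D * g := by ring
      _ ≤ _ := by gcongr

end FrolovPolynomial

/-! ### Counting lattice points -/

/-- The point `A k` of the lattice generated by `A`. -/
def latticePt {d : ℕ} (A : Matrix (Fin d) (Fin d) ℝ) (k : Fin d → ℤ) : Fin d → ℝ :=
  A.mulVec fun j => (k j : ℝ)

theorem latticePt_sub {d : ℕ} (A : Matrix (Fin d) (Fin d) ℝ) (k l : Fin d → ℤ) :
    latticePt A (k - l) = latticePt A k - latticePt A l := by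
  rw [latticePt, latticePt, latticePt, ← Matrix.mulVec_sub]
  congr 1
  ext j
  simp

/-- The lattice generated by `A` is admissible with constant `c`. -/
def IsAdmissible {d : ℕ} (A : Matrix (Fin d) (Fin d) ℝ) (c : ℝ) : Prop :=
  ∀ k : Fin d → ℤ, k ≠ 0 → c ≤ |∏ i, latticePt A k i|

theorem IsAdmissible.encard_box_le {d : ℕ} (hd : 1 ≤ d) {A : Matrix (Fin d) (Fin d) ℝ} {c : ℝ}
    (hc : 0 < c) (hA : IsAdmissible A c) (a ℓ : Fin d → ℝ) (hℓ : ∀ i, 0 < ℓ i) :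
    {k : Fin d → ℤ | ∀ i, latticePt A k i ∈ Set.Ico (a i) (a i + ℓ i)}.encard ≤
      ((⌊(∏ i, ℓ i) / c⌋₊ + 1 : ℕ) : ℕ∞) := by
  set N := ⌊(∏ i, ℓ i) / c⌋₊ + 1 with hN
  have hN0 : (0 : ℝ) < N := by positivity
  have hNlt : (∏ i, ℓ i) / N < c := by
    rw [div_lt_iff₀ hN0, ← div_lt_iff₀' hc, hN]
    push_cast
    exact Nat.lt_floor_add_one _
  set i0 : Fin d := ⟨0, hd⟩
  have key : Set.InjOn (fun k => ⌊(latticePt A k i0 - a i0) / ℓ i0 * N⌋₊)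
      {k : Fin d → ℤ | ∀ i, latticePt A k i ∈ Set.Ico (a i) (a i + ℓ i)} := by
    intro k hk l hl hkl
    by_contra hne
    have h1 := hA (k - l) (sub_ne_zero.2 hne)
    rw [latticePt_sub] at h1
    have hfl : |(latticePt A k i0 - a i0) / ℓ i0 * N - (latticePt A l i0 - a i0) / ℓ i0 * N| ≤ 1 := by
      have hk0 : 0 ≤ (latticePt A k i0 - a i0) / ℓ i0 * N :=
        mul_nonneg (div_nonneg (sub_nonneg.2 (hk i0).1) (hℓ i0).le) hN0.le
      have hl0 : 0 ≤ (latticePt A l i0 - a i0) / ℓ i0 * N :=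
        mul_nonneg (div_nonneg (sub_nonneg.2 (hl i0).1) (hℓ i0).le) hN0.le
      have e1 := Nat.floor_le hk0
      have e2 := Nat.lt_floor_add_one ((latticePt A k i0 - a i0) / ℓ i0 * N)
      have e3 := Nat.floor_le hl0
      have e4 := Nat.lt_floor_add_one ((latticePt A l i0 - a i0) / ℓ i0 * N)
      simp only at hkl
      rw [hkl] at e1 e2
      rw [abs_le]
      constructor <;> linarith
    have h0 : |latticePt A k i0 - latticePt A l i0| ≤ ℓ i0 / N := by
      rw [← sub_mul, ← sub_div, sub_sub_sub_cancel_right, abs_mul, abs_div, abs_of_pos (hℓ i0),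
        abs_of_pos hN0, div_mul_eq_mul_div, div_le_one (hℓ i0)] at hfl
      rwa [le_div_iff₀ hN0]
    have hi : ∀ i, |latticePt A k i - latticePt A l i| ≤ ℓ i := fun i => by
      have e1 := hk i
      have e2 := hl i
      rw [Set.mem_Ico] at e1 e2
      rw [abs_le]
      constructor <;> linarith
    have h2 : |∏ i, (latticePt A k - latticePt A l) i| ≤ (∏ i, ℓ i) / N := by
      rw [Finset.abs_prod, ← Finset.mul_prod_erase _ _ (Finset.mem_univ i0),
        ← Finset.mul_prod_erase _ ℓ (Finset.mem_univ i0), mul_div_right_comm]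
      refine mul_le_mul h0 (Finset.prod_le_prod (fun _ _ => abs_nonneg _) fun i _ => hi i)
        (Finset.prod_nonneg fun _ _ => abs_nonneg _) (div_nonneg (hℓ i0).le hN0.le)
    linarith
  have := Set.encard_le_encard_of_injOn (t := ((Finset.range N : Finset ℕ) : Set ℕ))
    (fun k hk => ?_) key
  · rwa [Set.encard_coe_eq_coe_finsetCard, Finset.card_range] at this
  · rw [Finset.mem_coe, Finset.mem_range, Nat.floor_lt
      (mul_nonneg (div_nonneg (sub_nonneg.2 (hk i0).1) (hℓ i0).le) hN0.le)]
    have e1 := (hk i0).2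
    have : (latticePt A k i0 - a i0) / ℓ i0 < 1 := by
      rw [div_lt_one (hℓ i0)]; linarith
    nlinarith

theorem IsAdmissible.tsum_box_le {d : ℕ} (hd : 1 ≤ d) {A : Matrix (Fin d) (Fin d) ℝ} {c : ℝ}
    (hc : 0 < c) (hA : IsAdmissible A c) (a ℓ : Fin d → ℝ) (hℓ : ∀ i, 0 < ℓ i) :
    ∑' _ : {k : Fin d → ℤ | ∀ i, latticePt A k i ∈ Set.Ico (a i) (a i + ℓ i)}, (1 : ℝ≥0∞) ≤
      ENNReal.ofReal ((∏ i, ℓ i) / c + 1) := by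
  rw [ENNReal.tsum_set_one]
  have h := hA.encard_box_le hd hc a ℓ hℓ
  have hpos : 0 ≤ (∏ i, ℓ i) / c := div_nonneg (Finset.prod_nonneg fun i _ => (hℓ i).le) hc.le
  calc _ ≤ (((⌊(∏ i, ℓ i) / c⌋₊ + 1 : ℕ) : ℕ∞) : ℝ≥0∞) := ENat.toENNReal_mono h
    _ = ENNReal.ofReal ((⌊(∏ i, ℓ i) / c⌋₊ + 1 : ℕ) : ℝ) := by
        rw [ENNReal.ofReal_natCast, ENat.toENNReal_coe]
    _ ≤ _ := ENNReal.ofReal_le_ofReal (by push_cast; gcongr; exact Nat.floor_le hpos)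

/-! ### The decay function `(1 + |t|)⁻²` -/

/-- The function `(1 + |t|)⁻²` with values in `[0, ∞]`. -/
def decay (t : ℝ) : ℝ≥0∞ := ENNReal.ofReal (((1 + |t|) ^ 2)⁻¹)

/-- The sum of `decay` over the integers. -/
def decaySum : ℝ≥0∞ := ∑' q : ℤ, decay q

theorem decaySum_lt_top : decaySum < ⊤ := by
  have h1 : Summable fun q : ℤ => 4 * |((q : ℝ) + 1 / 2)| ^ (-2 : ℝ) :=
    (Real.summable_one_div_int_add_rpow (1 / 2) 2 |>.2 (by norm_num)).mul_left 4 |>.congr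
      fun q => by rw [Real.rpow_neg (abs_nonneg _), one_div]
  refine lt_of_le_of_lt (ENNReal.tsum_le_tsum fun q => ?_)
    (ENNReal.ofReal_tsum_of_nonneg (fun q => by positivity) h1 ▸ ENNReal.ofReal_lt_top)
  refine ENNReal.ofReal_le_ofReal ?_
  have h2 : 0 < |(q : ℝ) + 1 / 2| := by
    rw [abs_pos]
    intro h
    have : (2 * q + 1 : ℤ) = 0 := by
      have : (2 * (q : ℝ) + 1) = 0 := by linarith
      exact_mod_cast this
    omega
  rw [Real.rpow_neg h2.le, Real.rpow_two, show (4 : ℝ) * (|(q : ℝ) + 1 / 2| ^ 2)⁻¹ =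
    ((|(q : ℝ) + 1 / 2| / 2) ^ 2)⁻¹ by field_simp; norm_num]
  gcongr
  have := abs_add_le (q : ℝ) (1 / 2)
  rw [abs_of_pos (show (0 : ℝ) < 1 / 2 by norm_num)] at this
  have := abs_nonneg (q : ℝ)
  linarith

theorem decay_le_floor (t : ℝ) : decay t ≤ 4 * decay ⌊t⌋ := by
  have h4 : (4 : ℝ≥0∞) = ENNReal.ofReal 4 := by simp
  rw [decay, decay, h4, ← ENNReal.ofReal_mul (by norm_num)]
  refine ENNReal.ofReal_le_ofReal ?_
  rw [show (4 : ℝ) * ((1 + |(⌊t⌋ : ℝ)|) ^ 2)⁻¹ = (((1 + |(⌊t⌋ : ℝ)|) / 2) ^ 2)⁻¹ by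
    field_simp; norm_num]
  gcongr
  have h1 := Int.floor_le t
  have h2 := Int.lt_floor_add_one t
  have h3 : |(⌊t⌋ : ℝ)| ≤ |t| + 1 := by
    rw [abs_le]
    have := abs_le.1 (le_refl |t|)
    constructor <;> linarith [this.1, this.2]
  have := abs_nonneg t
  linarith

theorem decay_le_one (t : ℝ) : decay t ≤ 1 := by
  rw [decay, ENNReal.ofReal_le_one]
  refine inv_le_one_of_one_le₀ (one_le_pow₀ ?_)
  linarith [abs_nonneg t]

theorem measurable_decay : Measurable decay := by
  unfold decay; fun_prop

theorem tsum_pi_prod_le {ι : Type*} (d : ℕ) (g : ι → ℝ≥0∞) :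
    ∑' q : Fin d → ι, ∏ i, g (q i) ≤ (∑' q, g q) ^ d := by
  classical
  rw [ENNReal.tsum_eq_iSup_sum]
  refine iSup_le fun s => ?_
  let t : Finset ι := s.biUnion fun q => Finset.univ.image q
  calc ∑ q ∈ s, ∏ i, g (q i) ≤ ∑ q ∈ Fintype.piFinset fun _ : Fin d => t, ∏ i, g (q i) := by
        refine Finset.sum_le_sum_of_subset fun q hq => ?_
        rw [Fintype.mem_piFinset]
        intro i
        exact Finset.mem_biUnion.2 ⟨q, hq, Finset.mem_image_of_mem _ (Finset.mem_univ i)⟩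
    _ = (∑ q ∈ t, g q) ^ d := by
        rw [← Finset.prod_univ_sum]; simp
    _ ≤ _ := by gcongr; exact ENNReal.sum_le_tsum _

theorem IsAdmissible.tsum_decay_le {d : ℕ} (hd : 1 ≤ d) {A : Matrix (Fin d) (Fin d) ℝ} {c : ℝ}
    (hc : 0 < c) (hA : IsAdmissible A c) (ρ y : Fin d → ℝ) (hρ : ∀ i, 0 < ρ i) :
    ∑' k, ∏ i, decay (ρ i * (latticePt A k i - y i)) ≤
      (4 * decaySum) ^ d * ENNReal.ofReal ((∏ i, ρ i)⁻¹ / c + 1) := by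
  let q : (Fin d → ℤ) → (Fin d → ℤ) := fun k i => ⌊ρ i * (latticePt A k i - y i)⌋
  have hcount : ∀ z, ∑' _ : q ⁻¹' {z}, (1 : ℝ≥0∞) ≤
      ENNReal.ofReal ((∏ i, ρ i)⁻¹ / c + 1) := fun z => by
    have h := hA.tsum_box_le hd hc (fun i => y i + z i / ρ i) (fun i => (ρ i)⁻¹)
      fun i => inv_pos.2 (hρ i)
    rw [Finset.prod_inv_distrib] at h
    refine le_trans ?_ h
    rw [ENNReal.tsum_set_one, ENNReal.tsum_set_one]
    refine ENat.toENNReal_mono (Set.encard_le_encard fun k hk i => ?_)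
    have hz : ⌊ρ i * (latticePt A k i - y i)⌋ = z i := congrFun hk i
    rw [Int.floor_eq_iff] at hz
    have hr := hρ i
    constructor
    · have : (z i : ℝ) / ρ i ≤ latticePt A k i - y i := by
        rw [div_le_iff₀' hr]; exact hz.1
      linarith
    · have : latticePt A k i - y i < (z i + 1 : ℝ) / ρ i := by
        rw [lt_div_iff₀' hr]; exact hz.2
      rw [add_div, one_div] at this
      linarith
  rw [← ENNReal.tsum_fiberwise _ q]
  calc ∑' z, ∑' k : q ⁻¹' {z}, ∏ i, decay (ρ i * (latticePt A k i - y i))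
      ≤ ∑' z : Fin d → ℤ, (∏ i, 4 * decay (z i)) * ENNReal.ofReal ((∏ i, ρ i)⁻¹ / c + 1) := by
        refine ENNReal.tsum_le_tsum fun z => ?_
        calc ∑' k : q ⁻¹' {z}, ∏ i, decay (ρ i * (latticePt A k i - y i))
            ≤ ∑' _ : q ⁻¹' {z}, (∏ i, 4 * decay (z i)) * 1 := by
              refine ENNReal.tsum_le_tsum fun k => ?_
              rw [mul_one]
              refine Finset.prod_le_prod' fun i _ => ?_
              have hz : ⌊ρ i * (latticePt A k i - y i)⌋ = z i := congrFun k.2 i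
              rw [← hz]
              exact decay_le_floor _
          _ ≤ _ := by rw [ENNReal.tsum_mul_left]; gcongr; exact hcount z
    _ = (∑' z : Fin d → ℤ, ∏ i, 4 * decay (z i)) * ENNReal.ofReal ((∏ i, ρ i)⁻¹ / c + 1) :=
        ENNReal.tsum_mul_right
    _ ≤ _ := by
        gcongr
        refine (tsum_pi_prod_le d fun z : ℤ => 4 * decay z).trans ?_
        rw [ENNReal.tsum_mul_left]
        rfl

/-! ### The number of Frolov nodes -/

theorem frolovNodes_eq_image (d n : ℕ) : frolovNodes d n =
    (fun k => WithLp.toLp 2 (latticePt (frolovMatrix d n) k)) ''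
      {k | ∀ i, latticePt (frolovMatrix d n) k i ∈ Set.Ico (0 : ℝ) 1} := by
  ext x
  constructor
  · rintro ⟨⟨k, rfl⟩, h⟩
    exact ⟨k, h, rfl⟩
  · rintro ⟨k, h, rfl⟩
    exact ⟨⟨k, rfl⟩, h⟩

theorem exists_frolovNodes_encard_le {d : ℕ} (hd : 1 ≤ d) :
    ∃ N : ℕ, ∀ n : ℕ, 1 ≤ n → (frolovNodes d n).encard ≤ (N * n : ℕ) := by
  obtain ⟨c, hc, h⟩ := exists_frolovMatrix_admissible hd
  refine ⟨⌈1 / c⌉₊ + 1, fun n hn => ?_⟩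
  have hn0 : (0 : ℝ) < n := by exact_mod_cast hn
  have hA : IsAdmissible (frolovMatrix d n) (c / n) := fun k hk => (h n hn k hk).1
  have h1 := hA.encard_box_le hd (by positivity) 0 1 fun _ => one_pos
  rw [frolovNodes_eq_image]
  refine (Set.encard_image_le _ _).trans (le_trans (by simpa using h1) ?_)
  have h3 : ⌊(∏ i : Fin d, (1 : Fin d → ℝ) i) / (c / n)⌋₊ ≤ ⌈1 / c⌉₊ * n := by
    refine Nat.floor_le_of_le ?_
    simp only [Pi.one_apply, Finset.prod_const_one]
    push_cast
    rw [one_div_div, div_eq_mul_one_div, mul_comm]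
    gcongr
    exact Nat.le_ceil _
  have : ⌊(∏ i : Fin d, (1 : Fin d → ℝ) i) / (c / n)⌋₊ + 1 ≤ (⌈1 / c⌉₊ + 1) * n := by
    rw [add_mul]; omega
  simpa using (Nat.cast_le (α := ℕ∞)).2 this

theorem frolovNodes_finite {d : ℕ} (hd : 1 ≤ d) {n : ℕ} (hn : 1 ≤ n) :
    (frolovNodes d n).Finite := by
  obtain ⟨N, hN⟩ := exists_frolovNodes_encard_le hd
  exact Set.finite_of_encard_le_coe (hN n hn)

theorem exists_latticePt_near {d : ℕ} (hd : 1 ≤ d) : ∃ r : ℝ, 0 < r ∧ ∀ n : ℕ, 1 ≤ n →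
    ∀ x : Fin d → ℝ, ∃ k, ∀ i, |latticePt (frolovMatrix d n) k i - x i| ≤
      ((n : ℝ) * (frolovVandermonde d).det) ^ (-(1 / (d : ℝ))) * r := by
  set V := frolovVandermonde d with hV
  refine ⟨∑ i, ∑ j, |V i j| + 1, by positivity, fun n hn x => ?_⟩
  have hsp := frolovMatrix_scale_pos hd hn
  rw [← hV] at hsp
  set τ := ((n : ℝ) * V.det) ^ (-(1 / (d : ℝ))) with hτ
  set t := V⁻¹.mulVec (τ⁻¹ • x) with ht
  refine ⟨fun j => round (t j), fun i => ?_⟩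
  have hx : x = τ • V.mulVec t := by
    rw [ht, Matrix.mulVec_mulVec, Matrix.mul_nonsing_inv _ (isUnit_det_frolovVandermonde hd),
      Matrix.one_mulVec, smul_smul, mul_inv_cancel₀ hsp.ne', one_smul]
  have h1 : latticePt (frolovMatrix d n) (fun j => round (t j)) i - x i =
      τ * ∑ j, V i j * ((round (t j) : ℝ) - t j) := by
    conv_lhs => rw [hx]
    rw [latticePt, frolovMatrix, ← hV, ← hτ, Matrix.smul_mulVec]
    simp only [Pi.smul_apply, smul_eq_mul, Matrix.mulVec, dotProduct]
    rw [← mul_sub, ← Finset.sum_sub_distrib]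
    simp_rw [mul_sub]
  rw [h1, abs_mul, abs_of_pos hsp]
  gcongr
  calc |∑ j, V i j * ((round (t j) : ℝ) - t j)| ≤ ∑ j, |V i j * ((round (t j) : ℝ) - t j)| :=
        Finset.abs_sum_le_sum_abs _ _
    _ ≤ ∑ j, |V i j| := by
        refine Finset.sum_le_sum fun j _ => ?_
        rw [abs_mul, abs_sub_comm]
        have := abs_sub_round (t j)
        nlinarith [abs_nonneg (V i j)]
    _ ≤ ∑ i, ∑ j, |V i j| :=
        Finset.single_le_sum (f := fun i => ∑ j, |V i j|)
          (fun i _ => Finset.sum_nonneg fun j _ => abs_nonneg _) (Finset.mem_univ i)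
    _ ≤ _ := by linarith

theorem zero_mem_frolovNodes (d n : ℕ) : (0 : Pt d) ∈ frolovNodes d n := by
  refine ⟨⟨0, ?_⟩, fun i => by simp⟩
  ext i
  simp [Matrix.mulVec, dotProduct]

theorem exists_le_frolovNodes_encard {d : ℕ} (hd : 1 ≤ d) :
    ∃ c : ℝ, 0 < c ∧ ∀ n : ℕ, 1 ≤ n → ENNReal.ofReal (c * n) ≤ (frolovNodes d n).encard := by
  obtain ⟨r, hr, hnear⟩ := exists_latticePt_near hd
  set D := (frolovVandermonde d).det with hD
  have hDpos : 0 < D := frolovVandermonde_det_pos hd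
  refine ⟨D * ((6 * r) ^ d)⁻¹, by positivity, fun n hn => ?_⟩
  have hn0 : (0 : ℝ) < n := by exact_mod_cast hn
  have hsp := frolovMatrix_scale_pos hd hn
  have hpow := frolovMatrix_scale_pow hd hn
  have hnear' := hnear n hn
  rw [← hD] at hsp hpow
  set τ := ((n : ℝ) * D) ^ (-(1 / (d : ℝ))) with hτ
  have hnD : (n : ℝ) * D = (τ⁻¹) ^ d := by rw [inv_pow, hpow, inv_inv]
  set σ := 3 * (τ * r) with hσ
  have hσ0 : 0 < σ := by positivity
  set N := ⌊1 / σ⌋₊ with hN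
  have htarget : D * ((6 * r) ^ d)⁻¹ * n = (1 / (2 * σ)) ^ d := by
    rw [show D * ((6 * r) ^ d)⁻¹ * n = (n * D) * ((6 * r) ^ d)⁻¹ by ring, hnD, ← inv_pow,
      ← mul_pow, hσ]
    congr 1
    field_simp
    norm_num
  rw [htarget]
  rcases Nat.eq_zero_or_pos N with h0 | hpos
  · have h1 : 1 / σ < 1 := by
      have := Nat.lt_floor_add_one (1 / σ)
      rw [← hN, h0] at this
      simpa using this
    calc ENNReal.ofReal ((1 / (2 * σ)) ^ d) ≤ 1 := by
          rw [ENNReal.ofReal_le_one]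
          refine pow_le_one₀ (by positivity) ?_
          rw [one_div, mul_inv, ← one_div σ]
          have : 0 < 1 / σ := by positivity
          linarith
      _ ≤ _ := by
          have : (1 : ℕ∞) ≤ (frolovNodes d n).encard :=
            Set.one_le_encard_iff_nonempty.2 ⟨0, zero_mem_frolovNodes d n⟩
          exact_mod_cast ENat.toENNReal_mono this
  · have hN1 : (1 : ℝ) ≤ N := by exact_mod_cast hpos
    have hNle : (N : ℝ) ≤ 1 / σ := Nat.floor_le (by positivity)
    have hNge : 1 / (2 * σ) ≤ N := by
      have := Nat.lt_floor_add_one (1 / σ)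
      rw [← hN] at this
      rw [one_div, mul_inv, ← one_div σ]
      linarith
    choose k hk using fun q : Fin d → Fin N => hnear' fun i => σ * (((q i : ℕ) : ℝ) + 1 / 2)
    have hb : ∀ q i, σ * ((q i : ℕ) : ℝ) ≤ latticePt (frolovMatrix d n) (k q) i ∧
        latticePt (frolovMatrix d n) (k q) i < σ * (((q i : ℕ) : ℝ) + 1) := fun q i => by
      have h := abs_le.1 (hk q i)
      have hτr : 0 < τ * r := by positivity
      constructor <;> nlinarith [h.1, h.2]
    have hmem : ∀ q, WithLp.toLp 2 (latticePt (frolovMatrix d n) (k q)) ∈ frolovNodes d n := by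
      refine fun q => ⟨⟨k q, rfl⟩, fun i => ⟨le_trans (by positivity) (hb q i).1, ?_⟩⟩
      refine (hb q i).2.trans_le ?_
      have : (((q i : ℕ) : ℝ) + 1) ≤ N := by exact_mod_cast (q i).2
      calc σ * (((q i : ℕ) : ℝ) + 1) ≤ σ * (1 / σ) := by gcongr; linarith
        _ = 1 := by field_simp
    have hinj : Function.Injective fun q =>
        (WithLp.toLp 2 (latticePt (frolovMatrix d n) (k q)) : Pt d) := by
      intro q q' h
      have h' : latticePt (frolovMatrix d n) (k q) = latticePt (frolovMatrix d n) (k q') :=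
        congrArg WithLp.ofLp h
      ext i
      have e1 := hb q i
      have e2 := hb q' i
      rw [h'] at e1
      have l1 := lt_of_mul_lt_mul_left (e1.1.trans_lt e2.2) hσ0.le
      have l2 := lt_of_mul_lt_mul_left (e2.1.trans_lt e1.2) hσ0.le
      have l1' : (q i : ℕ) < (q' i : ℕ) + 1 := by exact_mod_cast l1
      have l2' : (q' i : ℕ) < (q i : ℕ) + 1 := by exact_mod_cast l2
      omega
    have hcard := Set.encard_le_encard (Set.range_subset_iff.2 hmem)
    rw [← Set.image_univ, hinj.encard_image, Set.encard_univ, ENat.card_eq_coe_fintype_card] at hcard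
    have hcard' := ENat.toENNReal_mono hcard
    refine le_trans ?_ hcard'
    simp only [Fintype.card_pi, Fintype.card_fin, Finset.prod_const, Finset.card_univ]
    rw [ENat.toENNReal_coe, ← ENNReal.ofReal_natCast]
    refine ENNReal.ofReal_le_ofReal ?_
    push_cast
    gcongr

theorem sameOrder_frolovNodes {d : ℕ} (hd : 1 ≤ d) :
    SameOrder (fun n => ((frolovNodes d n).encard : ℝ≥0∞)) (fun n => (n : ℝ≥0∞)) := by
  constructor
  · obtain ⟨N, hN⟩ := exists_frolovNodes_encard_le hd
    refine ⟨N, fun n hn => ?_⟩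
    have h := ENat.toENNReal_mono (hN n (by omega))
    rw [ENat.toENNReal_coe, Nat.cast_mul] at h
    exact h
  · obtain ⟨c, hc, h⟩ := exists_le_frolovNodes_encard hd
    refine ⟨(c⁻¹).toNNReal, fun n hn => ?_⟩
    calc (n : ℝ≥0∞) = ENNReal.ofReal (c⁻¹) * ENNReal.ofReal (c * n) := by
          rw [← ENNReal.ofReal_mul (by positivity), inv_mul_cancel_left₀ hc.ne',
            ENNReal.ofReal_natCast]
      _ ≤ _ := by
          rw [ENNReal.ofReal]
          gcongr
          exact h n (by omega)

/-! ### Poisson summation for functions with vanishing Fourier transform on the dual lattice -/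

/-- The integer vector `k` as a real vector. -/
def intVec {d : ℕ} (k : Fin d → ℤ) : Fin d → ℝ := fun i => (k i : ℝ)

/-- A point of `ℝ^d` modulo `ℤ^d`. -/
def toTorus {d : ℕ} (t : Fin d → ℝ) : UnitAddTorus (Fin d) := fun i => (t i : UnitAddCircle)

theorem toTorus_add_intVec {d : ℕ} (t : Fin d → ℝ) (k : Fin d → ℤ) :
    toTorus (t + intVec k) = toTorus t := by
  ext i
  simp only [toTorus, intVec, Pi.add_apply]
  rw [AddCircle.coe_add]
  have : ((k i : ℝ) : UnitAddCircle) = 0 := by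
    rw [AddCircle.coe_eq_zero_iff]
    exact ⟨k i, by simp⟩
  rw [this, add_zero]

theorem isOpenQuotientMap_toTorus (d : ℕ) : IsOpenQuotientMap (toTorus (d := d)) :=
  IsOpenQuotientMap.piMap (f := fun (_ : Fin d) (x : ℝ) => (x : UnitAddCircle))
    fun _ => QuotientAddGroup.isOpenQuotientMap_mk

/-- The half-open unit cube. -/
def unitBox (d : ℕ) : Set (Fin d → ℝ) := {x | ∀ i, x i ∈ Set.Ioc (0 : ℝ) (0 + 1)}

/-- The translate of the half-open unit cube by an integer vector. -/
def shiftedBox {d : ℕ} (k : Fin d → ℤ) : Set (Fin d → ℝ) := {x | ∀ i, ⌈x i⌉ - 1 = k i}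

theorem preimage_shiftedBox {d : ℕ} (k : Fin d → ℤ) :
    (fun t => t + intVec k) ⁻¹' shiftedBox k = unitBox d := by
  ext t
  simp only [Set.mem_preimage, shiftedBox, unitBox, Set.mem_ofPred_eq]
  refine forall_congr' fun i => ?_
  simp only [Pi.add_apply, intVec, Int.ceil_add_intCast]
  rw [Set.mem_Ioc, show ⌈t i⌉ + k i - 1 = k i ↔ ⌈t i⌉ = 1 by omega, Int.ceil_eq_iff]
  simp

theorem measurableSet_shiftedBox {d : ℕ} (k : Fin d → ℤ) : MeasurableSet (shiftedBox k) := by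
  have : shiftedBox k = ⋂ i, (fun x : Fin d → ℝ => ⌈x i⌉ - 1) ⁻¹' {k i} := by
    ext x; simp [shiftedBox]
  rw [this]
  refine MeasurableSet.iInter fun i => ?_
  exact ((Int.measurable_ceil.comp (measurable_pi_apply i)).sub_const 1) (measurableSet_singleton _)

theorem hasSum_integral_unitBox {d : ℕ} {G : (Fin d → ℝ) → ℂ} (hG : Integrable G) :
    HasSum (fun k => ∫ t in unitBox d, G (t + intVec k)) (∫ t, G t) := by
  have h := hasSum_integral_iUnion (μ := volume) (f := G) (s := fun k : Fin d → ℤ => shiftedBox k)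
    measurableSet_shiftedBox
    (fun k l hkl => Set.disjoint_left.2 fun x hk hl => hkl (by
      ext i; rw [← hk i, ← hl i])) hG.integrableOn
  have hu : (⋃ k : Fin d → ℤ, shiftedBox k) = Set.univ :=
    Set.eq_univ_of_forall fun x => Set.mem_iUnion.2 ⟨fun i => ⌈x i⌉ - 1, fun _ => rfl⟩
  rw [hu, Measure.restrict_univ] at h
  have h2 : ∀ k : Fin d → ℤ, ∫ t in unitBox d, G (t + intVec k) = ∫ t in shiftedBox k, G t :=
    fun k => by
      have := (measurePreserving_add_right volume (intVec k)).setIntegral_preimage_emb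
        (Homeomorph.addRight (intVec k)).measurableEmbedding G (shiftedBox k)
      rw [preimage_shiftedBox] at this
      exact this
  simpa only [h2] using h

/-- If the Fourier transform of `G` vanishes at all nonzero integer vectors, then the
periodization of `G` is constant. -/
theorem tsum_add_intVec_eq_integral {d : ℕ} {G : (Fin d → ℝ) → ℂ} (hcont : Continuous G)
    (hint : Integrable G)
    (hloc : ∀ t₀, ∃ s ∈ nhds t₀, ∃ u : (Fin d → ℤ) → ℝ, Summable u ∧
      ∀ k, ∀ t ∈ s, ‖G (t + intVec k)‖ ≤ u k)
    (hvan : ∀ n : Fin d → ℤ, n ≠ 0 → ∫ t, UnitAddTorus.mFourier (-n) (toTorus t) * G t = 0)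
    (t : Fin d → ℝ) : ∑' k, G (t + intVec k) = ∫ t, G t := by
  set H : (Fin d → ℝ) → ℂ := fun t => ∑' k, G (t + intVec k) with hH
  have hHcont : Continuous H := by
    refine continuous_iff_continuousAt.2 fun t₀ => ?_
    obtain ⟨s, hs, u, hu, hb⟩ := hloc t₀
    have : ContinuousOn H s := continuousOn_tsum
      (fun k => (hcont.comp (continuous_id.add continuous_const)).continuousOn) hu hb
    exact this.continuousAt hs
  have hper : ∀ t l, H (t + intVec l) = H t := fun t l => by
    rw [hH]
    simp only
    rw [← (Equiv.addLeft l).tsum_eq fun k => G (t + intVec k)]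
    refine tsum_congr fun k => ?_
    congr 1
    ext i
    simp [intVec, add_assoc]
  have hlift : ∀ t t', toTorus t = toTorus t' → H t = H t' := fun t t' h => by
    have : ∀ i, ∃ k : ℤ, t i = t' i + k := fun i => by
      have h1 : ((t i : ℝ) : UnitAddCircle) = t' i := congrFun h i
      have h2 : ((t i - t' i : ℝ) : UnitAddCircle) = 0 := by
        rw [AddCircle.coe_sub, h1, sub_self]
      obtain ⟨k, hk⟩ := (AddCircle.coe_eq_zero_iff (1 : ℝ)).1 h2
      refine ⟨k, ?_⟩
      simp at hk
      linarith
    choose k hk using this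
    have : t = t' + intVec k := by ext i; simp [intVec, hk i]
    rw [this, hper]
  have hq := isOpenQuotientMap_toTorus d
  have hlift' : Function.FactorsThrough H toTorus := fun a b hab => hlift a b hab
  have hq' : Topology.IsQuotientMap (⟨toTorus, hq.continuous⟩ : C(Fin d → ℝ, UnitAddTorus (Fin d))) :=
    hq.isQuotientMap
  set h : C(UnitAddTorus (Fin d), ℂ) := hq'.lift ⟨H, hHcont⟩ hlift' with hh
  have hcoe : ∀ t, h (toTorus t) = H t := fun t =>
    DFunLike.congr_fun (hq'.lift_comp ⟨H, hHcont⟩ hlift') t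
  have hnorm : ∀ n : Fin d → ℤ, ∀ x, ‖UnitAddTorus.mFourier n x‖ ≤ 1 := fun n x =>
    ((UnitAddTorus.mFourier n).norm_coe_le_norm x).trans UnitAddTorus.mFourier_norm.le
  have hcharcont : ∀ n : Fin d → ℤ, Continuous fun t : Fin d → ℝ =>
      UnitAddTorus.mFourier n (toTorus t) := fun n =>
    (UnitAddTorus.mFourier n).continuous.comp hq.continuous
  have hcoeff : ∀ n, UnitAddTorus.mFourierCoeff h n =
      ∫ t, UnitAddTorus.mFourier (-n) (toTorus t) * G t := fun n => by
    rw [UnitAddTorus.mFourierCoeff_eq_integral h n 0]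
    have hgint : Integrable fun t => UnitAddTorus.mFourier (-n) (toTorus t) * G t :=
      hint.bdd_mul (hcharcont _).aestronglyMeasurable (Filter.Eventually.of_forall fun t => hnorm _ _)
    have h1 := hasSum_integral_unitBox hgint
    have h2 := hasSum_integral_unitBox (G := fun t => ((‖G t‖ : ℝ) : ℂ)) hint.norm.ofReal
    rw [← h1.tsum_eq]
    simp only [toTorus_add_intVec]
    have hGk : ∀ k : Fin d → ℤ, Integrable (fun t => G (t + intVec k)) := fun k =>
      hint.comp_add_right (intVec k)
    rw [integral_tsum_of_summable_integral_norm]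
    · change ∫ t in unitBox d, UnitAddTorus.mFourier (-n) (toTorus t) • h (toTorus t) = _
      refine integral_congr_ae (Filter.Eventually.of_forall fun t => ?_)
      simp only [hcoe, smul_eq_mul, hH, tsum_mul_left]
    · intro k
      exact ((hGk k).bdd_mul (hcharcont _).aestronglyMeasurable
        (Filter.Eventually.of_forall fun t => hnorm (-n) _)).integrableOn
    · have h3 : Summable fun k : Fin d → ℤ => ∫ t in unitBox d, ‖G (t + intVec k)‖ := by
        have := h2.summable
        simp only [integral_complex_ofReal] at this
        exact Complex.summable_ofReal.1 this
      refine Summable.of_nonneg_of_le (fun k => by positivity) (fun k => ?_) h3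
      refine integral_mono_of_nonneg (Filter.Eventually.of_forall fun t => norm_nonneg _)
        (hGk k).norm.integrableOn (Filter.Eventually.of_forall fun t => ?_)
      simp only [norm_mul]
      exact mul_le_of_le_one_left (norm_nonneg _) (hnorm _ _)
  have hz : ∀ n, n ≠ 0 → UnitAddTorus.mFourierCoeff h n = 0 := fun n hn => by
    rw [hcoeff, hvan n hn]
  have hsum := UnitAddTorus.hasSum_mFourier_series_apply_of_summable
    (summable_of_ne_finset_zero (s := {0}) fun n hn => hz n (by simpa using hn)) (toTorus t)
  have h0 : HasSum (fun n => UnitAddTorus.mFourierCoeff h n •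
      UnitAddTorus.mFourier n (toTorus t)) (∫ t, G t) := by
    convert hasSum_single (0 : Fin d → ℤ) (fun n hn => ?_) using 1
    · rw [hcoeff]
      simp [UnitAddTorus.mFourier_zero]
    · rw [hz n hn, zero_smul]
  rw [← hsum.unique h0, hcoe]

theorem measurableEmbedding_toLin' {d : ℕ} {A : Matrix (Fin d) (Fin d) ℝ} (hA : A.det ≠ 0) :
    MeasurableEmbedding (Matrix.toLin' A) := by
  refine (LinearMap.continuous_of_finiteDimensional _).measurableEmbedding ?_
  exact Matrix.mulVec_injective_iff_isUnit.2 ((Matrix.isUnit_iff_isUnit_det A).2 hA.isUnit)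

theorem enorm_prod {ι : Type*} (s : Finset ι) (f : ι → ℂ) : ‖∏ i ∈ s, f i‖ₑ = ∏ i ∈ s, ‖f i‖ₑ := by
  simp only [enorm, nnnorm_prod, ENNReal.ofNNReal_finsetProd]

theorem integral_comp_mulVec {d : ℕ} {A : Matrix (Fin d) (Fin d) ℝ} (hA : A.det ≠ 0)
    (g : (Fin d → ℝ) → ℂ) : ∫ t, g (A.mulVec t) = |A.det|⁻¹ * ∫ z, g z := by
  have h := Real.map_matrix_volume_pi_eq_smul_volume_pi hA
  have hemb := measurableEmbedding_toLin' hA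
  have h1 := hemb.integral_map (μ := volume) g
  rw [h, integral_smul_measure] at h1
  simp only [Matrix.toLin'_apply] at h1
  rw [← h1, ENNReal.toReal_ofReal (abs_nonneg _), abs_inv, Complex.real_smul]

theorem integrable_comp_mulVec {d : ℕ} {A : Matrix (Fin d) (Fin d) ℝ} (hA : A.det ≠ 0)
    {g : (Fin d → ℝ) → ℂ} (hg : Integrable g) : Integrable fun t => g (A.mulVec t) := by
  have h := Real.map_matrix_volume_pi_eq_smul_volume_pi hA
  have hemb := measurableEmbedding_toLin' hA
  have h1 := hemb.integrable_map_iff (μ := volume) (g := g)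
  rw [h] at h1
  exact h1.1 (hg.smul_measure ENNReal.ofReal_ne_top)

theorem decay_add_le {a b : ℝ} (hb : |b| ≤ 1) : decay (a + b) ≤ 4 * decay a := by
  have h4 : (4 : ℝ≥0∞) = ENNReal.ofReal 4 := by simp
  rw [decay, decay, h4, ← ENNReal.ofReal_mul (by norm_num)]
  refine ENNReal.ofReal_le_ofReal ?_
  rw [show (4 : ℝ) * ((1 + |a|) ^ 2)⁻¹ = (((1 + |a|) / 2) ^ 2)⁻¹ by
    field_simp; norm_num]
  gcongr
  have h3 := abs_add_le (a + b) (-b)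
  rw [add_neg_cancel_right, abs_neg] at h3
  have := abs_nonneg (a + b)
  linarith

theorem lintegral_decay_lt_top : ∫⁻ t, decay t < ⊤ := by
  have h : Integrable fun t : ℝ => ((1 + |t|) ^ 2)⁻¹ := by
    have := integrable_one_add_norm (E := ℝ) (μ := volume) (r := 2) (by simp)
    refine this.congr (Filter.Eventually.of_forall fun t => ?_)
    simp only [Real.norm_eq_abs]
    rw [Real.rpow_neg (by positivity), Real.rpow_two]
  exact h.lintegral_lt_top

theorem integrable_of_decay {f : ℝ → ℂ} (hf : Continuous f) {C : ℝ≥0∞} (hC : C ≠ ⊤)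
    (hdec : ∀ t, ‖f t‖ₑ ≤ C * decay t) : Integrable f := by
  refine ⟨hf.aestronglyMeasurable, ?_⟩
  refine lt_of_le_of_lt (lintegral_mono hdec) ?_
  rw [lintegral_const_mul _ measurable_decay]
  exact ENNReal.mul_lt_top hC.lt_top lintegral_decay_lt_top

/-- Summation over a lattice is exact for product functions whose Fourier transform vanishes on the
nonzero vectors of the dual lattice. -/
theorem tsum_latticePt_eq_integral {d : ℕ} (hd : 1 ≤ d) {A : Matrix (Fin d) (Fin d) ℝ}
    (hdet : A.det ≠ 0) {c : ℝ} (hc : 0 < c) (hA : IsAdmissible A c) {F : Fin d → ℝ → ℂ}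
    (hF : ∀ i, Continuous (F i)) {C : ℝ≥0∞} (hC : C ≠ ⊤) (hdec : ∀ i t, ‖F i t‖ₑ ≤ C * decay t)
    (hvan : ∀ k : Fin d → ℤ, k ≠ 0 → ∃ i, 𝓕 (F i) (latticePt (A⁻¹.transpose) k i) = 0)
    (y : Fin d → ℝ) :
    ∑' k, ∏ i, F i (latticePt A k i - y i) = |A.det|⁻¹ * ∏ i, ∫ t, F i t := by
  set g : (Fin d → ℝ) → ℂ := fun z => ∏ i, F i (z i - y i) with hg
  have hFi : ∀ i, Integrable fun t => F i (t - y i) := fun i =>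
    (integrable_of_decay (hF i) hC (hdec i)).comp_sub_right _
  have hgint : Integrable g := Integrable.fintype_prod hFi
  have hgcont : Continuous g := by fun_prop
  have key := tsum_add_intVec_eq_integral (G := fun t => g (A.mulVec t))
    (hgcont.comp (by fun_prop)) (integrable_comp_mulVec hdet hgint) ?_ ?_ 0
  · have h1 : ∀ k : Fin d → ℤ, g (A.mulVec (0 + intVec k)) =
        ∏ i, F i (latticePt A k i - y i) := fun k => by rw [zero_add]; rfl
    simp only [h1] at key
    rw [key, integral_comp_mulVec hdet, hg, integral_fintype_prod_volume_eq_prod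
      (fun i t => F i (t - y i))]
    congr 2
    ext i
    exact integral_sub_right_eq_self _ _
  · intro t₀
    refine ⟨{t | ∀ i, |A.mulVec t i - A.mulVec t₀ i| < 1}, ?_, fun k =>
      (∏ i, C * (4 * decay (1 * (latticePt A k i - (y i - A.mulVec t₀ i))))).toReal, ?_, ?_⟩
    · refine IsOpen.mem_nhds ?_ (by simp)
      rw [show {t | ∀ i, |A.mulVec t i - A.mulVec t₀ i| < 1} =
        ⋂ i, {t | |A.mulVec t i - A.mulVec t₀ i| < 1} by ext; simp]
      exact isOpen_iInter_of_finite fun i => isOpen_lt (by fun_prop) continuous_const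
    · refine ENNReal.summable_toReal ?_
      have := hA.tsum_decay_le hd hc 1 (fun i => y i - A.mulVec t₀ i) fun _ => one_pos
      simp only [Finset.prod_mul_distrib, ENNReal.tsum_mul_left]
      refine ENNReal.mul_ne_top (ENNReal.prod_ne_top fun _ _ => hC) (ENNReal.mul_ne_top
        (ENNReal.prod_ne_top fun _ _ => by finiteness) (ne_top_of_le_ne_top ?_ this))
      have := decaySum_lt_top.ne
      finiteness
    · intro k t ht
      have htop : ∏ i, C * (4 * decay (1 * (latticePt A k i - (y i - A.mulVec t₀ i)))) ≠ ⊤ := by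
        refine ENNReal.prod_ne_top fun i _ => ?_
        have := (decay_le_one (1 * (latticePt A k i - (y i - A.mulVec t₀ i)))).trans_lt
          ENNReal.one_lt_top |>.ne
        finiteness
      rw [← toReal_enorm]
      refine ENNReal.toReal_mono htop ?_
      rw [hg]
      simp only
      rw [enorm_prod]
      refine Finset.prod_le_prod' fun i _ => (hdec i _).trans ?_
      gcongr
      have : A.mulVec (t + intVec k) i - y i = 1 * (latticePt A k i - (y i - A.mulVec t₀ i)) +
          (A.mulVec t i - A.mulVec t₀ i) := by
        
        change A.mulVec (t + intVec k) i - y i = 1 * (A.mulVec (intVec k) i - _) + _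
        rw [Matrix.mulVec_add, Pi.add_apply]; ring
      rw [this]
      exact decay_add_le (ht i).le
  · intro n hn
    set ξ := latticePt (A⁻¹.transpose) n with hξ
    have hchar : ∀ t, UnitAddTorus.mFourier (-n) (toTorus t) =
        ∏ i, Complex.exp (((-2 * Real.pi * (A.mulVec t i) * ξ i : ℝ) : ℂ) * Complex.I) := fun t => by
      have hdot : ∑ i, ξ i * A.mulVec t i = ∑ i, (n i : ℝ) * t i := by
        have h1 : ξ = Matrix.vecMul (fun j => (n j : ℝ)) A⁻¹ := by
          rw [hξ, latticePt, Matrix.mulVec_transpose]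
        change dotProduct ξ (A.mulVec t) = dotProduct (fun j => (n j : ℝ)) t
        rw [h1, ← Matrix.dotProduct_mulVec, Matrix.mulVec_mulVec,
          Matrix.nonsing_inv_mul _ hdet.isUnit, Matrix.one_mulVec]
      change ∏ i, fourier ((-n) i) ((t i : ℝ) : UnitAddCircle) = _
      simp only [fourier_coe_apply]
      rw [← Complex.exp_sum, ← Complex.exp_sum]
      congr 1
      rw [← Finset.sum_mul, ← Complex.ofReal_sum]
      have h2 : ∑ i, -2 * Real.pi * (A.mulVec t i) * ξ i = -2 * Real.pi * ∑ i, (n i : ℝ) * t i := by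
        rw [← hdot, Finset.mul_sum]
        exact Finset.sum_congr rfl fun i _ => by ring
      rw [h2]
      push_cast
      rw [Finset.mul_sum, Finset.sum_mul]
      refine Finset.sum_congr rfl fun i _ => ?_
      simp
      ring
    simp only [hchar]
    rw [integral_comp_mulVec hdet (fun z => (∏ i, Complex.exp
      (((-2 * Real.pi * (z i) * ξ i : ℝ) : ℂ) * Complex.I)) * g z)]
    simp only [hg, ← Finset.prod_mul_distrib]
    rw [integral_fintype_prod_volume_eq_prod (fun i t => Complex.exp
      (((-2 * Real.pi * t * ξ i : ℝ) : ℂ) * Complex.I) * F i (t - y i))]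
    obtain ⟨i, hi⟩ := hvan n hn
    rw [← hξ] at hi
    rw [Finset.prod_eq_zero (Finset.mem_univ i), mul_zero]
    rw [← integral_add_right_eq_self _ (y i)]
    rw [Real.fourier_real_eq_integral_exp_smul] at hi
    have : ∀ t, Complex.exp (((-2 * Real.pi * (t + y i) * ξ i : ℝ) : ℂ) * Complex.I) *
        F i (t + y i - y i) = Complex.exp (((-2 * Real.pi * y i * ξ i : ℝ) : ℂ) * Complex.I) *
        (Complex.exp (((-2 * Real.pi * t * ξ i : ℝ) : ℂ) * Complex.I) • F i t) := fun t => by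
      rw [add_sub_cancel_right, smul_eq_mul, ← mul_assoc, ← Complex.exp_add]
      congr 2
      push_cast
      ring
    simp only [this]
    rw [integral_const_mul, hi, mul_zero]

/-! ### Kernels dual to the local means -/

/-- Schwartz functions `Λ₀`, `Λ₁` with compactly supported Fourier transform which resolve the
identity together with `Ψ₀`, `Ψ₁`. -/
structure DualKernel {L : ℕ} (K : LocalMeanKernel L) where
  Λ₀ : 𝓢(ℝ, ℂ)
  Λ₁ : 𝓢(ℝ, ℂ)
  Φ : 𝓢(ℝ, ℂ)
  R : ℝ
  R_pos : 0 < R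
  fourier_Λ₀ : ∀ ξ, R ≤ |ξ| → 𝓕 (Λ₀ : ℝ → ℂ) ξ = 0
  fourier_Λ₁ : ∀ ξ, R ≤ |ξ| → 𝓕 (Λ₁ : ℝ → ℂ) ξ = 0
  conv₀ : ∀ x, ∫ t, K.Ψ₀ t * Λ₀ (x - t) = Φ x
  conv₁ : ∀ x, ∫ t, K.Ψ₁ t * Λ₁ (x - t) = 2 * Φ (2 * x) - Φ x
  integral_Φ : ∫ t, Φ t = 1

theorem exists_schwartz_mul_eq {φ D : ℝ → ℂ} (hφ : ContDiff ℝ ∞ φ) (hc : HasCompactSupport φ)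
    (hD : ContDiff ℝ ∞ D) (hne : ∀ ξ ∈ tsupport φ, D ξ ≠ 0) :
    ∃ q : 𝓢(ℝ, ℂ), (∀ ξ, q ξ * D ξ = φ ξ) ∧ ∀ ξ, φ ξ = 0 → q ξ = 0 := by
  have hsmooth : ContDiff ℝ ∞ fun ξ => φ ξ * (D ξ)⁻¹ := by
    refine contDiff_iff_contDiffAt.2 fun ξ => ?_
    by_cases h : ξ ∈ tsupport φ
    · exact hφ.contDiffAt.mul (hD.contDiffAt.inv (hne ξ h))
    · refine (contDiffAt_const (c := (0 : ℂ))).congr_of_eventuallyEq ?_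
      filter_upwards [notMem_tsupport_iff_eventuallyEq.1 h] with y hy
      simp [hy]
  have hcs : HasCompactSupport fun ξ => φ ξ * (D ξ)⁻¹ := hc.mul_right
  refine ⟨hcs.toSchwartzMap hsmooth, fun ξ => ?_, fun ξ h => ?_⟩
  · change φ ξ * (D ξ)⁻¹ * D ξ = φ ξ
    by_cases h : ξ ∈ tsupport φ
    · rw [inv_mul_cancel_right₀ (hne ξ h)]
    · rw [image_eq_zero_of_notMem_tsupport h]; simp
  · change φ ξ * (D ξ)⁻¹ = 0
    rw [h, zero_mul]

theorem exists_dual_factor {Ψ φ : ℝ → ℂ} (hΨ : ContDiff ℝ ∞ Ψ) (hΨc : HasCompactSupport Ψ)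
    (hφ : ContDiff ℝ ∞ φ) (hφc : HasCompactSupport φ) (hne : ∀ ξ ∈ tsupport φ, 𝓕 Ψ ξ ≠ 0) :
    ∃ Λ : 𝓢(ℝ, ℂ), (∀ ξ, φ ξ = 0 → 𝓕 (Λ : ℝ → ℂ) ξ = 0) ∧
      ∀ x, ∫ t, Ψ t * Λ (x - t) = 𝓕⁻ φ x := by
  set P : 𝓢(ℝ, ℂ) := hΨc.toSchwartzMap hΨ with hP
  set f : 𝓢(ℝ, ℂ) := hφc.toSchwartzMap hφ with hf
  obtain ⟨q, hq, hq0⟩ := exists_schwartz_mul_eq hφ hφc (𝓕 P).smooth'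
    (fun ξ hξ => by exact hne ξ hξ)
  have hΛ : 𝓕 (𝓕⁻ q) = q := by simp
  refine ⟨𝓕⁻ q, fun ξ h => ?_, fun x => ?_⟩
  · rw [← SchwartzMap.fourier_coe, hΛ]
    exact hq0 ξ h
  · have h1 : SchwartzMap.convolution (ContinuousLinearMap.mul ℂ ℂ) P (𝓕⁻ q) = 𝓕⁻ f := by
      have h2 : 𝓕 (SchwartzMap.convolution (ContinuousLinearMap.mul ℂ ℂ) P (𝓕⁻ q)) = f := by
        rw [SchwartzMap.fourier_convolution, hΛ]
        ext ξ
        have : f ξ = φ ξ := rfl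
        rw [SchwartzMap.pairing_apply_apply, this, ← hq ξ, mul_comm]
        rfl
      rw [← h2]; simp
    have h3 := DFunLike.congr_fun h1 x
    rw [SchwartzMap.convolution_apply] at h3
    have h4 : (𝓕⁻ f : 𝓢(ℝ, ℂ)) x = 𝓕⁻ φ x := by rw [SchwartzMap.fourierInv_coe]; rfl
    rw [← h4, ← h3]
    rfl

theorem fourierInv_comp_half_sub {φ : ℝ → ℂ} (hφ : Continuous φ) (hc : HasCompactSupport φ)
    (x : ℝ) : 𝓕⁻ (fun ξ => φ (ξ / 2) - φ ξ) x = 2 * 𝓕⁻ φ (2 * x) - 𝓕⁻ φ x := by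
  have hint : ∀ g : ℝ → ℂ, Continuous g → HasCompactSupport g →
      Integrable fun v : ℝ => Complex.exp (((2 * Real.pi * (v * x) : ℝ) : ℂ) * Complex.I) * g v :=
    fun g hg hgc => Continuous.integrable_of_hasCompactSupport (by fun_prop) hgc.mul_left
  have hinv : ∀ (g : ℝ → ℂ) (x : ℝ), 𝓕⁻ g x =
      ∫ v : ℝ, Complex.exp (((2 * Real.pi * (v * x) : ℝ) : ℂ) * Complex.I) * g v := fun g x => by
    rw [Real.fourierInv_eq']
    refine integral_congr_ae (Filter.Eventually.of_forall fun v => ?_)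
    simp [mul_comm x v]
  have h2c : HasCompactSupport fun v => φ (v / 2) := by
    have := hc.comp_homeomorph (Homeomorph.mulRight₀ (2⁻¹ : ℝ) (by norm_num))
    exact this
  have h2 := Measure.integral_comp_div (fun v : ℝ =>
    Complex.exp (((2 * Real.pi * (v * (2 * x)) : ℝ) : ℂ) * Complex.I) * φ v) 2
  rw [abs_two, Complex.real_smul] at h2
  rw [hinv, hinv, hinv]
  simp only [mul_sub]
  rw [integral_sub (hint (fun v => φ (v / 2)) (hφ.comp (by fun_prop)) h2c) (hint φ hφ hc)]
  congr 1
  rw [Complex.ofReal_ofNat] at h2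
  rw [← h2]
  refine integral_congr_ae (Filter.Eventually.of_forall fun v => ?_)
  simp only
  rw [show v / 2 * (2 * x) = v * x by ring]

theorem exists_dualKernel {L : ℕ} (K : LocalMeanKernel L) : Nonempty (DualKernel K) := by
  obtain ⟨ε, hε, h0, h1⟩ := K.tauberian
  let b : ContDiffBump (0 : ℝ) := ⟨2 * ε / 3, 3 * ε / 4, by positivity, by linarith⟩
  set φ₀ : ℝ → ℂ := fun ξ => (b ξ : ℂ) with hφ₀
  have hφ₀s : ContDiff ℝ ∞ φ₀ := Complex.ofRealCLM.contDiff.comp b.contDiff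
  have hφ₀z : ∀ ξ, 3 * ε / 4 ≤ |ξ| → φ₀ ξ = 0 := fun ξ h => by
    have : b ξ = 0 := b.zero_of_le_dist (by simpa using h)
    simp [hφ₀, this]
  have hφ₀o : ∀ ξ, |ξ| ≤ 2 * ε / 3 → φ₀ ξ = 1 := fun ξ h => by
    have : b ξ = 1 := b.one_of_mem_closedBall (by simpa using h)
    simp [hφ₀, this]
  have hφ₀c : HasCompactSupport φ₀ := HasCompactSupport.intro (isCompact_closedBall (0 : ℝ) ε)
    fun ξ h => hφ₀z ξ (by
      simp at h
      linarith)
  have hφ₀t : ∀ ξ ∈ tsupport φ₀, |ξ| < ε := fun ξ h => by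
    have : tsupport φ₀ ⊆ {ξ | |ξ| ≤ 3 * ε / 4} := by
      refine closure_minimal (fun ξ h => ?_) (isClosed_le continuous_abs continuous_const)
      by_contra hlt
      exact h (hφ₀z ξ (not_le.1 hlt).le)
    have := this h
    simp only [Set.mem_ofPred_eq] at this
    linarith
  set φ₁ : ℝ → ℂ := fun ξ => φ₀ (ξ / 2) - φ₀ ξ with hφ₁
  have hφ₁s : ContDiff ℝ ∞ φ₁ := (hφ₀s.comp (contDiff_id.div_const 2)).sub hφ₀s
  have hφ₁z : ∀ ξ, 3 * ε / 2 ≤ |ξ| → φ₁ ξ = 0 := fun ξ h => by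
    rw [hφ₁]
    simp only
    rw [hφ₀z ξ (by linarith), hφ₀z (ξ / 2) (by rw [abs_div, abs_two]; linarith), sub_zero]
  have hφ₁o : ∀ ξ, |ξ| ≤ 2 * ε / 3 → φ₁ ξ = 0 := fun ξ h => by
    rw [hφ₁]
    simp only
    have := abs_nonneg ξ
    rw [hφ₀o ξ h, hφ₀o (ξ / 2) (by rw [abs_div, abs_two]; linarith), sub_self]
  have hφ₁c : HasCompactSupport φ₁ := HasCompactSupport.intro (isCompact_closedBall (0 : ℝ) (2 * ε))
    fun ξ h => hφ₁z ξ (by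
      simp at h
      linarith)
  have hφ₁t : ∀ ξ ∈ tsupport φ₁, ε / 2 < |ξ| ∧ |ξ| < 2 * ε := fun ξ h => by
    have : tsupport φ₁ ⊆ {ξ | 2 * ε / 3 ≤ |ξ| ∧ |ξ| ≤ 3 * ε / 2} := by
      refine closure_minimal (fun ξ h => ⟨?_, ?_⟩)
        ((isClosed_le continuous_const continuous_abs).and
          (isClosed_le continuous_abs continuous_const))
      · by_contra hlt
        exact h (hφ₁o ξ (not_le.1 hlt).le)
      · by_contra hlt
        exact h (hφ₁z ξ (not_le.1 hlt).le)
    have := this h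
    simp only [Set.mem_ofPred_eq] at this
    constructor <;> linarith
  obtain ⟨Λ₀, hΛ₀, hc₀⟩ := exists_dual_factor K.contDiff₀ K.hasCompactSupport₀ hφ₀s hφ₀c
    fun ξ h => h0 ξ (hφ₀t ξ h)
  obtain ⟨Λ₁, hΛ₁, hc₁⟩ := exists_dual_factor K.contDiff₁ K.hasCompactSupport₁ hφ₁s hφ₁c
    fun ξ h => h1 ξ (hφ₁t ξ h).1 (hφ₁t ξ h).2
  set f : 𝓢(ℝ, ℂ) := hφ₀c.toSchwartzMap hφ₀s with hf
  have hΦ : ∀ x, (𝓕⁻ f : 𝓢(ℝ, ℂ)) x = 𝓕⁻ φ₀ x := fun x => by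
    rw [SchwartzMap.fourierInv_coe]; rfl
  refine ⟨⟨Λ₀, Λ₁, 𝓕⁻ f, 2 * ε, by positivity, fun ξ h => hΛ₀ ξ (hφ₀z ξ (by linarith)),
    fun ξ h => hΛ₁ ξ (hφ₁z ξ (by linarith)), fun x => by rw [hc₀, hΦ], fun x => ?_, ?_⟩⟩
  · rw [hc₁, hΦ, hΦ, ← fourierInv_comp_half_sub hφ₀s.continuous hφ₀c]
  · have h2 : (𝓕 (𝓕⁻ f) : 𝓢(ℝ, ℂ)) 0 = f 0 := by simp
    rw [SchwartzMap.fourier_coe, Real.fourier_real_eq_integral_exp_smul] at h2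
    simp only [mul_zero, Complex.ofReal_zero, zero_mul, Complex.exp_zero, one_smul] at h2
    rw [h2]
    exact hφ₀o 0 (by simpa using by positivity)

/-! ### Products of functions of one coordinate -/

theorem integral_prod_coord {𝕜 : Type*} [RCLike 𝕜] {d : ℕ} (F : Fin d → ℝ → 𝕜) :
    ∫ x : Pt d, ∏ i, F i (x i) = ∏ i, ∫ t, F i t := by
  rw [← integral_fintype_prod_volume_eq_prod]
  exact (PiLp.volume_preserving_ofLp (Fin d)).integral_comp
    (MeasurableEquiv.toLp 2 (Fin d → ℝ)).symm.measurableEmbedding fun x => ∏ i, F i (x i)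

theorem integrable_prod_coord {d : ℕ} {F : Fin d → ℝ → ℂ} (hF : ∀ i, Integrable (F i)) :
    Integrable fun x : Pt d => ∏ i, F i (x i) :=
  ((PiLp.volume_preserving_ofLp (Fin d)).integrable_comp_emb
    (MeasurableEquiv.toLp 2 (Fin d → ℝ)).symm.measurableEmbedding).2 (Integrable.fintype_prod hF)

theorem lintegral_enorm_prod_coord {d : ℕ} {F : Fin d → ℝ → ℂ} (hF : ∀ i, Integrable (F i)) :
    ∫⁻ x : Pt d, ‖∏ i, F i (x i)‖ₑ = ∏ i, ∫⁻ t, ‖F i t‖ₑ := by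
  rw [← ofReal_integral_norm_eq_lintegral_enorm (integrable_prod_coord hF)]
  simp only [norm_prod]
  rw [integral_prod_coord fun i t => ‖F i t‖, ENNReal.ofReal_prod_of_nonneg
    fun i _ => integral_nonneg fun t => norm_nonneg _]
  exact Finset.prod_congr rfl fun i _ => ofReal_integral_norm_eq_lintegral_enorm (hF i)

/-- The cube `[-r, r]^d`. -/
def bigCube (d : ℕ) (r : ℝ) : Set (Pt d) := {x | ∀ i, |x i| ≤ r}

theorem isClosed_bigCube (d : ℕ) (r : ℝ) : IsClosed (bigCube d r) := by
  have : bigCube d r = ⋂ i, {x : Pt d | |x i| ≤ r} := by ext; simp [bigCube]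
  rw [this]
  exact isClosed_iInter fun i => isClosed_le (by fun_prop) continuous_const

theorem isCompact_bigCube (d : ℕ) (r : ℝ) : IsCompact (bigCube d r) := by
  have : bigCube d r = (WithLp.toLp 2 : (Fin d → ℝ) → Pt d) ''
      Set.univ.pi fun _ => Set.Icc (-r) r := by
    ext x
    constructor
    · intro h
      exact ⟨x.ofLp, fun i _ => abs_le.1 (h i), rfl⟩
    · rintro ⟨y, hy, rfl⟩
      exact fun i => abs_le.2 (hy i (Set.mem_univ i))
  rw [this]
  exact (isCompact_univ_pi fun _ => isCompact_Icc).image (PiLp.continuous_toLp 2 _)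

theorem unitCube_subset_bigCube (d : ℕ) : unitCube d ⊆ bigCube d 1 := fun x hx i => by
  have := hx i
  rw [abs_le]
  constructor <;> linarith [this.1, this.2]

theorem isClosed_unitCube (d : ℕ) : IsClosed (unitCube d) := by
  have : unitCube d = ⋂ i, {x : Pt d | x i ∈ Set.Icc (0 : ℝ) 1} := by ext; simp [unitCube]
  rw [this]
  exact isClosed_iInter fun i => isClosed_Icc.preimage (by fun_prop)

/-! ### The local mean kernels -/

section LocalMean

variable {L : ℕ} (K : LocalMeanKernel L)

theorem LocalMeanKernel.exists_radius :
    ∃ ρ : ℝ, 0 < ρ ∧ ∀ j t, K.dilate j t ≠ 0 → |t| ≤ ρ := by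
  obtain ⟨r₀, h₀⟩ := K.hasCompactSupport₀.isCompact.isBounded.subset_closedBall 0
  obtain ⟨r₁, h₁⟩ := K.hasCompactSupport₁.isCompact.isBounded.subset_closedBall 0
  refine ⟨max 1 (max r₀ r₁), by positivity, fun j t h => ?_⟩
  cases j with
  | zero =>
    have := h₀ (subset_tsupport _ h)
    rw [mem_closedBall_zero_iff, Real.norm_eq_abs] at this
    exact this.trans ((le_max_left _ _).trans (le_max_right _ _))
  | succ j =>
    have h' : K.Ψ₁ (2 ^ j * t) ≠ 0 := right_ne_zero_of_mul h
    have := h₁ (subset_tsupport _ h')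
    rw [mem_closedBall_zero_iff, Real.norm_eq_abs, abs_mul, abs_of_pos (by positivity)] at this
    refine le_trans ?_ ((le_max_right _ _).trans (le_max_right _ _))
    have h1 : (1 : ℝ) ≤ 2 ^ j := one_le_pow₀ (by norm_num)
    nlinarith [abs_nonneg t]

/-- A radius such that all kernels `Ψ_j` are supported in `[-ρ, ρ]`. -/
def LocalMeanKernel.radius : ℝ := K.exists_radius.choose

theorem LocalMeanKernel.radius_pos : 0 < K.radius := K.exists_radius.choose_spec.1

theorem LocalMeanKernel.abs_le_radius {j : ℕ} {t : ℝ} (h : K.dilate j t ≠ 0) : |t| ≤ K.radius :=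
  K.exists_radius.choose_spec.2 j t h

theorem LocalMeanKernel.reflected_ne_zero {d : ℕ} {m : Fin d → ℕ} {x y : Pt d}
    (h : K.reflected m x y ≠ 0) (i : Fin d) : |x i - y i| ≤ K.radius :=
  K.abs_le_radius (Finset.prod_ne_zero_iff.1 h i (Finset.mem_univ i))

theorem LocalMeanKernel.continuous_reflected₂ {d : ℕ} (m : Fin d → ℕ) :
    Continuous fun q : Pt d × Pt d => K.reflected m q.1 q.2 := by
  refine continuous_finsetProd _ fun i _ => (K.contDiff_dilate (m i)).continuous.comp ?_
  fun_prop

end LocalMean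

/-! ### The dual kernels -/

theorem exists_enorm_schwartz_le (f : 𝓢(ℝ, ℂ)) :
    ∃ C : ℝ≥0∞, C ≠ ⊤ ∧ ∀ t, ‖f t‖ₑ ≤ C * decay t := by
  refine ⟨ENNReal.ofReal (2 ^ 2 * ((Finset.Iic (2, 0)).sup
    fun m => SchwartzMap.seminorm ℝ m.1 m.2) f), ENNReal.ofReal_ne_top, fun t => ?_⟩
  have h := SchwartzMap.one_add_le_sup_seminorm_apply (𝕜 := ℝ) (m := (2, 0)) (k := 2) (n := 0)
    le_rfl le_rfl f t
  rw [norm_iteratedFDeriv_zero, Real.norm_eq_abs] at h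
  rw [decay, ← ENNReal.ofReal_mul (by positivity), ← ofReal_norm]
  refine ENNReal.ofReal_le_ofReal ?_
  rw [← div_eq_mul_inv, le_div_iff₀ (by positivity), mul_comm]
  exact h

namespace DualKernel

variable {L : ℕ} {K : LocalMeanKernel L} (D : DualKernel K)

/-- The dilates `Λ_j` of the dual kernels. -/
def dilate : ℕ → ℝ → ℂ
  | 0 => D.Λ₀
  | j + 1 => fun t => 2 ^ j * D.Λ₁ (2 ^ j * t)

theorem continuous_dilate (j : ℕ) : Continuous (D.dilate j) := by
  cases j with
  | zero => exact D.Λ₀.continuous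
  | succ j => exact continuous_const.mul (D.Λ₁.continuous.comp (by fun_prop))

theorem decay_le_four_mul (t : ℝ) : decay t ≤ 4 * decay (2 * t) := by
  have h4 : (4 : ℝ≥0∞) = ENNReal.ofReal 4 := by simp
  rw [decay, decay, h4, ← ENNReal.ofReal_mul (by norm_num)]
  refine ENNReal.ofReal_le_ofReal ?_
  rw [show (4 : ℝ) * ((1 + |2 * t|) ^ 2)⁻¹ = (((1 + |2 * t|) / 2) ^ 2)⁻¹ by
    field_simp; norm_num]
  gcongr
  rw [abs_mul, abs_two]
  linarith [abs_nonneg t]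

theorem exists_enorm_dilate_le :
    ∃ C : ℝ≥0∞, C ≠ ⊤ ∧ ∀ j t, ‖D.dilate j t‖ₑ ≤ C * 2 ^ j * decay (2 ^ j * t) := by
  obtain ⟨C₀, hC₀, h₀⟩ := exists_enorm_schwartz_le D.Λ₀
  obtain ⟨C₁, hC₁, h₁⟩ := exists_enorm_schwartz_le D.Λ₁
  refine ⟨C₀ + C₁ * 4, by finiteness, fun j t => ?_⟩
  cases j with
  | zero =>
    simp only [pow_zero, mul_one, one_mul]
    exact (h₀ t).trans (by gcongr; exact le_self_add)
  | succ j =>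
    change ‖(2 : ℂ) ^ j * D.Λ₁ (2 ^ j * t)‖ₑ ≤ _
    have h2 : ‖(2 : ℂ) ^ j‖ₑ = 2 ^ j := by
      rw [enorm_pow]
      congr 1
      rw [← ofReal_norm]
      simp
    rw [enorm_mul, h2]
    calc 2 ^ j * ‖D.Λ₁ (2 ^ j * t)‖ₑ ≤ 2 ^ j * (C₁ * (4 * decay (2 * (2 ^ j * t)))) := by
          gcongr
          exact (h₁ _).trans (by gcongr; exact decay_le_four_mul _)
      _ = C₁ * 4 * 2 ^ j * decay (2 ^ (j + 1) * t) := by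
          rw [show (2 : ℝ) * (2 ^ j * t) = 2 ^ (j + 1) * t by ring]; ring
      _ ≤ _ := by
          gcongr
          · exact le_add_self
          · norm_num
          · omega

/-- A constant for the decay of the dual kernels. -/
def const : ℝ≥0∞ := D.exists_enorm_dilate_le.choose

theorem const_ne_top : D.const ≠ ⊤ := D.exists_enorm_dilate_le.choose_spec.1

theorem enorm_dilate_le (j : ℕ) (t : ℝ) : ‖D.dilate j t‖ₑ ≤ D.const * 2 ^ j * decay (2 ^ j * t) :=
  D.exists_enorm_dilate_le.choose_spec.2 j t

theorem integrable_dilate (j : ℕ) : Integrable (D.dilate j) := by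
  cases j with
  | zero => exact D.Λ₀.integrable
  | succ j =>
    exact (D.Λ₁.integrable.comp_mul_left' (R := (2 : ℝ) ^ j) (by positivity)).const_mul _

/-- A uniform bound for the `L_1` norms of the dual kernels. -/
theorem lintegral_enorm_dilate_le (j : ℕ) :
    ∫⁻ t, ‖D.dilate j t‖ₑ ≤ (∫⁻ t, ‖D.Λ₀ t‖ₑ) + ∫⁻ t, ‖D.Λ₁ t‖ₑ := by
  cases j with
  | zero => exact le_self_add
  | succ j =>
    refine le_trans (le_of_eq ?_) le_add_self
    rw [← ofReal_integral_norm_eq_lintegral_enorm (D.integrable_dilate (j + 1)),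
      ← ofReal_integral_norm_eq_lintegral_enorm D.Λ₁.integrable]
    congr 1
    have h := Measure.integral_comp_mul_left (fun t => ‖D.Λ₁ t‖) ((2 : ℝ) ^ j)
    simp only [dilate, norm_mul, norm_pow, Complex.norm_ofNat]
    rw [integral_const_mul, h, abs_of_pos (by positivity), smul_eq_mul,
      mul_inv_cancel_left₀ (by positivity)]

theorem fourier_dilate_eq_zero (j : ℕ) {ξ : ℝ} (h : D.R * 2 ^ j ≤ |ξ|) :
    𝓕 (D.dilate j) ξ = 0 := by
  cases j with
  | zero => exact D.fourier_Λ₀ ξ (by simpa using h)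
  | succ j =>
    have h1 : D.R ≤ |ξ / 2 ^ j| := by
      rw [abs_div, abs_of_pos (show (0 : ℝ) < 2 ^ j by positivity), le_div_iff₀ (by positivity)]
      refine le_trans ?_ h
      have := D.R_pos
      gcongr
      · norm_num
      · omega
    have h2 := D.fourier_Λ₁ _ h1
    rw [Real.fourier_real_eq_integral_exp_smul] at h2 ⊢
    have h3 := Measure.integral_comp_mul_left (fun v : ℝ => Complex.exp
      (((-2 * Real.pi * v * (ξ / 2 ^ j) : ℝ) : ℂ) * Complex.I) • D.Λ₁ v) ((2 : ℝ) ^ j)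
    rw [h2, smul_zero] at h3
    simp only [dilate, smul_eq_mul] at h3 ⊢
    have h4 : ∀ v : ℝ, Complex.exp (((-2 * Real.pi * v * ξ : ℝ) : ℂ) * Complex.I) *
        (2 ^ j * D.Λ₁ (2 ^ j * v)) = 2 ^ j * (Complex.exp
        (((-2 * Real.pi * (2 ^ j * v) * (ξ / 2 ^ j) : ℝ) : ℂ) * Complex.I) *
          D.Λ₁ (2 ^ j * v)) := fun v => by
      rw [show -2 * Real.pi * (2 ^ j * v) * (ξ / 2 ^ j) = -2 * Real.pi * v * ξ by field_simp]
      ring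
    simp only [h4]
    rw [integral_const_mul, h3, mul_zero]

/-- The convolution of `Ψ_j` with `Λ_j`. -/
def resolution : ℕ → ℝ → ℂ
  | 0 => D.Φ
  | j + 1 => fun x => 2 ^ j * (2 * D.Φ (2 * (2 ^ j * x)) - D.Φ (2 ^ j * x))

theorem integral_dilate_mul_dilate (j : ℕ) (x : ℝ) :
    ∫ t, K.dilate j t * D.dilate j (x - t) = D.resolution j x := by
  cases j with
  | zero => exact D.conv₀ x
  | succ j =>
    simp only [LocalMeanKernel.dilate, dilate, resolution]
    have h := Measure.integral_comp_mul_left (fun t : ℝ => K.Ψ₁ t * D.Λ₁ (2 ^ j * x - t))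
      ((2 : ℝ) ^ j)
    rw [D.conv₁] at h
    have h4 : ∀ t : ℝ, 2 ^ j * K.Ψ₁ (2 ^ j * t) * (2 ^ j * D.Λ₁ (2 ^ j * (x - t))) =
        2 ^ j * 2 ^ j * (K.Ψ₁ (2 ^ j * t) * D.Λ₁ (2 ^ j * x - 2 ^ j * t)) := fun t => by
      rw [← mul_sub]; ring
    simp only [h4]
    rw [integral_const_mul, h, abs_of_pos (by positivity), Complex.real_smul]
    push_cast
    have : (2 : ℂ) ^ j ≠ 0 := pow_ne_zero _ two_ne_zero
    field_simp

theorem sum_resolution (J : ℕ) (x : ℝ) :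
    ∑ j ∈ Finset.range (J + 1), D.resolution j x = 2 ^ J * D.Φ (2 ^ J * x) := by
  induction J with
  | zero => simp [resolution]
  | succ J ih =>
    rw [Finset.sum_range_succ, ih]
    simp only [resolution]
    rw [show (2 : ℝ) ^ (J + 1) * x = 2 * (2 ^ J * x) by ring]
    ring

/-- The kernel `Λ_m(x - y)`, where `Λ_m(z) = ∏ i, Λ_{m_i}(z_i)`. -/
def kernel {d : ℕ} (m : Fin d → ℕ) (x y : Pt d) : ℂ := ∏ i, D.dilate (m i) (x i - y i)

theorem continuous_kernel {d : ℕ} (m : Fin d → ℕ) :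
    Continuous fun q : Pt d × Pt d => D.kernel m q.1 q.2 :=
  continuous_finsetProd _ fun i _ => (D.continuous_dilate (m i)).comp (by fun_prop)

/-- The convolution of `Λ_m` with a function `g`. -/
def synth {d : ℕ} (m : Fin d → ℕ) (g : Pt d → ℂ) (x : Pt d) : ℂ := ∫ y, D.kernel m x y * g y

theorem integral_kernel_mul_reflected {d : ℕ} (m : Fin d → ℕ) (x z : Pt d) :
    ∫ y, D.kernel m x y * K.reflected m y z = ∏ i, D.resolution (m i) (x i - z i) := by
  simp only [kernel, LocalMeanKernel.reflected, ← Finset.prod_mul_distrib]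
  rw [integral_prod_coord fun i t => D.dilate (m i) (x i - t) * K.dilate (m i) (t - z i)]
  refine Finset.prod_congr rfl fun i _ => ?_
  rw [← integral_dilate_mul_dilate, ← integral_add_right_eq_self _ (z i)]
  refine integral_congr_ae (Filter.Eventually.of_forall fun t => ?_)
  simp only [add_sub_cancel_right]
  rw [mul_comm, sub_sub, add_comm (z i)]

end DualKernel

/-- The convolution of the kernel `Ψ_m` with a function. -/
def LocalMeanKernel.mean {L : ℕ} (K : LocalMeanKernel L) {d : ℕ} (m : Fin d → ℕ) (f : Pt d → ℂ)
    (x : Pt d) : ℂ := ∫ y, K.reflected m x y * f y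

namespace DualKernel

variable {L : ℕ} {K : LocalMeanKernel L} (D : DualKernel K) {d : ℕ}

theorem synth_mean {f : Pt d → ℂ} (hf : Continuous f) {r : ℝ} (hr : ∀ x, f x ≠ 0 → x ∈ bigCube d r)
    (m : Fin d → ℕ) (x : Pt d) :
    D.synth m (K.mean m f) x = ∫ z, (∏ i, D.resolution (m i) (x i - z i)) * f z := by
  simp only [synth, LocalMeanKernel.mean, ← integral_const_mul]
  rw [integral_integral_swap_of_hasCompactSupport]
  · refine integral_congr_ae (Filter.Eventually.of_forall fun z => ?_)
    simp only
    rw [← D.integral_kernel_mul_reflected m x z, ← integral_mul_const]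
    refine integral_congr_ae (Filter.Eventually.of_forall fun y => ?_)
    simp only [mul_assoc]
  · have h1 := (D.continuous_kernel m).comp
      ((continuous_const (y := x)).prodMk (continuous_fst (X := Pt d) (Y := Pt d)))
    have h2 := K.continuous_reflected₂ m
    exact h1.mul (h2.mul (hf.comp continuous_snd))
  · refine HasCompactSupport.intro ((isCompact_bigCube d (r + K.radius)).prod
      (isCompact_bigCube d r)) fun q hq => ?_
    by_contra hne
    have h1 : K.reflected m q.1 q.2 * f q.2 ≠ 0 := right_ne_zero_of_mul hne
    have h2 := hr _ (right_ne_zero_of_mul h1)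
    have h3 := K.reflected_ne_zero (left_ne_zero_of_mul h1)
    refine hq ⟨fun i => ?_, h2⟩
    have h4 := abs_add_le (q.1 i - q.2 i) (q.2 i)
    rw [sub_add_cancel] at h4
    linarith [h2 i, h3 i]

/-- Partial sums of the local mean decomposition of a continuous function converge. -/
theorem tendsto_sum_synth_mean {f : Pt d → ℂ} (hf : Continuous f) {r : ℝ}
    (hr : ∀ x, f x ≠ 0 → x ∈ bigCube d r) (x : Pt d) :
    Filter.Tendsto (fun J : ℕ => ∑ m ∈ Fintype.piFinset fun _ : Fin d => Finset.range (J + 1),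
      D.synth m (K.mean m f) x) Filter.atTop (nhds (f x)) := by
  have hfc : HasCompactSupport f := HasCompactSupport.intro (isCompact_bigCube d r)
    fun y hy => by_contra fun h => hy (hr y h)
  have hres : ∀ j, Continuous (D.resolution j) := fun j => by
    cases j with
    | zero => exact D.Φ.continuous
    | succ j =>
      have := D.Φ.continuous
      simp only [resolution]
      fun_prop
  have hsum : ∀ J : ℕ, ∑ m ∈ Fintype.piFinset fun _ : Fin d => Finset.range (J + 1),
      D.synth m (K.mean m f) x = ∫ w : Pt d, (∏ i, D.Φ (w i)) * f (x - ((2 : ℝ) ^ J)⁻¹ • w) := by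
    intro J
    simp only [D.synth_mean hf hr]
    rw [← integral_finsetSum]
    · simp only [← Finset.sum_mul]
      have h1 : ∀ z : Pt d, ∑ m ∈ Fintype.piFinset fun _ : Fin d => Finset.range (J + 1),
          ∏ i, D.resolution (m i) (x i - z i) = ∏ i : Fin d, 2 ^ J * D.Φ (2 ^ J * (x i - z i)) :=
        fun z => by
          rw [← Finset.prod_univ_sum (fun _ : Fin d => Finset.range (J + 1))
            fun i j => D.resolution j (x i - z i)]
          exact Finset.prod_congr rfl fun i _ => D.sum_resolution J _
      simp only [h1]
      rw [← integral_sub_left_eq_self _ volume x]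
      have h2 := Measure.integral_comp_smul (volume : Measure (Pt d))
        (fun w : Pt d => (∏ i, D.Φ (w i)) * f (x - ((2 : ℝ) ^ J)⁻¹ • w)) ((2 : ℝ) ^ J)
      have h3 : ∫ w : Pt d, (∏ i, D.Φ (w i)) * f (x - ((2 : ℝ) ^ J)⁻¹ • w) =
          ((2 : ℝ) ^ J) ^ d • ∫ w : Pt d, (∏ i, D.Φ (((2 : ℝ) ^ J • w) i)) *
            f (x - ((2 : ℝ) ^ J)⁻¹ • ((2 : ℝ) ^ J • w)) := by
        rw [h2, finrank_euclideanSpace_fin, abs_of_pos (by positivity), smul_smul,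
          mul_inv_cancel₀ (by positivity), one_smul]
      rw [h3, ← integral_smul]
      refine integral_congr_ae (Filter.Eventually.of_forall fun z => ?_)
      simp only [PiLp.sub_apply, sub_sub_cancel, PiLp.smul_apply, smul_eq_mul, smul_smul]
      rw [inv_mul_cancel₀ (by positivity), one_smul, Finset.prod_mul_distrib, Complex.real_smul]
      simp
      ring
    · intro m _
      exact Continuous.integrable_of_hasCompactSupport
        ((continuous_finsetProd _ fun i _ => (hres (m i)).comp (by fun_prop)).mul hf) hfc.mul_left
  simp only [hsum]
  have hΦint : Integrable fun w : Pt d => ∏ i, D.Φ (w i) :=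
    integrable_prod_coord fun i => D.Φ.integrable
  have hlim : f x = ∫ w : Pt d, (∏ i, D.Φ (w i)) * f x := by
    rw [integral_mul_const, integral_prod_coord fun _ t => D.Φ t]
    simp [D.integral_Φ]
  obtain ⟨M, hM⟩ := hf.bounded_above_of_compact_support hfc
  conv => enter [3]; rw [hlim]
  refine tendsto_integral_of_dominated_convergence (fun w => ‖∏ i, D.Φ (w i)‖ * M) (fun J => ?_)
    (hΦint.norm.mul_const M) (fun J => ?_) ?_
  · refine Continuous.aestronglyMeasurable ?_
    have := D.Φ.continuous
    fun_prop
  · refine Filter.Eventually.of_forall fun w => ?_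
    rw [norm_mul]
    gcongr
    exact hM _
  · refine Filter.Eventually.of_forall fun w => ?_
    refine Filter.Tendsto.const_mul _ ?_
    have h2 : Filter.Tendsto (fun J : ℕ => x - ((2 : ℝ) ^ J)⁻¹ • w) Filter.atTop (nhds x) := by
      have h3 : Filter.Tendsto (fun J : ℕ => ((2 : ℝ) ^ J)⁻¹) Filter.atTop (nhds 0) :=
        tendsto_inv_atTop_zero.comp (tendsto_pow_atTop_atTop_of_one_lt (by norm_num))
      have h4 := (h3.smul_const w).const_sub x
      simpa using h4
    exact (hf.tendsto x).comp h2

end DualKernel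

/-! ### Summation over dyadic levels -/

/-- The multi-indices `m` with `|m|₁ = μ`. -/
def level (d μ : ℕ) : Finset (Fin d → ℕ) := Finset.piAntidiag Finset.univ μ

theorem mem_level {d μ : ℕ} {m : Fin d → ℕ} : m ∈ level d μ ↔ ∑ i, m i = μ := by
  simp [level]

theorem card_level_le {d : ℕ} (hd : 1 ≤ d) (μ : ℕ) : (level d μ).card ≤ (μ + 1) ^ (d - 1) := by
  obtain ⟨e, rfl⟩ : ∃ e, d = e + 1 := ⟨d - 1, by omega⟩
  have h := Finset.card_le_card_of_injOn (s := level (e + 1) μ)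
    (t := Fintype.piFinset fun _ : Fin e => Finset.range (μ + 1)) (fun m => Fin.tail m)
    (fun m hm => by
      rw [Finset.mem_coe, Fintype.mem_piFinset]
      intro i
      rw [Finset.mem_coe, mem_level, Fin.sum_univ_succ] at hm
      have := Finset.single_le_sum (f := fun i : Fin e => m i.succ) (fun i _ => Nat.zero_le _)
        (Finset.mem_univ i)
      rw [Finset.mem_range]
      change m i.succ < _
      omega)
    (fun m hm m' hm' h => by
      rw [Finset.mem_coe, mem_level, Fin.sum_univ_succ] at hm hm'
      have hs : ∀ i : Fin e, m i.succ = m' i.succ := fun i => congrFun h i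
      simp only [hs] at hm
      ext i
      refine Fin.cases ?_ (fun j => hs j) i
      omega)
  simpa using h

theorem le_card_level {d : ℕ} (hd : 1 ≤ d) (μ : ℕ) : (μ / d + 1) ^ (d - 1) ≤ (level d μ).card := by
  obtain ⟨e, rfl⟩ : ∃ e, d = e + 1 := ⟨d - 1, by omega⟩
  have h := Finset.card_le_card_of_injOn (t := level (e + 1) μ)
    (s := Fintype.piFinset fun _ : Fin e => Finset.range (μ / (e + 1) + 1))
    (fun t => (Fin.cons (μ - ∑ i, t i) t : Fin (e + 1) → ℕ))
    (fun t ht => by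
      rw [Finset.mem_coe, Fintype.mem_piFinset] at ht
      rw [Finset.mem_coe, mem_level, Fin.sum_univ_succ]
      simp only [Fin.cons_zero, Fin.cons_succ]
      have : ∑ i, t i ≤ μ := by
        calc ∑ i, t i ≤ ∑ _ : Fin e, μ / (e + 1) := Finset.sum_le_sum fun i _ => by
              have := ht i
              rw [Finset.mem_range] at this
              omega
          _ = e * (μ / (e + 1)) := by simp
          _ ≤ (e + 1) * (μ / (e + 1)) := Nat.mul_le_mul_right _ (by omega)
          _ ≤ μ := Nat.mul_div_le _ _
      omega)
    (fun t _ t' _ h => (Fin.cons_injective2 h).2)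
  simpa using h

theorem tsum_eq_tsum_level {d : ℕ} (f : (Fin d → ℕ) → ℝ≥0∞) :
    ∑' m, f m = ∑' μ, ∑ m ∈ level d μ, f m := by
  rw [← ENNReal.tsum_fiberwise f fun m => ∑ i, m i]
  refine tsum_congr fun μ => ?_
  have : (fun m : Fin d → ℕ => ∑ i, m i) ⁻¹' {μ} = (level d μ : Set (Fin d → ℕ)) := by
    ext m; simp [mem_level]
  rw [this]
  exact Finset.tsum_subtype (level d μ) f

theorem one_div_toReal (θ : ℝ≥0∞) : (1 / θ).toReal = 1 / θ.toReal := by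
  rw [ENNReal.toReal_div]; simp

theorem one_div_toReal_le_one {θ : ℝ≥0∞} (hθ : 1 ≤ θ) : (1 / θ).toReal ≤ 1 := by
  have : 1 / θ ≤ 1 := by rw [one_div]; exact ENNReal.inv_le_one.2 hθ
  exact ENNReal.toReal_le_of_le_ofReal one_pos.le (by simpa using this)

theorem sum_le_card_rpow_mul_seqNorm {ι : Type*} {θ : ℝ≥0∞} (hθ : 1 ≤ θ) (a : ι → ℝ≥0∞)
    (F : Finset ι) :
    ∑ i ∈ F, a i ≤ (F.card : ℝ≥0∞) ^ (1 - (1 / θ).toReal) * seqNorm θ a := by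
  unfold seqNorm
  split_ifs with h
  · subst h
    simp only [one_div, ENNReal.inv_top, ENNReal.toReal_zero, sub_zero, ENNReal.rpow_one]
    rw [← nsmul_eq_mul]
    exact Finset.sum_le_card_nsmul _ _ _ fun i _ => le_iSup a i
  · have h1 : 1 ≤ θ.toReal := by
      have := ENNReal.toReal_mono h hθ
      simpa using this
    have h0 : 0 < θ.toReal := by linarith
    have h2 := ENNReal.rpow_sum_le_const_mul_sum_rpow F a h1
    have h3 := ENNReal.rpow_le_rpow h2 (show 0 ≤ 1 / θ.toReal by positivity)
    rw [← ENNReal.rpow_mul, mul_one_div_cancel h0.ne', ENNReal.rpow_one,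
      ENNReal.mul_rpow_of_nonneg _ _ (by positivity), ← ENNReal.rpow_mul] at h3
    rw [one_div_toReal]
    refine h3.trans ?_
    rw [show (θ.toReal - 1) * (1 / θ.toReal) = 1 - 1 / θ.toReal by field_simp]
    gcongr
    exact ENNReal.sum_le_tsum _

theorem summable_geometric_mul_rpow {δ κ : ℝ} (hδ : 0 < δ) :
    Summable fun ν : ℕ => (2 : ℝ) ^ (-δ * ν) * ((ν : ℝ) + 1) ^ κ := by
  set r : ℝ := 2 ^ (-δ) with hr
  have hr0 : 0 < r := by positivity
  have hr1 : r < 1 := Real.rpow_lt_one_of_one_lt_of_neg (by norm_num) (by linarith)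
  have h1 := summable_pow_mul_geometric_of_norm_lt_one ⌈κ⌉₊ (r := r)
    (by rwa [Real.norm_eq_abs, abs_of_pos hr0])
  have h2 := ((summable_nat_add_iff 1).2 h1).mul_left r⁻¹
  refine Summable.of_nonneg_of_le (fun ν => by positivity) (fun ν => ?_) h2
  rw [Real.rpow_mul (by norm_num), ← hr, Real.rpow_natCast]
  have h3 : ((ν : ℝ) + 1) ^ κ ≤ ((ν : ℝ) + 1) ^ ⌈κ⌉₊ := by
    rw [← Real.rpow_natCast]
    exact Real.rpow_le_rpow_of_exponent_le (by linarith [(Nat.cast_nonneg ν : (0 : ℝ) ≤ ν)])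
      (Nat.le_ceil _)
  push_cast
  rw [pow_succ]
  calc r ^ ν * ((ν : ℝ) + 1) ^ κ ≤ r ^ ν * ((ν : ℝ) + 1) ^ ⌈κ⌉₊ := by gcongr
    _ = _ := by field_simp

/-- The exponent of the logarithm in the rate. -/
def logExponent (d : ℕ) (θ : ℝ≥0∞) : ℝ := ((d : ℝ) - 1) * (1 - (1 / θ).toReal)

theorem logExponent_nonneg {d : ℕ} (hd : 1 ≤ d) {θ : ℝ≥0∞} (hθ : 1 ≤ θ) : 0 ≤ logExponent d θ := by
  have h1 : (1 : ℝ) ≤ d := by exact_mod_cast hd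
  exact mul_nonneg (by linarith) (by linarith [one_div_toReal_le_one hθ])

theorem tsum_ite_le_eq_tsum_add (f : ℕ → ℝ≥0∞) (M : ℕ) :
    ∑' μ, (if M ≤ μ then f μ else 0) = ∑' ν, f (ν + M) := by
  rw [← Summable.sum_add_tsum_nat_add' (k := M) ENNReal.summable,
    Finset.sum_eq_zero fun μ hμ => if_neg (by have := Finset.mem_range.1 hμ; omega), zero_add]
  exact tsum_congr fun ν => if_pos (by omega)

/-- Sums over all levels from `M` on. -/
theorem exists_tsum_high_le {d : ℕ} (hd : 1 ≤ d) {θ : ℝ≥0∞} (hθ : 1 ≤ θ) {δ : ℝ} (hδ : 0 < δ) :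
    ∃ C : ℝ≥0∞, C ≠ ⊤ ∧ ∀ (M : ℕ) (a : (Fin d → ℕ) → ℝ≥0∞),
      ∑' m : Fin d → ℕ, (if M ≤ ∑ i, m i then
        (2 : ℝ≥0∞) ^ (-δ * ((∑ i, m i : ℕ) : ℝ)) * a m else 0) ≤
      C * (ENNReal.ofReal (2 ^ (-δ * M) * ((M : ℝ) + 1) ^ logExponent d θ) * seqNorm θ a) := by
  set κ := logExponent d θ with hκ
  have hκ0 : 0 ≤ κ := logExponent_nonneg hd hθ
  set S : ℕ → ℝ := fun ν => (2 : ℝ) ^ (-δ * ν) * ((ν : ℝ) + 1) ^ κ with hS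
  have hSsum : Summable S := summable_geometric_mul_rpow hδ
  have hS0 : ∀ ν, 0 ≤ S ν := fun ν => by positivity
  refine ⟨ENNReal.ofReal (∑' ν, S ν), ENNReal.ofReal_ne_top, fun M a => ?_⟩
  have hterm : ∀ μ, ∑ m ∈ level d μ, (if M ≤ ∑ i, m i then
      (2 : ℝ≥0∞) ^ (-δ * ((∑ i, m i : ℕ) : ℝ)) * a m else 0) ≤
      if M ≤ μ then ENNReal.ofReal (S μ) * seqNorm θ a else 0 := fun μ => by
    have h1 : ∀ m ∈ level d μ, (if M ≤ ∑ i, m i then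
        (2 : ℝ≥0∞) ^ (-δ * ((∑ i, m i : ℕ) : ℝ)) * a m else 0) =
        if M ≤ μ then (2 : ℝ≥0∞) ^ (-δ * (μ : ℝ)) * a m else 0 := fun m hm => by
      rw [mem_level.1 hm]
    rw [Finset.sum_congr rfl h1]
    split_ifs with h
    · rw [← Finset.mul_sum, hS, ENNReal.ofReal_mul (by positivity), mul_assoc,
        ← ENNReal.ofReal_rpow_of_pos (by norm_num), ENNReal.ofReal_ofNat]
      gcongr
      refine (sum_le_card_rpow_mul_seqNorm hθ a _).trans ?_
      gcongr
      rw [hκ, logExponent, Real.rpow_mul (by positivity), ← ENNReal.ofReal_rpow_of_nonneg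
        (by positivity) (by linarith [one_div_toReal_le_one hθ])]
      refine ENNReal.rpow_le_rpow ?_ (by linarith [one_div_toReal_le_one hθ])
      have h2 : ((level d μ).card : ℝ) ≤ ((μ : ℝ) + 1) ^ (d - 1) := by
        exact_mod_cast card_level_le hd μ
      rw [← ENNReal.ofReal_natCast, show ((d : ℝ) - 1) = ((d - 1 : ℕ) : ℝ) by
        rw [Nat.cast_sub hd]; simp, Real.rpow_natCast]
      exact ENNReal.ofReal_le_ofReal h2
    · simp
  rw [tsum_eq_tsum_level]
  refine (ENNReal.tsum_le_tsum hterm).trans ?_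
  rw [tsum_ite_le_eq_tsum_add, ENNReal.ofReal_tsum_of_nonneg hS0 hSsum, ENNReal.tsum_mul_right, ← mul_assoc]
  gcongr
  rw [← ENNReal.tsum_mul_right]
  refine ENNReal.tsum_le_tsum fun ν => ?_
  rw [← ENNReal.ofReal_mul (hS0 _)]
  refine ENNReal.ofReal_le_ofReal ?_
  rw [hS]
  simp only
  have h4 : ((ν + M : ℕ) : ℝ) + 1 ≤ ((ν : ℝ) + 1) * ((M : ℝ) + 1) := by
    push_cast
    nlinarith [mul_nonneg (Nat.cast_nonneg ν : (0 : ℝ) ≤ ν) (Nat.cast_nonneg M : (0 : ℝ) ≤ M)]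
  calc (2 : ℝ) ^ (-δ * ((ν + M : ℕ) : ℝ)) * (((ν + M : ℕ) : ℝ) + 1) ^ κ
      ≤ (2 : ℝ) ^ (-δ * ((ν + M : ℕ) : ℝ)) * (((ν : ℝ) + 1) * ((M : ℝ) + 1)) ^ κ := by gcongr
    _ = _ := by
        rw [Real.mul_rpow (by positivity) (by positivity)]
        push_cast
        rw [mul_add, Real.rpow_add (by norm_num)]
        ring

/-! ### Pairing an `L_p` function with a bounded weight -/

theorem lintegral_mul_le_rpow {α : Type*} [MeasurableSpace α] {μ : Measure α} {p : ℝ≥0∞}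
    (hp : 1 ≤ p) {g : α → ℂ} (hg : AEStronglyMeasurable g μ) {w : α → ℝ≥0∞} (hw : Measurable w)
    {H W : ℝ≥0∞} (hH : ∀ x, w x ≤ H) (hW : ∫⁻ x, w x ∂μ ≤ W) :
    ∫⁻ x, w x * ‖g x‖ₑ ∂μ ≤
      H ^ (1 / p).toReal * W ^ (1 - (1 / p).toReal) * eLpNorm g p μ := by
  set ν := μ.withDensity w with hν
  have hνle : ν ≤ H • μ := by
    rw [hν, ← withDensity_const]
    exact withDensity_mono (Filter.Eventually.of_forall hH)
  have hac : ν ≪ μ := withDensity_absolutelyContinuous _ _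
  have h1 : ∫⁻ x, w x * ‖g x‖ₑ ∂μ = eLpNorm g 1 ν := by
    rw [eLpNorm_one_eq_lintegral_enorm, hν, lintegral_withDensity_eq_lintegral_mul₀
      hw.aemeasurable hg.enorm]
    rfl
  rw [h1]
  refine (eLpNorm_le_eLpNorm_mul_rpow_measure_univ hp (hg.mono_ac hac)).trans ?_
  rw [one_div_toReal, ENNReal.toReal_one, div_one, mul_comm, mul_assoc, mul_left_comm]
  have hsub : 0 ≤ 1 - 1 / p.toReal := by
    rw [← one_div_toReal]; linarith [one_div_toReal_le_one hp]
  gcongr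
  · rw [hν, withDensity_apply _ MeasurableSet.univ, Measure.restrict_univ]
    exact hW
  · refine (eLpNorm_mono_measure g hνle).trans ?_
    rcases eq_or_ne H 0 with h0 | h0
    · rw [h0, zero_smul, eLpNorm_measure_zero]
      exact zero_le
    · refine le_of_eq ?_
      rw [eLpNorm_smul_measure_of_ne_zero h0, smul_eq_mul, one_div_toReal]

/-! ### Bounds for the dual kernels -/

theorem two_pow_sum {d : ℕ} (m : Fin d → ℕ) : ∏ i, (2 : ℝ≥0∞) ^ m i = 2 ^ ∑ i, m i :=
  Finset.prod_pow_eq_pow_sum _ _ _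

theorem summable_of_tsum_enorm_ne_top {ι : Type*} {f : ι → ℂ} (h : ∑' i, ‖f i‖ₑ ≠ ⊤) :
    Summable f := by
  refine Summable.of_norm ?_
  have := ENNReal.summable_toReal h
  simpa only [toReal_enorm] using this

namespace DualKernel

variable {L : ℕ} {K : LocalMeanKernel L} (D : DualKernel K) {d : ℕ}

/-- A uniform bound for the `L_1` norms of the one-dimensional dual kernels. -/
def mass : ℝ≥0∞ := (∫⁻ t, ‖D.Λ₀ t‖ₑ) + ∫⁻ t, ‖D.Λ₁ t‖ₑ

theorem mass_ne_top : D.mass ≠ ⊤ :=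
  ENNReal.add_ne_top.2 ⟨D.Λ₀.integrable.2.ne, D.Λ₁.integrable.2.ne⟩

/-- The function `Λ_m(z) = ∏ i, Λ_{m_i}(z_i)`. -/
def profile (m : Fin d → ℕ) (z : Pt d) : ℂ := ∏ i, D.dilate (m i) (z i)

theorem kernel_eq_profile (m : Fin d → ℕ) (x y : Pt d) : D.kernel m x y = D.profile m (x - y) := rfl

theorem continuous_profile (m : Fin d → ℕ) : Continuous (D.profile m) :=
  continuous_finsetProd _ fun i _ => (D.continuous_dilate (m i)).comp (by fun_prop)

theorem integrable_profile (m : Fin d → ℕ) : Integrable (D.profile m) :=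
  integrable_prod_coord fun i => D.integrable_dilate (m i)

theorem integral_profile (m : Fin d → ℕ) :
    ∫ z, D.profile m z = ∏ i, ∫ t, D.dilate (m i) t :=
  integral_prod_coord fun i => D.dilate (m i)

theorem lintegral_profile_le (m : Fin d → ℕ) : ∫⁻ z, ‖D.profile m z‖ₑ ≤ D.mass ^ d := by
  rw [show (∫⁻ z, ‖D.profile m z‖ₑ) = _ from
    lintegral_enorm_prod_coord fun i => D.integrable_dilate (m i)]
  calc ∏ i, ∫⁻ t, ‖D.dilate (m i) t‖ₑ ≤ ∏ _ : Fin d, D.mass :=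
        Finset.prod_le_prod' fun i _ => D.lintegral_enorm_dilate_le (m i)
    _ = _ := by simp

theorem enorm_profile_le (m : Fin d → ℕ) (z : Pt d) : ‖D.profile m z‖ₑ ≤
    D.const ^ d * 2 ^ (∑ i, m i) * ∏ i, decay (2 ^ m i * z i) := by
  rw [profile, enorm_prod]
  calc ∏ i, ‖D.dilate (m i) (z i)‖ₑ ≤ ∏ i, D.const * 2 ^ m i * decay (2 ^ m i * z i) :=
        Finset.prod_le_prod' fun i _ => D.enorm_dilate_le (m i) (z i)
    _ = _ := by
        rw [Finset.prod_mul_distrib, Finset.prod_mul_distrib, two_pow_sum]; simp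

theorem lintegral_kernel_left (m : Fin d → ℕ) (y : Pt d) :
    ∫⁻ x, ‖D.kernel m x y‖ₑ ≤ D.mass ^ d := by
  simp only [kernel_eq_profile]
  rw [lintegral_sub_right_eq_self fun z => ‖D.profile m z‖ₑ]
  exact D.lintegral_profile_le m

theorem lintegral_kernel_right (m : Fin d → ℕ) (x : Pt d) :
    ∫⁻ y, ‖D.kernel m x y‖ₑ ≤ D.mass ^ d := by
  simp only [kernel_eq_profile]
  rw [lintegral_sub_left_eq_self (fun z => ‖D.profile m z‖ₑ)]
  exact D.lintegral_profile_le m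

theorem continuous_kernel_right (m : Fin d → ℕ) (x : Pt d) : Continuous (D.kernel m x) :=
  (D.continuous_profile m).comp (continuous_const.sub continuous_id)

theorem continuous_kernel_left (m : Fin d → ℕ) (y : Pt d) :
    Continuous fun x => D.kernel m x y :=
  (D.continuous_profile m).comp (continuous_id.sub continuous_const)

theorem enorm_synth_le (m : Fin d → ℕ) (g : Pt d → ℂ) (x : Pt d) :
    ‖D.synth m g x‖ₑ ≤ ∫⁻ y, ‖D.kernel m x y‖ₑ * ‖g y‖ₑ := by
  refine (enorm_integral_le_lintegral_enorm _).trans (le_of_eq ?_)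
  simp only [enorm_mul]

theorem exists_lintegral_kernel_mul_le {p : ℝ≥0∞} (hp : 1 ≤ p) : ∃ C : ℝ≥0∞, C ≠ ⊤ ∧
    ∀ (m : Fin d → ℕ) (x : Pt d) (g : Pt d → ℂ), Continuous g →
      ∫⁻ y, ‖D.kernel m x y‖ₑ * ‖g y‖ₑ ≤
        C * ((2 ^ ∑ i, m i : ℝ≥0∞) ^ (1 / p).toReal * eLpNorm g p volume) := by
  have h0 : 0 ≤ 1 - (1 / p).toReal := by linarith [one_div_toReal_le_one hp]
  refine ⟨(D.const ^ d) ^ (1 / p).toReal * (D.mass ^ d) ^ (1 - (1 / p).toReal), ?_,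
    fun m x g hg => ?_⟩
  · have h1 := D.const_ne_top
    have h2 := D.mass_ne_top
    exact ENNReal.mul_ne_top (ENNReal.rpow_ne_top_of_nonneg (by positivity) (by finiteness))
      (ENNReal.rpow_ne_top_of_nonneg h0 (by finiteness))
  · have h := lintegral_mul_le_rpow (μ := volume) hp hg.aestronglyMeasurable
      (w := fun y => ‖D.kernel m x y‖ₑ) (D.continuous_kernel_right m x).enorm.measurable
      (H := D.const ^ d * 2 ^ ∑ i, m i) (fun y => ?_) (D.lintegral_kernel_right m x)
    · refine h.trans (le_of_eq ?_)
      rw [ENNReal.mul_rpow_of_nonneg _ _ (by positivity)]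
      ring
    · refine (D.enorm_profile_le m (x - y)).trans ?_
      exact mul_le_of_le_one_right' (Finset.prod_le_one' fun i _ => decay_le_one _)

theorem continuous_synth (m : Fin d → ℕ) {g : Pt d → ℂ} (hg : Continuous g)
    (hc : HasCompactSupport g) : Continuous (D.synth m g) := by
  have h := hc.continuous_convolution_left (ContinuousLinearMap.mul ℝ ℂ) (μ := volume) hg
    (D.continuous_profile m).locallyIntegrable
  refine h.congr fun x => ?_
  simp only [convolution, synth, ContinuousLinearMap.mul_apply', kernel_eq_profile]
  refine integral_congr_ae (Filter.Eventually.of_forall fun y => mul_comm _ _)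

theorem integral_synth (m : Fin d → ℕ) {g : Pt d → ℂ} (hg : Integrable g) :
    ∫ x, D.synth m g x = (∏ i, ∫ t, D.dilate (m i) t) * ∫ y, g y := by
  have h := integral_convolution (ContinuousLinearMap.mul ℝ ℂ) (μ := volume) (ν := volume) hg
    (D.integrable_profile m)
  rw [ContinuousLinearMap.mul_apply', D.integral_profile, mul_comm] at h
  rw [← h]
  refine integral_congr_ae (Filter.Eventually.of_forall fun x => ?_)
  simp only [convolution, synth, ContinuousLinearMap.mul_apply', kernel_eq_profile]
  refine integral_congr_ae (Filter.Eventually.of_forall fun y => mul_comm _ _)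

theorem lintegral_synth_le (m : Fin d → ℕ) {g : Pt d → ℂ} (hg : Continuous g) :
    ∫⁻ x, ‖D.synth m g x‖ₑ ≤ D.mass ^ d * ∫⁻ y, ‖g y‖ₑ := by
  calc ∫⁻ x, ‖D.synth m g x‖ₑ ≤ ∫⁻ x, ∫⁻ y, ‖D.kernel m x y‖ₑ * ‖g y‖ₑ :=
        lintegral_mono fun x => D.enorm_synth_le m g x
    _ = ∫⁻ y, ∫⁻ x, ‖D.kernel m x y‖ₑ * ‖g y‖ₑ := by
        refine lintegral_lintegral_swap ?_
        have h1 := (D.continuous_kernel (d := d) m).enorm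
        have h2 := (hg.comp (continuous_snd (X := Pt d) (Y := Pt d))).enorm
        exact (h1.measurable.mul h2.measurable).aemeasurable
    _ ≤ ∫⁻ y, D.mass ^ d * ‖g y‖ₑ := by
        refine lintegral_mono fun y => ?_
        rw [lintegral_mul_const _ (D.continuous_kernel_left m y).enorm.measurable]
        gcongr
        exact D.lintegral_kernel_left m y
    _ = _ := lintegral_const_mul _ hg.enorm.measurable

/-! ### Sums of the dual kernels over the Frolov lattice -/

end DualKernel

/-- The points of the Frolov lattice. -/
def frolovPt (d n : ℕ) (k : Fin d → ℤ) : Pt d := WithLp.toLp 2 (latticePt (frolovMatrix d n) k)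

namespace DualKernel

variable {L : ℕ} {K : LocalMeanKernel L} (D : DualKernel K) {d : ℕ}

/-- The sum of `|Λ_m(x - y)|` over the points `x` of the Frolov lattice. -/
def latticeSum (m : Fin d → ℕ) (n : ℕ) (y : Pt d) : ℝ≥0∞ := ∑' k, ‖D.kernel m (frolovPt d n k) y‖ₑ

theorem measurable_latticeSum (m : Fin d → ℕ) (n : ℕ) : Measurable (D.latticeSum m n) :=
  Measurable.tsum fun _ => (D.continuous_kernel_right m _).enorm.measurable

theorem exists_latticeSum_le (hd : 1 ≤ d) : ∃ C : ℝ≥0∞, C ≠ ⊤ ∧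
    ∀ (m : Fin d → ℕ) (n : ℕ), 1 ≤ n → ∀ y, D.latticeSum m n y ≤ C * (n + 2 ^ ∑ i, m i) := by
  obtain ⟨c, hc, hadm⟩ := exists_frolovMatrix_admissible hd
  refine ⟨D.const ^ d * (4 * decaySum) ^ d * (ENNReal.ofReal c⁻¹ + 1), ?_, fun m n hn y => ?_⟩
  · have h1 := D.const_ne_top
    have h2 := decaySum_lt_top.ne
    finiteness
  · have hn0 : (0 : ℝ) < n := by exact_mod_cast hn
    have hA : IsAdmissible (frolovMatrix d n) (c / n) := fun k hk => (hadm n hn k hk).1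
    have hsum := hA.tsum_decay_le hd (by positivity) (fun i => 2 ^ m i) (fun i => y i)
      (fun i => by positivity)
    calc D.latticeSum m n y
        ≤ ∑' k, D.const ^ d * 2 ^ (∑ i, m i) *
            ∏ i, decay (2 ^ m i * (latticePt (frolovMatrix d n) k i - y i)) :=
          ENNReal.tsum_le_tsum fun k => D.enorm_profile_le m (frolovPt d n k - y)
      _ = D.const ^ d * 2 ^ (∑ i, m i) *
            ∑' k, ∏ i, decay (2 ^ m i * (latticePt (frolovMatrix d n) k i - y i)) :=
          ENNReal.tsum_mul_left
      _ ≤ D.const ^ d * 2 ^ (∑ i, m i) * ((4 * decaySum) ^ d *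
            ENNReal.ofReal ((∏ i, (2 : ℝ) ^ m i)⁻¹ / (c / n) + 1)) := by gcongr
      _ = D.const ^ d * (4 * decaySum) ^ d *
            (2 ^ (∑ i, m i) * ENNReal.ofReal ((∏ i, (2 : ℝ) ^ m i)⁻¹ / (c / n) + 1)) := by ring
      _ ≤ D.const ^ d * (4 * decaySum) ^ d *
            ((ENNReal.ofReal c⁻¹ + 1) * (n + 2 ^ ∑ i, m i)) := by
          refine mul_le_mul_right ?_ _
          rw [Finset.prod_pow_eq_pow_sum]
          set P : ℝ := 2 ^ ∑ i, m i with hP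
          have hP0 : 0 < P := by positivity
          have hP1 : (2 : ℝ≥0∞) ^ (∑ i, m i) = ENNReal.ofReal P := by
            rw [hP, ENNReal.ofReal_pow (by norm_num)]; simp
          rw [hP1, ← ENNReal.ofReal_mul hP0.le, ← ENNReal.ofReal_natCast,
            ← ENNReal.ofReal_add (by positivity) hP0.le, ← ENNReal.ofReal_one,
            ← ENNReal.ofReal_add (by positivity) one_pos.le, ← ENNReal.ofReal_mul (by positivity)]
          refine ENNReal.ofReal_le_ofReal ?_
          have : P * (P⁻¹ / (c / n) + 1) = c⁻¹ * n + P := by field_simp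
          rw [this]
          have h3 : 0 < c⁻¹ := by positivity
          nlinarith [mul_pos h3 hP0]
      _ = _ := by ring

theorem exists_lintegral_latticeSum_le (hd : 1 ≤ d) {r : ℝ} (hr : 0 ≤ r) : ∃ C : ℝ≥0∞, C ≠ ⊤ ∧
    ∀ (m : Fin d → ℕ) (n : ℕ), 1 ≤ n → ∫⁻ y in bigCube d r, D.latticeSum m n y ≤ C * n := by
  obtain ⟨c, hc, hadm⟩ := exists_frolovMatrix_admissible hd
  refine ⟨ENNReal.ofReal ((2 * r + 1) ^ d / c + 1) * D.mass ^ d, ?_, fun m n hn => ?_⟩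
  · have h1 := D.mass_ne_top
    finiteness
  have hn0 : (0 : ℝ) < n := by exact_mod_cast hn
  have hn1 : (1 : ℝ) ≤ n := by exact_mod_cast hn
  have hA : IsAdmissible (frolovMatrix d n) (c / n) := fun k hk => (hadm n hn k hk).1
  have hSm : MeasurableSet (bigCube d r) := (isClosed_bigCube d r).measurableSet
  have hcount : ∀ z : Pt d, ∑' k, (bigCube d r).indicator (1 : Pt d → ℝ≥0∞) (frolovPt d n k - z) ≤
      ENNReal.ofReal ((2 * r + 1) ^ d / c + 1) * n := fun z => by
    have h1 := hA.tsum_box_le hd (by positivity) (fun i => z i - r) (fun _ => 2 * r + 1)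
      fun _ => by positivity
    set B : Set (Fin d → ℤ) := {k | ∀ i, latticePt (frolovMatrix d n) k i ∈
      Set.Ico (z i - r) (z i - r + (2 * r + 1))} with hB
    calc ∑' k, (bigCube d r).indicator (1 : Pt d → ℝ≥0∞) (frolovPt d n k - z)
        ≤ ∑' k, B.indicator (fun _ => (1 : ℝ≥0∞)) k := by
          refine ENNReal.tsum_le_tsum fun k => ?_
          by_cases h : frolovPt d n k - z ∈ bigCube d r
          · have hk : k ∈ B := fun i => by
              have := abs_le.1 (h i)
              change -r ≤ latticePt (frolovMatrix d n) k i - z i ∧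
                latticePt (frolovMatrix d n) k i - z i ≤ r at this
              constructor <;> linarith [this.1, this.2]
            rw [Set.indicator_of_mem h, Set.indicator_of_mem hk]
            rfl
          · rw [Set.indicator_of_notMem h]; exact zero_le
      _ = ∑' _ : B, (1 : ℝ≥0∞) := (tsum_subtype B _).symm
      _ ≤ ENNReal.ofReal ((∏ _ : Fin d, (2 * r + 1)) / (c / n) + 1) := h1
      _ ≤ _ := by
          rw [← ENNReal.ofReal_natCast n, ← ENNReal.ofReal_mul (by positivity)]
          refine ENNReal.ofReal_le_ofReal ?_
          simp only [Finset.prod_const, Finset.card_univ, Fintype.card_fin]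
          rw [add_mul, one_mul, div_div_eq_mul_div, mul_div_right_comm]
          gcongr
  have hk : ∀ k, ∫⁻ y in bigCube d r, ‖D.kernel m (frolovPt d n k) y‖ₑ =
      ∫⁻ z, ‖D.profile m z‖ₑ * (bigCube d r).indicator (1 : Pt d → ℝ≥0∞) (frolovPt d n k - z) :=
    fun k => by
      rw [← lintegral_indicator hSm, ← lintegral_sub_left_eq_self _ (frolovPt d n k)]
      refine lintegral_congr fun z => ?_
      by_cases h : frolovPt d n k - z ∈ bigCube d r
      · rw [Set.indicator_of_mem h, Set.indicator_of_mem h, kernel_eq_profile, sub_sub_cancel]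
        simp
      · rw [Set.indicator_of_notMem h, Set.indicator_of_notMem h, mul_zero]
  have hind : Measurable ((bigCube d r).indicator (1 : Pt d → ℝ≥0∞)) :=
    measurable_one.indicator hSm
  simp only [latticeSum]
  rw [lintegral_tsum fun k => (D.continuous_kernel_right m _).enorm.measurable.aemeasurable]
  simp only [hk]
  have hmeas : ∀ k : Fin d → ℤ, AEMeasurable (fun z : Pt d => ‖D.profile m z‖ₑ *
      (bigCube d r).indicator (1 : Pt d → ℝ≥0∞) (frolovPt d n k - z)) volume := fun k =>
    ((D.continuous_profile m).enorm.measurable.mul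
      (hind.comp (measurable_const.sub measurable_id))).aemeasurable
  rw [← lintegral_tsum hmeas]
  calc ∫⁻ z, ∑' k, ‖D.profile m z‖ₑ *
        (bigCube d r).indicator (1 : Pt d → ℝ≥0∞) (frolovPt d n k - z)
      ≤ ∫⁻ z, ‖D.profile m z‖ₑ * (ENNReal.ofReal ((2 * r + 1) ^ d / c + 1) * n) := by
        refine lintegral_mono fun z => ?_
        simp only
        rw [ENNReal.tsum_mul_left]
        gcongr
        exact hcount z
    _ = (∫⁻ z, ‖D.profile m z‖ₑ) * (ENNReal.ofReal ((2 * r + 1) ^ d / c + 1) * n) :=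
        lintegral_mul_const _ (D.continuous_profile m).enorm.measurable
    _ ≤ D.mass ^ d * (ENNReal.ofReal ((2 * r + 1) ^ d / c + 1) * n) := by
        gcongr
        exact D.lintegral_profile_le m
    _ = _ := by ring

/-- An upper bound for the contribution of one dyadic block to the cubature error. -/
def blockBound (r : ℝ) (m : Fin d → ℕ) (n : ℕ) (g : Pt d → ℂ) : ℝ≥0∞ :=
  ∫⁻ y in bigCube d r, (D.latticeSum m n y / n + D.mass ^ d) * ‖g y‖ₑ

theorem exists_blockBound_le (hd : 1 ≤ d) {r : ℝ} (hr : 0 ≤ r) {p : ℝ≥0∞} (hp : 1 ≤ p) :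
    ∃ C : ℝ≥0∞, C ≠ ⊤ ∧ ∀ (m : Fin d → ℕ) (n : ℕ), 1 ≤ n → ∀ g : Pt d → ℂ, Continuous g →
      D.blockBound r m n g ≤
        C * ((1 + 2 ^ (∑ i, m i) / n : ℝ≥0∞) ^ (1 / p).toReal * eLpNorm g p volume) := by
  obtain ⟨C₁, hC₁, h₁⟩ := D.exists_latticeSum_le hd
  obtain ⟨C₂, hC₂, h₂⟩ := D.exists_lintegral_latticeSum_le hd hr
  have h0 : 0 ≤ 1 - (1 / p).toReal := by linarith [one_div_toReal_le_one hp]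
  have hm := D.mass_ne_top
  have hv : volume (bigCube d r) ≠ ⊤ := (isCompact_bigCube d r).measure_lt_top.ne
  refine ⟨(C₁ + D.mass ^ d) ^ (1 / p).toReal *
    (C₂ + D.mass ^ d * volume (bigCube d r)) ^ (1 - (1 / p).toReal),
    ENNReal.mul_ne_top (ENNReal.rpow_ne_top_of_nonneg (by positivity) (by finiteness))
      (ENNReal.rpow_ne_top_of_nonneg h0 (by finiteness)), fun m n hn g hg => ?_⟩
  have hn0 : (n : ℝ≥0∞) ≠ 0 := by
    simp only [ne_eq, Nat.cast_eq_zero]; omega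
  have hnt : (n : ℝ≥0∞) ≠ ⊤ := ENNReal.natCast_ne_top n
  have hmeas : Measurable fun y => D.latticeSum m n y / n + D.mass ^ d :=
    ((D.measurable_latticeSum m n).div_const _).add_const _
  have h := lintegral_mul_le_rpow (μ := volume.restrict (bigCube d r)) hp
    hg.aestronglyMeasurable (w := fun y => D.latticeSum m n y / n + D.mass ^ d) hmeas
    (H := (C₁ + D.mass ^ d) * (1 + 2 ^ (∑ i, m i) / n))
    (W := C₂ + D.mass ^ d * volume (bigCube d r)) (fun y => ?_) ?_
  · refine h.trans ?_
    rw [ENNReal.mul_rpow_of_nonneg _ _ (by positivity)]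
    calc _ ≤ (C₁ + D.mass ^ d) ^ (1 / p).toReal * (1 + 2 ^ (∑ i, m i) / n) ^ (1 / p).toReal *
          (C₂ + D.mass ^ d * volume (bigCube d r)) ^ (1 - (1 / p).toReal) *
          eLpNorm g p volume := by
            gcongr
            exact Measure.restrict_le_self
      _ = _ := by ring
  · rw [add_mul]
    refine add_le_add ?_ (le_mul_of_one_le_right' le_self_add)
    calc D.latticeSum m n y / n ≤ C₁ * (n + 2 ^ ∑ i, m i) / n := by
          gcongr
          exact h₁ m n hn y
      _ = C₁ * (1 + 2 ^ (∑ i, m i) / n) := by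
          rw [mul_div_assoc, ENNReal.add_div, ENNReal.div_self hn0 hnt]
  · rw [lintegral_add_right _ measurable_const, setLIntegral_const]
    gcongr
    simp only [div_eq_mul_inv]
    rw [lintegral_mul_const _ (D.measurable_latticeSum m n)]
    calc _ ≤ C₂ * n * (n : ℝ≥0∞)⁻¹ := by
          gcongr
          exact h₂ m n hn
      _ = C₂ := by rw [mul_assoc, ENNReal.mul_inv_cancel hn0 hnt, mul_one]

end DualKernel

/-! ### The error of Frolov's rule on one dyadic block -/

namespace DualKernel

variable {L : ℕ} {K : LocalMeanKernel L} (D : DualKernel K) {d : ℕ}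

theorem lintegral_enorm_lt_top {g : Pt d → ℂ} (hg : Continuous g) (hc : HasCompactSupport g) :
    ∫⁻ y, ‖g y‖ₑ < ⊤ :=
  (hg.integrable_of_hasCompactSupport hc).2

theorem hasCompactSupport_of_bigCube {g : Pt d → ℂ} {r : ℝ}
    (hr : ∀ x, g x ≠ 0 → x ∈ bigCube d r) : HasCompactSupport g :=
  HasCompactSupport.intro (isCompact_bigCube d r) fun y hy => by_contra fun h => hy (hr y h)

theorem setLIntegral_mul_enorm {g : Pt d → ℂ} {r : ℝ} (hr : ∀ x, g x ≠ 0 → x ∈ bigCube d r)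
    (w : Pt d → ℝ≥0∞) : ∫⁻ y in bigCube d r, w y * ‖g y‖ₑ = ∫⁻ y, w y * ‖g y‖ₑ := by
  refine setLIntegral_eq_of_support_subset fun y hy => hr y fun h => ?_
  simp [h] at hy

theorem tsum_enorm_synth_le (m : Fin d → ℕ) (n : ℕ) {g : Pt d → ℂ} (hg : Continuous g) {r : ℝ}
    (hr : ∀ x, g x ≠ 0 → x ∈ bigCube d r) :
    ∑' k, ‖D.synth m g (frolovPt d n k)‖ₑ ≤ ∫⁻ y in bigCube d r, D.latticeSum m n y * ‖g y‖ₑ := by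
  rw [setLIntegral_mul_enorm hr]
  calc ∑' k, ‖D.synth m g (frolovPt d n k)‖ₑ
      ≤ ∑' k, ∫⁻ y, ‖D.kernel m (frolovPt d n k) y‖ₑ * ‖g y‖ₑ :=
        ENNReal.tsum_le_tsum fun k => D.enorm_synth_le m g _
    _ = ∫⁻ y, ∑' k, ‖D.kernel m (frolovPt d n k) y‖ₑ * ‖g y‖ₑ :=
        (lintegral_tsum fun k => ((D.continuous_kernel_right m _).enorm.measurable.mul
          hg.enorm.measurable).aemeasurable).symm
    _ = _ := by simp only [ENNReal.tsum_mul_right, latticeSum]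

/-- The error of the (full lattice) cubature rule on one dyadic block. -/
def blockError (m : Fin d → ℕ) (n : ℕ) (g : Pt d → ℂ) : ℂ :=
  (∫ x, D.synth m g x) - (1 / (n : ℂ)) * ∑' k, D.synth m g (frolovPt d n k)

theorem tsum_enorm_synth_div_le (m : Fin d → ℕ) (n : ℕ) {g : Pt d → ℂ}
    (hg : Continuous g) {r : ℝ} (hr : ∀ x, g x ≠ 0 → x ∈ bigCube d r) :
    (∑' k, ‖D.synth m g (frolovPt d n k)‖ₑ) / n + ∫⁻ x, ‖D.synth m g x‖ₑ ≤
      D.blockBound r m n g := by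
  have h1 : D.blockBound r m n g = (∫⁻ y in bigCube d r, D.latticeSum m n y * ‖g y‖ₑ) / n +
      D.mass ^ d * ∫⁻ y in bigCube d r, ‖g y‖ₑ := by
    simp only [blockBound, add_mul, div_eq_mul_inv]
    have hm1 : Measurable fun y => D.mass ^ d * ‖g y‖ₑ := measurable_const.mul hg.enorm.measurable
    have hm2 : Measurable fun y => D.latticeSum m n y * ‖g y‖ₑ :=
      (D.measurable_latticeSum m n).mul hg.enorm.measurable
    rw [lintegral_add_right _ hm1, lintegral_const_mul _ hg.enorm.measurable,
      ← lintegral_mul_const _ hm2]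
    congr 1
    refine lintegral_congr fun y => ?_
    ring
  have h2 : ∫⁻ y in bigCube d r, ‖g y‖ₑ = ∫⁻ y, ‖g y‖ₑ := by
    have := setLIntegral_mul_enorm hr 1
    simpa using this
  rw [h1, h2]
  gcongr
  · exact D.tsum_enorm_synth_le m n hg hr
  · exact D.lintegral_synth_le m hg

theorem enorm_blockError_le (m : Fin d → ℕ) (n : ℕ) {g : Pt d → ℂ}
    (hg : Continuous g) {r : ℝ} (hr : ∀ x, g x ≠ 0 → x ∈ bigCube d r) :
    ‖D.blockError m n g‖ₑ ≤ D.blockBound r m n g := by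
  refine le_trans ?_ (D.tsum_enorm_synth_div_le m n hg hr)
  rw [blockError, add_comm]
  refine (enorm_sub_le).trans (add_le_add (enorm_integral_le_lintegral_enorm _) ?_)
  rw [enorm_mul, mul_comm ‖1 / (n : ℂ)‖ₑ, div_eq_mul_inv]
  refine mul_le_mul' ?_ ?_
  · exact enorm_tsum_le_tsum_enorm
  · rcases Nat.eq_zero_or_pos n with h | h
    · simp [h]
    · rw [one_mul, enorm_inv (by exact_mod_cast h.ne')]
      rw [← ofReal_norm]
      simp

/-- Frolov's rule is exact on the low-frequency blocks. -/
theorem exists_blockError_eq_zero (hd : 1 ≤ d) : ∃ a : ℕ, ∀ (m : Fin d → ℕ) (n : ℕ), 1 ≤ n →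
    2 ^ (∑ i, m i + a) ≤ n → ∀ (g : Pt d → ℂ), Continuous g → HasCompactSupport g →
      D.blockError m n g = 0 := by
  obtain ⟨c, hc, hadm⟩ := exists_frolovMatrix_admissible hd
  obtain ⟨a, ha⟩ := pow_unbounded_of_one_lt (D.R ^ d / c) (one_lt_two)
  refine ⟨a, fun m n hn hmn g hg hgc => ?_⟩
  have hn0 : (0 : ℝ) < n := by exact_mod_cast hn
  have hA : IsAdmissible (frolovMatrix d n) (c / n) := fun k hk => (hadm n hn k hk).1
  have hdet := frolovMatrix_det hd hn
  have hmn' : (2 : ℝ) ^ (∑ i, m i) * 2 ^ a ≤ n := by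
    rw [← pow_add]; exact_mod_cast hmn
  have hRc : D.R ^ d < c * 2 ^ a := by rwa [div_lt_iff₀' hc] at ha
  have hvan : ∀ k : Fin d → ℤ, k ≠ 0 → ∃ i, 𝓕 (D.dilate (m i))
      (latticePt ((frolovMatrix d n)⁻¹.transpose) k i) = 0 := fun k hk => by
    by_contra! hcon
    have h1 : ∀ i, |latticePt ((frolovMatrix d n)⁻¹.transpose) k i| ≤ D.R * 2 ^ m i := fun i => by
      by_contra! h
      exact hcon i (D.fourier_dilate_eq_zero _ h.le)
    have h2 := (hadm n hn k hk).2
    have h3 : |∏ i, latticePt ((frolovMatrix d n)⁻¹.transpose) k i| ≤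
        D.R ^ d * 2 ^ ∑ i, m i := by
      rw [Finset.abs_prod]
      calc _ ≤ ∏ i, D.R * 2 ^ m i := Finset.prod_le_prod (fun _ _ => abs_nonneg _) fun i _ => h1 i
        _ = _ := by
          rw [Finset.prod_mul_distrib, Finset.prod_pow_eq_pow_sum]; simp
    have h4 : D.R ^ d * 2 ^ ∑ i, m i < c * n := by
      calc D.R ^ d * 2 ^ ∑ i, m i < c * 2 ^ a * 2 ^ ∑ i, m i := by gcongr
        _ = c * (2 ^ (∑ i, m i) * 2 ^ a) := by ring
        _ ≤ c * n := by gcongr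
    exact absurd (h2.trans h3) (not_le.2 h4)
  have hpois : ∀ y : Pt d, ∑' k, D.kernel m (frolovPt d n k) y =
      n * ∏ i, ∫ t, D.dilate (m i) t := fun y => by
    have hdec : ∀ i t, ‖D.dilate (m i) t‖ₑ ≤
        (D.const * 2 ^ (∑ i, m i) * 4 ^ (∑ i, m i)) * decay t := fun i t => by
      have hmi : m i ≤ ∑ i, m i := Finset.single_le_sum (f := m) (fun _ _ => Nat.zero_le _)
        (Finset.mem_univ i)
      have h4 : ∀ j : ℕ, decay ((2 : ℝ) ^ j * t) ≤ 4 ^ j * decay t := fun j => by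
        refine le_trans ?_ (le_mul_of_one_le_left' (one_le_pow₀ (by norm_num)))
        refine ENNReal.ofReal_le_ofReal ?_
        have habs : |t| ≤ |2 ^ j * t| := by
          rw [abs_mul, abs_of_pos (by positivity : (0 : ℝ) < 2 ^ j)]
          exact le_mul_of_one_le_left (abs_nonneg t) (one_le_pow₀ (by norm_num))
        exact inv_anti₀ (by positivity) (by gcongr)
      calc ‖D.dilate (m i) t‖ₑ ≤ D.const * 2 ^ m i * decay (2 ^ m i * t) := D.enorm_dilate_le _ _
        _ ≤ D.const * 2 ^ m i * (4 ^ m i * decay t) := by gcongr; exact h4 _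
        _ ≤ D.const * 2 ^ (∑ i, m i) * (4 ^ (∑ i, m i) * decay t) := by gcongr <;> norm_num
        _ = _ := by ring
    have h := tsum_latticePt_eq_integral hd (by rw [hdet]; positivity) (by positivity) hA
      (F := fun i => D.dilate (m i)) (fun i => D.continuous_dilate _)
      (by have := D.const_ne_top; finiteness) hdec hvan y.ofLp
    rw [hdet, abs_of_pos (by positivity), inv_inv] at h
    exact_mod_cast h
  have hgi : Integrable g := hg.integrable_of_hasCompactSupport hgc
  obtain ⟨C, hC, hCb⟩ := D.exists_latticeSum_le hd
  have hn0' : (n : ℂ) ≠ 0 := by exact_mod_cast hn0.ne'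
  have hsum : ∑' k, D.synth m g (frolovPt d n k) =
      n * ((∏ i, ∫ t, D.dilate (m i) t) * ∫ y, g y) := by
    simp only [synth]
    rw [← integral_tsum]
    · simp only [tsum_mul_right, hpois]
      rw [integral_const_mul]
      ring
    · exact fun k => ((D.continuous_kernel_right m _).mul hg).aestronglyMeasurable
    · have hm : ∀ k, AEMeasurable (fun y => ‖D.kernel m (frolovPt d n k) y * g y‖ₑ) volume :=
        fun k => ((D.continuous_kernel_right m _).mul hg).enorm.measurable.aemeasurable
      rw [← lintegral_tsum hm]
      simp only [enorm_mul, ENNReal.tsum_mul_right]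
      refine ne_top_of_le_ne_top ?_ (lintegral_mono fun y => mul_le_mul_left (hCb m n hn y) _)
      rw [lintegral_const_mul _ hg.enorm.measurable]
      have := (lintegral_enorm_lt_top hg hgc).ne
      exact ENNReal.mul_ne_top (ENNReal.mul_ne_top hC (by finiteness)) this
  rw [blockError, D.integral_synth m hgi, hsum]
  field_simp
  simp

end DualKernel

/-! ### The error of Frolov's rule as a sum over the lattice -/

theorem frolovPt_injective {d : ℕ} (hd : 1 ≤ d) {n : ℕ} (hn : 1 ≤ n) :
    Function.Injective (frolovPt d n) := by
  obtain ⟨c, hc, hadm⟩ := exists_frolovMatrix_admissible hd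
  intro k l h
  by_contra hne
  have h' : latticePt (frolovMatrix d n) k = latticePt (frolovMatrix d n) l :=
    congrArg WithLp.ofLp h
  have h1 := (hadm n hn (k - l) (sub_ne_zero.2 hne)).1
  have h2 : latticePt (frolovMatrix d n) (k - l) = 0 := by rw [latticePt_sub, h', sub_self]
  have h3 : ∏ i, latticePt (frolovMatrix d n) (k - l) i = 0 :=
    Finset.prod_eq_zero (Finset.mem_univ ⟨0, hd⟩) (by rw [h2]; rfl)
  change c / n ≤ |∏ i, latticePt (frolovMatrix d n) (k - l) i| at h1
  rw [h3, abs_zero] at h1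
  have hn0 : (0 : ℝ) < n := by exact_mod_cast hn
  have : 0 < c / n := by positivity
  linarith

/-- A continuous function vanishing off the unit cube vanishes off its interior. -/
theorem eq_zero_of_notMem_Ioo {d : ℕ} {f : Pt d → ℂ} (hf : Continuous f)
    (hs : ∀ x, f x ≠ 0 → x ∈ unitCube d) {x : Pt d} {i : Fin d} (hx : x i ∉ Set.Ioo (0 : ℝ) 1) :
    f x = 0 := by
  by_contra hne
  have hx1 := hs x hne i
  have hopen : IsOpen {y | f y ≠ 0} := isOpen_ne_fun hf continuous_const
  have hcont : ∀ v : Pt d, Filter.Tendsto (fun t : ℝ => x + t • v) (nhds 0) (nhds x) := fun v => by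
    have : Continuous fun t : ℝ => x + t • v := by fun_prop
    simpa using this.tendsto 0
  have hev : ∀ v : Pt d, ∀ᶠ t in nhdsWithin (0 : ℝ) (Set.Ioi 0), x i + t * v i ∈ Set.Icc (0 : ℝ) 1 :=
    fun v => by
      have := (hcont v).eventually (hopen.mem_nhds hne)
      filter_upwards [this.filter_mono nhdsWithin_le_nhds] with t ht
      simpa using hs _ ht i
  have hone : (EuclideanSpace.single i (1 : ℝ) : Pt d) i = 1 := by simp
  rcases hx1.1.eq_or_lt with h0 | h0
  · obtain ⟨t, ht, ht'⟩ := ((hev (-EuclideanSpace.single i (1 : ℝ))).and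
      self_mem_nhdsWithin).exists
    simp only [PiLp.neg_apply, hone] at ht
    have := ht.1
    have h' : (0 : ℝ) < t := ht'
    linarith
  · rcases hx1.2.eq_or_lt with h1 | h1
    · obtain ⟨t, ht, ht'⟩ := ((hev (EuclideanSpace.single i (1 : ℝ))).and
        self_mem_nhdsWithin).exists
      simp only [hone] at ht
      have := ht.2
      have h' : (0 : ℝ) < t := ht'
      linarith
    · exact hx ⟨h0, h1⟩

theorem frolovRule_eq_tsum {d : ℕ} (hd : 1 ≤ d) {n : ℕ} (hn : 1 ≤ n) {f : Pt d → ℂ}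
    (hf : Continuous f) (hs : ∀ x, f x ≠ 0 → x ∈ unitCube d) :
    frolovRule d n f = (1 / (n : ℂ)) * ∑' k, f (frolovPt d n k) := by
  rw [frolovRule]
  congr 1
  have hzero : ∀ k, frolovPt d n k ∉ frolovNodes d n → f (frolovPt d n k) = 0 := fun k hk => by
    by_contra hne
    refine hk ⟨⟨k, rfl⟩, fun i => ?_⟩
    by_contra hi
    exact hne (eq_zero_of_notMem_Ioo hf hs (i := i) fun h => hi ⟨h.1.le, h.2⟩)
  have hinj := frolovPt_injective hd hn
  have hpre : frolovNodes d n = frolovPt d n '' (frolovPt d n ⁻¹' frolovNodes d n) := by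
    rw [Set.image_preimage_eq_of_subset]
    rintro x ⟨⟨k, rfl⟩, -⟩
    exact ⟨k, rfl⟩
  have hfin : (frolovPt d n ⁻¹' frolovNodes d n).Finite :=
    (frolovNodes_finite hd hn).preimage hinj.injOn
  rw [hpre, finsum_mem_image hinj.injOn, tsum_eq_finsum]
  · refine finsum_congr fun k => ?_
    by_cases h : frolovPt d n k ∈ frolovNodes d n
    · simp [h]
    · simp [h, hzero k h]
  · refine hfin.subset fun k hk => ?_
    by_contra h
    exact hk (hzero k h)

theorem setIntegral_unitCube {d : ℕ} {f : Pt d → ℂ} (hs : ∀ x, f x ≠ 0 → x ∈ unitCube d) :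
    ∫ x in unitCube d, f x = ∫ x, f x :=
  setIntegral_eq_integral_of_forall_compl_eq_zero fun x hx => by_contra fun h => hx (hs x h)

namespace DualKernel

variable {L : ℕ} {K : LocalMeanKernel L} (D : DualKernel K) {d : ℕ}

/-- The error of Frolov's rule is bounded by the sum of the errors on the dyadic blocks. -/
theorem enorm_error_le_tsum (hd : 1 ≤ d) {n : ℕ} (hn : 1 ≤ n) {r : ℝ}
    {g : (Fin d → ℕ) → Pt d → ℂ} (hg : ∀ m, Continuous (g m))
    (hr : ∀ m x, g m x ≠ 0 → x ∈ bigCube d r) (hsum : ∑' m, D.blockBound r m n (g m) ≠ ⊤)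
    {f : Pt d → ℂ} (hf : Continuous f) (hs : ∀ x, f x ≠ 0 → x ∈ unitCube d)
    (hfg : ∀ x, f x = ∑' m, D.synth m (g m) x) :
    ‖(∫ x in unitCube d, f x) - frolovRule d n f‖ₑ ≤ ∑' m, ‖D.blockError m n (g m)‖ₑ := by
  have hn0 : (n : ℝ≥0∞) ≠ 0 := by
    simp only [ne_eq, Nat.cast_eq_zero]; omega
  have hb : ∑' m, ((∑' k, ‖D.synth m (g m) (frolovPt d n k)‖ₑ) / n +
      ∫⁻ x, ‖D.synth m (g m) x‖ₑ) ≠ ⊤ :=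
    ne_top_of_le_ne_top hsum (ENNReal.tsum_le_tsum fun m =>
      D.tsum_enorm_synth_div_le m n (hg m) (hr m))
  rw [ENNReal.tsum_add, ENNReal.add_ne_top] at hb
  have hcont : ∀ m, Continuous (D.synth m (g m)) := fun m =>
    D.continuous_synth m (hg m) (hasCompactSupport_of_bigCube (hr m))
  have hint : HasSum (fun m => ∫ x, D.synth m (g m) x) (∫ x, f x) := by
    have h1 : ∫ x, f x = ∑' m, ∫ x, D.synth m (g m) x := by
      simp only [hfg]
      exact integral_tsum (fun m => (hcont m).aestronglyMeasurable) hb.2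
    rw [h1]
    refine Summable.hasSum (summable_of_tsum_enorm_ne_top (ne_top_of_le_ne_top hb.2
      (ENNReal.tsum_le_tsum fun m => enorm_integral_le_lintegral_enorm _)))
  have hdouble : ∑' m, ∑' k, ‖D.synth m (g m) (frolovPt d n k)‖ₑ ≠ ⊤ := by
    have := hb.1
    simp only [div_eq_mul_inv, ENNReal.tsum_mul_right] at this
    intro h
    rw [h, ENNReal.top_mul (ENNReal.inv_ne_zero.2 (ENNReal.natCast_ne_top n))] at this
    exact this rfl
  have hlat : HasSum (fun m => ∑' k, D.synth m (g m) (frolovPt d n k))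
      (∑' k, f (frolovPt d n k)) := by
    have hsm : Summable fun q : (Fin d → ℕ) × (Fin d → ℤ) =>
        D.synth q.1 (g q.1) (frolovPt d n q.2) := by
      refine summable_of_tsum_enorm_ne_top ?_
      rw [ENNReal.tsum_prod (f := fun m k => ‖D.synth m (g m) (frolovPt d n k)‖ₑ)]
      exact hdouble
    have h1 : ∑' k, f (frolovPt d n k) = ∑' m, ∑' k, D.synth m (g m) (frolovPt d n k) := by
      simp only [hfg]
      exact Summable.tsum_comm (f := fun m k => D.synth m (g m) (frolovPt d n k)) hsm
    rw [h1]
    exact hsm.prod.hasSum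
  have herr : HasSum (fun m => D.blockError m n (g m))
      ((∫ x in unitCube d, f x) - frolovRule d n f) := by
    rw [setIntegral_unitCube hs, frolovRule_eq_tsum hd hn hf hs]
    exact hint.sub (hlat.mul_left _)
  rw [← herr.tsum_eq]
  exact enorm_tsum_le_tsum_enorm

end DualKernel

/-! ### The error of Frolov's rule on functions given by a dyadic decomposition -/

theorem exists_tsum_high_rpow_le {d : ℕ} (hd : 1 ≤ d) {θ : ℝ≥0∞} (hθ : 1 ≤ θ) {s ι : ℝ}
    (hs : ι < s) :
    ∃ C : ℝ≥0∞, C ≠ ⊤ ∧ ∀ (M : ℕ) (b : (Fin d → ℕ) → ℝ≥0∞),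
      ∑' m : Fin d → ℕ, (if M ≤ ∑ i, m i then (2 ^ ∑ i, m i : ℝ≥0∞) ^ ι * b m else 0) ≤
      C * (ENNReal.ofReal (2 ^ (-(s - ι) * M) * ((M : ℝ) + 1) ^ logExponent d θ) *
        seqNorm θ fun m => weight s m * b m) := by
  obtain ⟨C, hC, h⟩ := exists_tsum_high_le hd hθ (sub_pos.2 hs)
  refine ⟨C, hC, fun M b => (le_of_eq ?_).trans (h M fun m => weight s m * b m)⟩
  refine tsum_congr fun m => ?_
  split_ifs with hm
  · rw [← mul_assoc, weight, ← ENNReal.rpow_add _ _ (by norm_num) (by norm_num),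
      ← ENNReal.rpow_natCast, ← ENNReal.rpow_mul]
    congr 2
    ring
  · rfl

theorem natLog_bounds (a : ℕ) {δ κ : ℝ} (hδ : 0 ≤ δ) (hκ : 0 ≤ κ) {n : ℕ} (hn : 2 ≤ n) :
    (2 : ℝ) ^ (-δ * ((Nat.log 2 n - a : ℕ) : ℝ)) * (((Nat.log 2 n - a : ℕ) : ℝ) + 1) ^ κ ≤
      (2 ^ (δ * (a + 1)) * (2 / Real.log 2) ^ κ) * ((n : ℝ) ^ (-δ) * Real.log n ^ κ) := by
  have hn0 : (0 : ℝ) < n := by positivity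
  have hl2 : 0 < Real.log 2 := Real.log_pos one_lt_two
  have h1 : n ≤ 2 ^ ((Nat.log 2 n - a) + a + 1) :=
    (Nat.lt_pow_succ_log_self one_lt_two n).le.trans (Nat.pow_le_pow_right two_pos (by omega))
  have h2 : (n : ℝ) ≤ 2 ^ ((((Nat.log 2 n - a : ℕ) : ℝ) + (a + 1))) := by
    have : (n : ℝ) ≤ 2 ^ ((Nat.log 2 n - a) + a + 1) := by exact_mod_cast h1
    refine this.trans (le_of_eq ?_)
    rw [← Real.rpow_natCast]
    push_cast
    ring_nf
  have h3 : (2 : ℝ) ^ (-δ * ((Nat.log 2 n - a : ℕ) : ℝ)) ≤ 2 ^ (δ * (a + 1)) * (n : ℝ) ^ (-δ) := by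
    have h4 := Real.rpow_le_rpow_of_nonpos hn0 h2 (neg_nonpos.2 hδ)
    rw [← Real.rpow_mul (by norm_num)] at h4
    calc (2 : ℝ) ^ (-δ * ((Nat.log 2 n - a : ℕ) : ℝ))
        = 2 ^ (δ * (a + 1)) * 2 ^ ((((Nat.log 2 n - a : ℕ) : ℝ) + (a + 1)) * -δ) := by
          rw [← Real.rpow_add (by norm_num)]
          ring_nf
      _ ≤ _ := by gcongr
  have h5 : ((Nat.log 2 n - a : ℕ) : ℝ) + 1 ≤ (2 / Real.log 2) * Real.log n := by
    have h6 : ((Nat.log 2 n - a : ℕ) : ℝ) ≤ Nat.log 2 n := by exact_mod_cast Nat.sub_le _ _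
    have h7 : ((2 ^ Nat.log 2 n : ℕ) : ℝ) ≤ n := by exact_mod_cast Nat.pow_log_le_self 2 (by omega)
    have h8 := Real.log_le_log (by positivity) h7
    push_cast at h8
    rw [Real.log_pow] at h8
    have h9 : Real.log 2 ≤ Real.log n := Real.log_le_log (by norm_num) (by exact_mod_cast hn)
    rw [div_mul_eq_mul_div, le_div_iff₀ hl2]
    nlinarith
  have hln : 0 ≤ Real.log n := Real.log_natCast_nonneg n
  calc _ ≤ (2 ^ (δ * (a + 1)) * (n : ℝ) ^ (-δ)) * ((2 / Real.log 2) * Real.log n) ^ κ := by gcongr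
    _ = _ := by
      rw [Real.mul_rpow (by positivity) hln]
      ring

namespace DualKernel

variable {L : ℕ} {K : LocalMeanKernel L} (D : DualKernel K) {d : ℕ}

theorem exists_tsum_enorm_synth_le (hd : 1 ≤ d) {p θ : ℝ≥0∞} (hp : 1 ≤ p) (hθ : 1 ≤ θ) {s : ℝ}
    (hs : (1 / p).toReal < s) : ∃ C : ℝ≥0∞, C ≠ ⊤ ∧ ∀ g : (Fin d → ℕ) → Pt d → ℂ,
      (∀ m, Continuous (g m)) → ∃ w : (Fin d → ℕ) → ℝ≥0∞,
        (∀ m x, ∫⁻ y, ‖D.kernel m x y‖ₑ * ‖g m y‖ₑ ≤ w m) ∧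
        ∑' m, w m ≤ C * seqNorm θ fun m => weight s m * eLpNorm (g m) p volume := by
  obtain ⟨C₁, hC₁, h₁⟩ := exists_tsum_high_rpow_le hd hθ hs
  obtain ⟨C₂, hC₂, h₂⟩ := D.exists_lintegral_kernel_mul_le (d := d) hp
  refine ⟨C₂ * C₁, ENNReal.mul_ne_top hC₂ hC₁, fun g hg => ⟨fun m =>
    C₂ * ((2 ^ ∑ i, m i : ℝ≥0∞) ^ (1 / p).toReal * eLpNorm (g m) p volume),
    fun m x => h₂ m x _ (hg m), ?_⟩⟩
  rw [ENNReal.tsum_mul_left, mul_assoc]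
  gcongr
  simpa using h₁ 0 fun m => eLpNorm (g m) p volume

theorem continuous_tsum_synth (hd : 1 ≤ d) {p θ : ℝ≥0∞} (hp : 1 ≤ p) (hθ : 1 ≤ θ) {s : ℝ}
    (hs : (1 / p).toReal < s) {g : (Fin d → ℕ) → Pt d → ℂ} (hg : ∀ m, Continuous (g m)) {r : ℝ}
    (hr : ∀ m x, g m x ≠ 0 → x ∈ bigCube d r)
    (hN : (seqNorm θ fun m => weight s m * eLpNorm (g m) p volume) ≠ ⊤) :
    Continuous fun x => ∑' m, D.synth m (g m) x := by
  obtain ⟨C, hC, h⟩ := D.exists_tsum_enorm_synth_le hd hp hθ hs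
  obtain ⟨w, hw, hsum⟩ := h g hg
  have hfin : ∑' m, w m ≠ ⊤ := ne_top_of_le_ne_top (ENNReal.mul_ne_top hC hN) hsum
  refine continuous_tsum (u := fun m => (w m).toReal)
    (fun m => D.continuous_synth m (hg m) (hasCompactSupport_of_bigCube (hr m)))
    (ENNReal.summable_toReal hfin) fun m x => ?_
  rw [← toReal_enorm]
  exact ENNReal.toReal_mono (ENNReal.ne_top_of_tsum_ne_top hfin m)
    ((D.enorm_synth_le m _ x).trans (hw m x))

theorem exists_enorm_tsum_synth_le (hd : 1 ≤ d) {p θ : ℝ≥0∞} (hp : 1 ≤ p) (hθ : 1 ≤ θ) {s : ℝ}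
    (hs : (1 / p).toReal < s) : ∃ C : ℝ≥0∞, C ≠ ⊤ ∧ ∀ g : (Fin d → ℕ) → Pt d → ℂ,
      (∀ m, Continuous (g m)) → ∀ x, ‖∑' m, D.synth m (g m) x‖ₑ ≤
        C * seqNorm θ fun m => weight s m * eLpNorm (g m) p volume := by
  obtain ⟨C, hC, h⟩ := D.exists_tsum_enorm_synth_le hd hp hθ hs
  refine ⟨C, hC, fun g hg x => ?_⟩
  obtain ⟨w, hw, hsum⟩ := h g hg
  exact enorm_tsum_le_tsum_enorm.trans ((ENNReal.tsum_le_tsum fun m =>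
    (D.enorm_synth_le m _ x).trans (hw m x)).trans hsum)

/-- The upper bound for the error of Frolov's rule. -/
theorem exists_enorm_error_le (hd : 1 ≤ d) {p θ : ℝ≥0∞} (hp : 1 ≤ p) (hθ : 1 ≤ θ) {s : ℝ}
    (hs : (1 / p).toReal < s) {r : ℝ} (hr0 : 0 ≤ r) : ∃ C : ℝ≥0∞, C ≠ ⊤ ∧ ∀ n : ℕ, 2 ≤ n →
      ∀ g : (Fin d → ℕ) → Pt d → ℂ, (∀ m, Continuous (g m)) →
      (∀ m x, g m x ≠ 0 → x ∈ bigCube d r) →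
      (seqNorm θ fun m => weight s m * eLpNorm (g m) p volume) ≠ ⊤ →
      ∀ f : Pt d → ℂ, Continuous f → (∀ x, f x ≠ 0 → x ∈ unitCube d) →
      (∀ x, f x = ∑' m, D.synth m (g m) x) →
      ‖(∫ x in unitCube d, f x) - frolovRule d n f‖ₑ ≤
        C * (seqNorm θ fun m => weight s m * eLpNorm (g m) p volume) * rate d s θ n := by
  set ι := (1 / p).toReal with hι
  have hι0 : 0 ≤ ι := by positivity
  have hκ0 : 0 ≤ logExponent d θ := logExponent_nonneg hd hθ
  obtain ⟨C₁, hC₁, h₁⟩ := exists_tsum_high_rpow_le hd hθ hs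
  obtain ⟨C₂, hC₂, h₂⟩ := D.exists_blockBound_le hd hr0 hp
  obtain ⟨a, ha⟩ := D.exists_blockError_eq_zero hd
  refine ⟨C₂ * (2 ^ a + 1 : ℝ≥0∞) ^ ι * C₁ *
    ENNReal.ofReal (2 ^ ((s - ι) * (a + 1)) * (2 / Real.log 2) ^ logExponent d θ), ?_,
    fun n hn g hg hgr hN f hf hfs hfg => ?_⟩
  · have : (2 ^ a + 1 : ℝ≥0∞) ^ ι ≠ ⊤ := ENNReal.rpow_ne_top_of_nonneg hι0 (by finiteness)
    finiteness
  have hn1 : 1 ≤ n := by omega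
  have hn0 : (n : ℝ≥0∞) ≠ 0 := by
    simp only [ne_eq, Nat.cast_eq_zero]; omega
  have hnt : (n : ℝ≥0∞) ≠ ⊤ := ENNReal.natCast_ne_top n
  have hnr : (0 : ℝ) < n := by positivity
  have hn1' : (1 : ℝ≥0∞) ≤ n := by exact_mod_cast hn1
  have hfin : ∑' m, D.blockBound r m n (g m) ≠ ⊤ := by
    have h3 : ∀ m, D.blockBound r m n (g m) ≤
        C₂ * (2 ^ ι * ((2 ^ ∑ i, m i : ℝ≥0∞) ^ ι * eLpNorm (g m) p volume)) := fun m => by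
      refine (h₂ m n hn1 _ (hg m)).trans ?_
      rw [← mul_assoc (2 ^ ι), ← ENNReal.mul_rpow_of_nonneg _ _ hι0]
      gcongr
      rw [two_mul]
      gcongr
      · exact one_le_pow₀ (by norm_num)
      · exact ENNReal.div_le_of_le_mul (le_mul_of_one_le_right' hn1')
    refine ne_top_of_le_ne_top ?_ (ENNReal.tsum_le_tsum h3)
    rw [ENNReal.tsum_mul_left, ENNReal.tsum_mul_left]
    have h4 := h₁ 0 fun m => eLpNorm (g m) p volume
    simp only [Nat.zero_le, if_true] at h4
    have h5 := ne_top_of_le_ne_top (ENNReal.mul_ne_top hC₁ (ENNReal.mul_ne_top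
      ENNReal.ofReal_ne_top hN)) h4
    exact ENNReal.mul_ne_top hC₂ (ENNReal.mul_ne_top
      (ENNReal.rpow_ne_top_of_nonneg hι0 (by norm_num)) h5)
  refine (D.enorm_error_le_tsum hd hn1 hg hgr hfin hf hfs hfg).trans ?_
  set M := Nat.log 2 n - a with hM
  have hterm : ∀ m, ‖D.blockError m n (g m)‖ₑ ≤ C₂ * (2 ^ a + 1) ^ ι * ((n : ℝ≥0∞)⁻¹) ^ ι *
      if M ≤ ∑ i, m i then (2 ^ ∑ i, m i : ℝ≥0∞) ^ ι * eLpNorm (g m) p volume else 0 := fun m => by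
    by_cases hmn : 2 ^ (∑ i, m i + a) ≤ n
    · rw [ha m n hn1 hmn _ (hg m) (hasCompactSupport_of_bigCube (hgr m))]
      simp
    · push Not at hmn
      have hmM : M ≤ ∑ i, m i := by
        have := Nat.log_lt_of_lt_pow (by omega) hmn
        omega
      rw [if_pos hmM]
      refine ((D.enorm_blockError_le m n (hg m) (hgr m)).trans (h₂ m n hn1 _ (hg m))).trans ?_
      have hle : (1 + 2 ^ (∑ i, m i) / n : ℝ≥0∞) ≤
          (2 ^ a + 1) * ((n : ℝ≥0∞)⁻¹ * 2 ^ ∑ i, m i) := by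
        rw [add_mul, one_mul, mul_comm (n : ℝ≥0∞)⁻¹, ← div_eq_mul_inv, ← mul_div_assoc, ← pow_add]
        gcongr
        rw [ENNReal.le_div_iff_mul_le (.inl hn0) (.inl hnt), one_mul, add_comm]
        exact_mod_cast hmn.le
      calc _ ≤ C₂ * (((2 ^ a + 1) * ((n : ℝ≥0∞)⁻¹ * 2 ^ ∑ i, m i)) ^ ι *
            eLpNorm (g m) p volume) := by gcongr
        _ = _ := by
          rw [ENNReal.mul_rpow_of_nonneg _ _ hι0, ENNReal.mul_rpow_of_nonneg _ _ hι0]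
          ring
  refine (ENNReal.tsum_le_tsum hterm).trans ?_
  rw [ENNReal.tsum_mul_left]
  have hbound := natLog_bounds a (sub_pos.2 hs).le hκ0 hn
  calc _ ≤ C₂ * (2 ^ a + 1) ^ ι * ((n : ℝ≥0∞)⁻¹) ^ ι * (C₁ * (ENNReal.ofReal
        ((2 ^ ((s - ι) * (a + 1)) * (2 / Real.log 2) ^ logExponent d θ) *
          ((n : ℝ) ^ (-(s - ι)) * Real.log n ^ logExponent d θ)) *
            seqNorm θ fun m => weight s m * eLpNorm (g m) p volume)) := by
        gcongr
        refine (h₁ M _).trans ?_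
        gcongr
    _ = _ := by
        have hl : 0 ≤ Real.log n := Real.log_natCast_nonneg n
        have hl2 : 0 < Real.log 2 := Real.log_pos one_lt_two
        have hr1 : ((n : ℝ≥0∞)⁻¹) ^ ι = ENNReal.ofReal ((n : ℝ) ^ (-ι)) := by
          rw [ENNReal.inv_rpow, ← ENNReal.ofReal_natCast, ENNReal.ofReal_rpow_of_pos hnr,
            ← ENNReal.ofReal_inv_of_pos (by positivity), Real.rpow_neg hnr.le]
        have hr2 : rate d s θ n = ENNReal.ofReal ((n : ℝ) ^ (-ι)) *
            ENNReal.ofReal ((n : ℝ) ^ (-(s - ι)) * Real.log n ^ logExponent d θ) := by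
          rw [← ENNReal.ofReal_mul (by positivity), ← mul_assoc, ← Real.rpow_add hnr, rate,
            logExponent]
          ring_nf
        rw [hr1, hr2, ENNReal.ofReal_mul (by positivity)]
        ring

end DualKernel

/-! ### Tempered distributions and convolution integrals -/

/-- A linear form that is dominated by `‖J ·‖` factors through `J`. -/
theorem exists_factor_of_norm_le {E X : Type*} [AddCommGroup E] [Module ℂ E]
    [NormedAddCommGroup X] [NormedSpace ℂ X] (J : E →ₗ[ℂ] X) (u : E →ₗ[ℂ] ℂ) {C : ℝ}
    (h : ∀ e, ‖u e‖ ≤ C * ‖J e‖) : ∃ F : X →L[ℂ] ℂ, ∀ e, u e = F (J e) := by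
  obtain ⟨σ, hσ⟩ := J.rangeRestrict.exists_rightInverse_of_surjective J.range_rangeRestrict
  have hσ' : ∀ x : LinearMap.range J, J (σ x) = x := fun x =>
    congrArg Subtype.val (LinearMap.congr_fun hσ x)
  let F₀ : LinearMap.range J →L[ℂ] ℂ := (u ∘ₗ σ).mkContinuous C fun x => by
    simpa [hσ'] using h (σ x)
  obtain ⟨F, hF, -⟩ := exists_extension_norm_eq (LinearMap.range J) F₀
  refine ⟨F, fun e => ?_⟩
  have h1 := hF (J.rangeRestrict e)
  change F (J e) = _ at h1
  rw [h1]
  change u e = u (σ (J.rangeRestrict e))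
  rw [← sub_eq_zero, ← map_sub, ← norm_le_zero_iff]
  refine (h _).trans (le_of_eq ?_)
  rw [map_sub, hσ', LinearMap.codRestrict_apply, sub_self, norm_zero, mul_zero]

instance compactSpace_bigCube (d : ℕ) (r : ℝ) : CompactSpace (bigCube d r) :=
  isCompact_iff_compactSpace.1 (isCompact_bigCube d r)

/-- The space of families of continuous multilinear maps of orders `0, …, N` on a cube. -/
def JetSpace (d : ℕ) (r : ℝ) (N : ℕ) : Type :=
  ∀ l : Fin (N + 1), C(bigCube d r, Pt d [×(l : ℕ)]→L[ℝ] ℂ)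

section JetSpace

variable (d : ℕ) (r : ℝ) (l : ℕ)

instance normedAddCommGroupJet : NormedAddCommGroup C(bigCube d r, Pt d [×l]→L[ℝ] ℂ) :=
  ContinuousMap.instNormedAddCommGroup

instance normedSpaceJet : NormedSpace ℂ C(bigCube d r, Pt d [×l]→L[ℝ] ℂ) :=
  ContinuousMap.normedSpace

instance completeSpaceJet : CompleteSpace C(bigCube d r, Pt d [×l]→L[ℝ] ℂ) := inferInstance

instance (N : ℕ) : NormedAddCommGroup (JetSpace d r N) :=
  Pi.normedAddCommGroup (G := fun l : Fin (N + 1) => C(bigCube d r, Pt d [×(l : ℕ)]→L[ℝ] ℂ))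

instance (N : ℕ) : NormedSpace ℂ (JetSpace d r N) :=
  Pi.normedSpace (E := fun l : Fin (N + 1) => C(bigCube d r, Pt d [×(l : ℕ)]→L[ℝ] ℂ))

end JetSpace

/-- The derivatives up to order `N` of a Schwartz function, restricted to a cube. -/
def jet (d : ℕ) (r : ℝ) (N : ℕ) : 𝓢(Pt d, ℂ) →ₗ[ℂ] JetSpace d r N where
  toFun φ l := ⟨fun z => iteratedFDeriv ℝ l φ z,
    ((φ.smooth ⊤).continuous_iteratedFDeriv (by exact_mod_cast le_top)).comp
      continuous_subtype_val⟩
  map_add' φ ψ := by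
    refine funext fun l => ContinuousMap.ext fun z => ?_
    exact iteratedFDeriv_add_apply ((φ.smooth _).contDiffAt) ((ψ.smooth _).contDiffAt)
  map_smul' c φ := by
    refine funext fun l => ContinuousMap.ext fun z => ?_
    exact iteratedFDeriv_const_smul_apply ((φ.smooth _).contDiffAt)

theorem jet_apply {d : ℕ} {r : ℝ} {N : ℕ} (φ : 𝓢(Pt d, ℂ)) (l : Fin (N + 1)) (z : bigCube d r) :
    jet d r N φ l z = iteratedFDeriv ℝ l φ z := rfl

/-- The Schwartz functions supported in a cube. -/
def schwartzOn (d : ℕ) (r : ℝ) : Submodule ℂ 𝓢(Pt d, ℂ) where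
  carrier := {φ | ∀ z, φ z ≠ 0 → z ∈ bigCube d r}
  zero_mem' z hz := absurd rfl hz
  add_mem' {φ ψ} hφ hψ z hz := by
    by_contra h
    have h1 : φ z = 0 := by_contra fun h' => h (hφ z h')
    have h2 : ψ z = 0 := by_contra fun h' => h (hψ z h')
    exact hz (by simp [h1, h2])
  smul_mem' c φ hφ z hz := hφ z fun h => hz (by simp [h])

theorem exists_seminorm_le_jet (d : ℕ) (r : ℝ) {N k l : ℕ} (hl : l ≤ N) : ∃ C : ℝ, 0 ≤ C ∧
    ∀ φ ∈ schwartzOn d r, SchwartzMap.seminorm ℂ k l φ ≤ C * ‖jet d r N φ‖ := by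
  obtain ⟨R, hR⟩ := (isCompact_bigCube d r).isBounded.exists_norm_le
  refine ⟨|R| ^ k, by positivity, fun φ hφ => SchwartzMap.seminorm_le_bound ℂ k l φ (by positivity)
    fun x => ?_⟩
  have hts : tsupport φ ⊆ bigCube d r :=
    closure_minimal (fun z hz => hφ z hz) (isClosed_bigCube d r)
  by_cases hx : x ∈ bigCube d r
  · have h1 : ‖x‖ ≤ |R| := (hR x hx).trans (le_abs_self R)
    have h2 : ‖iteratedFDeriv ℝ l φ x‖ ≤ ‖jet d r N φ‖ := by
      have h3 := norm_le_pi_norm (jet d r N φ) ⟨l, by omega⟩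
      exact ((jet d r N φ ⟨l, by omega⟩).norm_coe_le_norm ⟨x, hx⟩).trans h3
    gcongr
  · have h1 : iteratedFDeriv ℝ l φ x = 0 := by
      by_contra h
      exact hx (hts (support_iteratedFDeriv_subset l h))
    rw [h1, norm_zero, mul_zero]
    positivity

/-- Locally, a tempered distribution is a continuous functional of finitely many derivatives. -/
theorem exists_eq_jet {d : ℕ} (u : 𝓢'(Pt d, ℂ)) (r : ℝ) : ∃ (N : ℕ)
    (F : JetSpace d r N →L[ℂ] ℂ),
      ∀ φ ∈ schwartzOn d r, u φ = F (jet d r N φ) := by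
  let u' : 𝓢(Pt d, ℂ) →L[ℂ] ℂ := u
  obtain ⟨S, C, -, hC⟩ := Seminorm.bound_of_continuous (schwartz_withSeminorms ℂ (Pt d) ℂ)
    ((normSeminorm ℂ ℂ).comp u'.toLinearMap) (continuous_norm.comp u'.continuous)
  refine ⟨S.sup Prod.snd, ?_⟩
  have hb : ∀ q ∈ S, ∃ B : ℝ, 0 ≤ B ∧ ∀ φ ∈ schwartzOn d r,
      SchwartzMap.seminorm ℂ q.1 q.2 φ ≤ B * ‖jet d r (S.sup Prod.snd) φ‖ := fun q hq =>
    exists_seminorm_le_jet d r (Finset.le_sup (f := Prod.snd) hq)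
  choose! B hB0 hB using hb
  obtain ⟨F, hF⟩ := exists_factor_of_norm_le ((jet d r (S.sup Prod.snd)).comp
    (schwartzOn d r).subtype) (u'.toLinearMap.comp (schwartzOn d r).subtype)
    (C := C * ∑ q ∈ S, B q) fun e => by
      have h1 : ‖u' e‖ ≤ C * (S.sup (schwartzSeminormFamily ℂ (Pt d) ℂ)) (e : 𝓢(Pt d, ℂ)) := hC e
      refine h1.trans ?_
      rw [mul_assoc]
      refine mul_le_mul_of_nonneg_left ?_ C.2
      refine Seminorm.finset_sup_apply_le (mul_nonneg (Finset.sum_nonneg hB0) (norm_nonneg _))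
        fun q hq => (hB q hq e e.2).trans ?_
      exact mul_le_mul_of_nonneg_right (Finset.single_le_sum hB0 hq) (norm_nonneg _)
  exact ⟨F, fun φ hφ => hF ⟨φ, hφ⟩⟩

open Convolution in
theorem iteratedFDeriv_convolution {d : ℕ} {w φ : Pt d → ℂ} (hw : LocallyIntegrable w)
    (hφ : ContDiff ℝ ∞ φ) (hc : HasCompactSupport φ) (l : ℕ) :
    iteratedFDeriv ℝ l (fun z => ∫ y, w y * φ (z - y)) =
      fun z => ∫ y, w y • iteratedFDeriv ℝ l φ (z - y) := by
  induction l with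
  | zero =>
    ext1 z
    simp only [iteratedFDeriv_zero_eq_comp, Function.comp_apply]
    refine ((continuousMultilinearCurryFin0 ℝ (Pt d)
      ℂ).symm.toContinuousLinearEquiv.integral_comp_comm _).symm.trans ?_
    refine integral_congr_ae (Filter.Eventually.of_forall fun y => ?_)
    ext v
    simp
  | succ l ih =>
    ext1 z
    rw [iteratedFDeriv_succ_eq_comp_left, Function.comp_apply, ih]
    have hcl : HasCompactSupport (iteratedFDeriv ℝ l φ) := hc.iteratedFDeriv l
    have hsm : ContDiff ℝ 1 (iteratedFDeriv ℝ l φ) :=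
      hφ.iteratedFDeriv_right (by exact_mod_cast le_top)
    have h1 := (hcl.hasFDerivAt_convolution_right
      (ContinuousLinearMap.lsmul ℝ ℂ (E := Pt d [×l]→L[ℝ] ℂ)) hw hsm z).fderiv
    have h2 : (fun z => ∫ y, w y • iteratedFDeriv ℝ l φ (z - y)) =
        (w ⋆[ContinuousLinearMap.lsmul ℝ ℂ (E := Pt d [×l]→L[ℝ] ℂ)] iteratedFDeriv ℝ l φ) := rfl
    rw [h2, h1]
    simp only [convolution]
    refine (ContinuousLinearEquiv.integral_comp_comm (X := Pt d) (μ := volume) (𝕜 := ℝ) (E := Pt d →L[ℝ] Pt d [×l]→L[ℝ] ℂ)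
      (F := Pt d [×(l + 1)]→L[ℝ] ℂ) (continuousMultilinearCurryLeftEquiv ℝ
        (fun _ : Fin (l + 1) => Pt d) ℂ).symm.toContinuousLinearEquiv _).symm.trans ?_
    refine integral_congr_ae (Filter.Eventually.of_forall fun y => ?_)
    ext v
    simp [iteratedFDeriv_succ_eq_comp_left, ContinuousLinearMap.precompR_apply]
    rfl

theorem exists_support_subset_bigCube {d : ℕ} {E : Type*} [Zero E] {φ : Pt d → E}
    (hc : HasCompactSupport φ) : ∃ a : ℝ, 0 ≤ a ∧ ∀ z, φ z ≠ 0 → z ∈ bigCube d a := by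
  obtain ⟨R, hR⟩ := hc.isCompact.isBounded.exists_norm_le
  refine ⟨|R|, abs_nonneg R, fun z hz i => ?_⟩
  exact ((PiLp.norm_apply_le z i).trans (hR z (subset_tsupport _ hz))).trans (le_abs_self R)

section Translates

variable {d : ℕ} {φ : 𝓢(Pt d, ℂ)}

theorem translate_mem_schwartzOn {a b : ℝ} (ha : ∀ z, φ z ≠ 0 → z ∈ bigCube d a) {y : Pt d}
    (hy : y ∈ bigCube d b) : φ.compSubConstCLM ℂ y ∈ schwartzOn d (a + b) := fun z hz i => by
  have h1 := ha (z - y) hz i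
  have h2 := abs_add_le (z i - y i) (y i)
  rw [sub_add_cancel] at h2
  have h3 := hy i
  rw [PiLp.sub_apply] at h1
  linarith

theorem jet_translate_apply {r : ℝ} {N : ℕ} (y : Pt d) (l : Fin (N + 1)) (z : bigCube d r) :
    jet d r N (φ.compSubConstCLM ℂ y) l z = iteratedFDeriv ℝ l φ (z - y) := by
  rw [jet_apply]
  exact iteratedFDeriv_comp_sub l y z

theorem continuous_jet_translate (r : ℝ) (N : ℕ) :
    Continuous fun y => jet d r N (φ.compSubConstCLM ℂ y) := by
  refine continuous_pi fun l => ?_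
  refine ContinuousMap.continuous_of_continuous_uncurry _ ?_
  have h : Continuous (iteratedFDeriv ℝ (l : ℕ) φ) :=
    (φ.smooth ⊤).continuous_iteratedFDeriv (by exact_mod_cast le_top)
  have h2 : Continuous fun q : Pt d × bigCube d r => iteratedFDeriv ℝ (l : ℕ) φ (q.2 - q.1) :=
    h.comp (by fun_prop)
  refine h2.congr fun q => ?_
  exact (jet_translate_apply (N := N) q.1 l q.2).symm

theorem continuous_apply_translate (u : 𝓢'(Pt d, ℂ)) (hφ : HasCompactSupport φ) :
    Continuous fun y => u (φ.compSubConstCLM ℂ y) := by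
  obtain ⟨a, ha0, ha⟩ := exists_support_subset_bigCube hφ
  refine continuous_iff_continuousAt.2 fun y₀ => ?_
  obtain ⟨N, F, hF⟩ := exists_eq_jet u (a + (‖y₀‖ + 1))
  refine (F.continuous.comp (continuous_jet_translate (φ := φ) _ N)).continuousAt.congr ?_
  filter_upwards [Metric.ball_mem_nhds y₀ one_pos] with y hy
  refine (hF _ (translate_mem_schwartzOn ha fun i => ?_)).symm
  refine (PiLp.norm_apply_le y i).trans ?_
  have := norm_add_le (y - y₀) y₀
  rw [sub_add_cancel] at this
  rw [Metric.mem_ball, dist_eq_norm] at hy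
  linarith

instance completeSpaceJetSpace (r : ℝ) (N : ℕ) : CompleteSpace (JetSpace d r N) :=
  inferInstanceAs (CompleteSpace (∀ l : Fin (N + 1), C(bigCube d r, Pt d [×(l : ℕ)]→L[ℝ] ℂ)))

/-- A tempered distribution commutes with convolution integrals. -/
theorem apply_eq_integral_translate (u : 𝓢'(Pt d, ℂ)) (hφ : HasCompactSupport φ) {w : Pt d → ℂ}
    (hw : Continuous w) (hwc : HasCompactSupport w) {ψ : 𝓢(Pt d, ℂ)}
    (hψ : ∀ z, ψ z = ∫ y, w y * φ (z - y)) :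
    u ψ = ∫ y, w y * u (φ.compSubConstCLM ℂ y) := by
  obtain ⟨a, ha0, ha⟩ := exists_support_subset_bigCube hφ
  obtain ⟨b, hb0, hb⟩ := exists_support_subset_bigCube hwc
  obtain ⟨N, F, hF⟩ := exists_eq_jet u (a + b)
  have hψs : ψ ∈ schwartzOn d (a + b) := fun z hz i => by
    rw [hψ] at hz
    obtain ⟨y, hy⟩ : ∃ y, w y * φ (z - y) ≠ 0 := by
      by_contra! h
      exact hz (by simp [h])
    exact translate_mem_schwartzOn ha (hb y (left_ne_zero_of_mul hy)) z (right_ne_zero_of_mul hy) i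
  set H : Pt d → JetSpace d (a + b) N := fun y => w y • jet d (a + b) N (φ.compSubConstCLM ℂ y)
  have hHc : Continuous H := hw.smul (continuous_jet_translate _ _)
  have hHi : Integrable H := hHc.integrable_of_hasCompactSupport hwc.smul_right
  have hjet : jet d (a + b) N ψ = ∫ y, H y := by
    refine funext fun l => ContinuousMap.ext fun z => ?_
    let ev : JetSpace d (a + b) N →L[ℂ] Pt d [×(l : ℕ)]→L[ℝ] ℂ :=
      (ContinuousMap.evalCLM ℂ z).comp (ContinuousLinearMap.proj (R := ℂ)
        (φ := fun l : Fin (N + 1) => C(bigCube d (a + b), Pt d [×(l : ℕ)]→L[ℝ] ℂ)) l)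
    change _ = ev (∫ y, H y)
    rw [← ev.integral_comp_comm hHi, jet_apply, show (ψ : Pt d → ℂ) = _ from funext hψ,
      iteratedFDeriv_convolution hw.locallyIntegrable (φ.smooth ⊤) hφ]
    refine integral_congr_ae (Filter.Eventually.of_forall fun y => ?_)
    change _ = w y • jet d (a + b) N (φ.compSubConstCLM ℂ y) l z
    rw [jet_translate_apply]
  rw [hF ψ hψs, hjet, ← F.integral_comp_comm hHi]
  refine integral_congr_ae (Filter.Eventually.of_forall fun y => ?_)
  simp only [H, map_smul, smul_eq_mul]
  by_cases hy : w y = 0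
  · simp [hy]
  · rw [hF _ (translate_mem_schwartzOn ha (hb y hy))]

end Translates

/-! ### Representation of distributions supported in the cube by their local means -/

open scoped Manifold in
/-- A tempered distribution vanishes on test functions supported off its support. -/
theorem apply_eq_zero_of_disjoint_dsupport {d : ℕ} (u : 𝓢'(Pt d, ℂ)) {φ : 𝓢(Pt d, ℂ)}
    (hφ : HasCompactSupport φ) (hd : Disjoint (tsupport φ) (Distribution.dsupport u)) :
    u φ = 0 := by
  have h1 : ∀ x ∈ tsupport φ, ∃ U, Distribution.IsVanishingOn u U ∧ IsOpen U ∧ x ∈ U :=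
    fun x hx => (Distribution.notMem_dsupport_iff x).1 fun h => Set.disjoint_left.1 hd hx h
  choose! U hvan hopen hmem using h1
  obtain ⟨t, ht⟩ := hφ.isCompact.elim_nhds_subcover' (fun x _ => U x)
    fun x hx => (hopen x hx).mem_nhds (hmem x hx)
  obtain ⟨ρ, hρ⟩ := SmoothPartitionOfUnity.exists_isSubordinate 𝓘(ℝ, Pt d) (ι := t)
    (isClosed_tsupport φ) (fun x => U x.1) (fun x => hopen _ x.1.2) (by
      refine ht.trans (Set.iUnion₂_subset fun x hx => ?_)
      exact Set.subset_iUnion (fun x : t => U x.1) ⟨x, hx⟩)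
  have hsm : ∀ i, ContDiff ℝ ∞ fun z => (ρ i z : ℂ) * φ z := fun i =>
    (Complex.ofRealCLM.contDiff.comp (ρ i).contMDiff.contDiff).mul (φ.smooth ⊤)
  have hcs : ∀ i, HasCompactSupport fun z => (ρ i z : ℂ) * φ z := fun i => hφ.mul_left
  have hsum : φ = ∑ i, (hcs i).toSchwartzMap (hsm i) := by
    ext z
    rw [sum_apply]
    change φ z = ∑ i, (ρ i z : ℂ) * φ z
    by_cases hz : φ z = 0
    · simp [hz]
    · have h := ρ.sum_eq_one (subset_tsupport _ hz)
      rw [finsum_eq_sum_of_fintype] at h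
      rw [← Finset.sum_mul, ← Complex.ofReal_sum, h, Complex.ofReal_one, one_mul]
  rw [hsum, map_sum]
  refine Finset.sum_eq_zero fun i _ => hvan _ i.1.2 _ ?_
  refine (closure_mono ?_).trans (hρ i)
  intro z hz
  have : (ρ i z : ℂ) * φ z ≠ 0 := hz
  exact fun h => this (by simp [h])

theorem apply_eq_zero_of_notMem_unitCube {d : ℕ} {u : 𝓢'(Pt d, ℂ)}
    (hu : Distribution.dsupport u ⊆ unitCube d) {φ : 𝓢(Pt d, ℂ)} {a : ℝ} {x : Pt d}
    (hφ : HasCompactSupport φ) (ha : ∀ z, φ z ≠ 0 → ∀ i, |x i - z i| ≤ a)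
    (hx : x ∉ bigCube d (1 + a)) : u φ = 0 := by
  refine apply_eq_zero_of_disjoint_dsupport u hφ (Set.disjoint_left.2 fun z hz hzu => hx fun i => ?_)
  have hcl : IsClosed {z : Pt d | ∀ i, |x i - z i| ≤ a} := by
    simp only [Set.ofPred_forall]
    exact isClosed_iInter fun i => isClosed_le (by fun_prop) continuous_const
  have h1 : |x i - z i| ≤ a := closure_minimal (fun z hz => ha z hz) hcl hz i
  have h2 := unitCube_subset_bigCube d (hu hzu) i
  have h3 := abs_add_le (x i - z i) (z i)
  rw [sub_add_cancel] at h3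
  linarith

namespace LocalMeanKernel

variable {L : ℕ} (K : LocalMeanKernel L) {d : ℕ}

theorem reflectedSchwartz_eq_translate (m : Fin d → ℕ) (x : Pt d) :
    K.reflectedSchwartz m x = (K.reflectedSchwartz m 0).compSubConstCLM ℂ x := by
  ext y
  change ∏ i, K.dilate (m i) (x i - y i) = ∏ i, K.dilate (m i) ((0 : Pt d) i - (y - x) i)
  simp

theorem hasCompactSupport_reflectedSchwartz (m : Fin d → ℕ) (x : Pt d) :
    HasCompactSupport (K.reflectedSchwartz m x) := K.hasCompactSupport_reflected m x

theorem continuous_localMean (u : 𝓢'(Pt d, ℂ)) (m : Fin d → ℕ) : Continuous (K.localMean u m) := by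
  have h := continuous_apply_translate u (K.hasCompactSupport_reflectedSchwartz m 0)
  simp only [← K.reflectedSchwartz_eq_translate] at h
  exact h

theorem localMean_ne_zero {u : 𝓢'(Pt d, ℂ)} (hu : Distribution.dsupport u ⊆ unitCube d)
    (m : Fin d → ℕ) (x : Pt d) (hx : K.localMean u m x ≠ 0) : x ∈ bigCube d (1 + K.radius) := by
  by_contra h
  exact hx (apply_eq_zero_of_notMem_unitCube hu (K.hasCompactSupport_reflectedSchwartz m x)
    (fun z hz => K.reflected_ne_zero hz) h)

theorem localMean_eq_mean {u : 𝓢'(Pt d, ℂ)} {f : Pt d → ℂ} (hf : IsContinuousRep u f)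
    (m : Fin d → ℕ) : K.localMean u m = K.mean m f := by
  ext x
  refine (hf.2 _ (K.hasCompactSupport_reflectedSchwartz m x)).trans ?_
  exact integral_congr_ae (Filter.Eventually.of_forall fun y => mul_comm _ _)

/-- The local means of `x ↦ u(φ(· - x))` in terms of the local means of `u`. -/
theorem mean_translate (u : 𝓢'(Pt d, ℂ)) {φ : 𝓢(Pt d, ℂ)} (hφ : HasCompactSupport φ)
    (m : Fin d → ℕ) (x : Pt d) :
    K.mean m (fun y => u (φ.compSubConstCLM ℂ y)) x = ∫ t, φ t * K.localMean u m (x + t) := by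
  have hρ := K.hasCompactSupport_reflectedSchwartz (d := d) m 0
  have hr : Continuous (K.reflected m x) := (K.contDiff_reflected m x).continuous
  have hloc : LocallyIntegrable (K.reflected m x) := hr.locallyIntegrable
  have hsm : ContDiff ℝ ∞ fun z => ∫ y, K.reflected m x y * φ (z - y) :=
    hφ.contDiff_convolution_right (ContinuousLinearMap.mul ℝ ℂ) hloc (φ.smooth ⊤)
  have hcs : HasCompactSupport fun z => ∫ y, K.reflected m x y * φ (z - y) :=
    HasCompactSupport.convolution (ContinuousLinearMap.mul ℝ ℂ) (K.hasCompactSupport_reflected m x) hφ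
  have h1 := apply_eq_integral_translate u hφ hr (K.hasCompactSupport_reflected m x)
    (ψ := hcs.toSchwartzMap hsm) fun z => rfl
  have hφx : HasCompactSupport fun y => φ (y - x) :=
    hφ.comp_homeomorph (Homeomorph.subRight x)
  have h2 := apply_eq_integral_translate u hρ (w := fun y => φ (y - x))
    (φ.continuous.comp (by fun_prop)) hφx (ψ := hcs.toSchwartzMap hsm) fun z => by
      change ∫ y, K.reflected m x y * φ (z - y) = ∫ y, φ (y - x) * K.reflected m 0 (z - y)
      rw [← integral_sub_left_eq_self _ volume (z + x)]
      refine integral_congr_ae (Filter.Eventually.of_forall fun y => ?_)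
      simp only [reflected, PiLp.sub_apply, PiLp.add_apply, PiLp.zero_apply]
      rw [mul_comm]
      congr 2
      · abel
      · ext i
        ring_nf
  refine h1.symm.trans (h2.trans ?_)
  rw [← integral_add_left_eq_self _ x]
  simp only [add_sub_cancel_left, ← K.reflectedSchwartz_eq_translate]
  rfl

end LocalMeanKernel

namespace DualKernel

variable {L : ℕ} {K : LocalMeanKernel L} (D : DualKernel K) {d : ℕ}

theorem synth_integral_translate (m : Fin d → ℕ) {φ g : Pt d → ℂ} (hφ : Continuous φ)
    (hφc : HasCompactSupport φ) (hg : Continuous g) (hgc : HasCompactSupport g) :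
    D.synth m (fun y => ∫ t, φ t * g (y + t)) 0 = ∫ t, D.synth m g t * φ t := by
  obtain ⟨a, -, ha⟩ := exists_support_subset_bigCube hφc
  obtain ⟨b, -, hb⟩ := exists_support_subset_bigCube hgc
  simp only [synth, ← integral_const_mul]
  rw [integral_integral_swap_of_hasCompactSupport]
  · refine integral_congr_ae (Filter.Eventually.of_forall fun t => ?_)
    simp only
    rw [← integral_sub_right_eq_self _ t, ← integral_mul_const]
    refine integral_congr_ae (Filter.Eventually.of_forall fun y => ?_)
    simp only [sub_add_cancel, kernel_eq_profile, zero_sub, neg_sub]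
    ring
  · have h1 := (D.continuous_kernel_right m (0 : Pt d)).comp (continuous_fst (X := Pt d) (Y := Pt d))
    have h2 : Continuous fun q : Pt d × Pt d => g (q.1 + q.2) := hg.comp (by fun_prop)
    exact h1.mul ((hφ.comp continuous_snd).mul h2)
  · refine HasCompactSupport.intro ((isCompact_bigCube d (b + a)).prod
      (isCompact_bigCube d a)) fun q hq => ?_
    by_contra hne
    have h1 : φ q.2 * g (q.1 + q.2) ≠ 0 := right_ne_zero_of_mul hne
    have h2 := ha _ (left_ne_zero_of_mul h1)
    have h3 := hb _ (right_ne_zero_of_mul h1)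
    refine hq ⟨fun i => ?_, h2⟩
    have h4 := abs_sub (q.1 i + q.2 i) (q.2 i)
    rw [add_sub_cancel_right] at h4
    have h5 := h3 i
    rw [PiLp.add_apply] at h5
    linarith [h2 i]

theorem hasSum_box {f : (Fin d → ℕ) → ℂ} {a : ℂ} (hf : Summable f)
    (h : Filter.Tendsto (fun J : ℕ => ∑ m ∈ Fintype.piFinset fun _ : Fin d => Finset.range (J + 1),
      f m) Filter.atTop (nhds a)) : a = ∑' m, f m := by
  refine tendsto_nhds_unique h (hf.hasSum.comp (Filter.tendsto_atTop_finset_of_monotone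
    (fun J J' hJ => Fintype.piFinset_subset _ _ fun _ => Finset.range_mono (by omega)) fun m => ?_))
  refine ⟨∑ i, m i, Fintype.mem_piFinset.2 fun i => Finset.mem_range.2 ?_⟩
  have := Finset.single_le_sum (f := m) (fun _ _ => Nat.zero_le _) (Finset.mem_univ i)
  omega

/-- A distribution supported in the cube whose local means decay is a continuous function. -/
theorem isContinuousRep_tsum_synth {u : 𝓢'(Pt d, ℂ)}
    (hu : Distribution.dsupport u ⊆ unitCube d) {w : (Fin d → ℕ) → ℝ≥0∞}
    (hw : ∀ m x, ∫⁻ y, ‖D.kernel m x y‖ₑ * ‖K.localMean u m y‖ₑ ≤ w m) (hfin : ∑' m, w m ≠ ⊤)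
    (hcont : Continuous fun x => ∑' m, D.synth m (K.localMean u m) x) :
    IsContinuousRep u fun x => ∑' m, D.synth m (K.localMean u m) x := by
  refine ⟨hcont, fun φ hφ => ?_⟩
  have hgc : ∀ m, HasCompactSupport (K.localMean u m) := fun m =>
    hasCompactSupport_of_bigCube fun x hx => K.localMean_ne_zero hu m x hx
  obtain ⟨a, ha0, ha⟩ := exists_support_subset_bigCube hφ
  have hvs : ∀ x, u (φ.compSubConstCLM ℂ x) ≠ 0 → x ∈ bigCube d (1 + a) := fun x hx => by
    by_contra h
    have hc : HasCompactSupport (φ.compSubConstCLM ℂ x) := hφ.comp_homeomorph (Homeomorph.subRight x)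
    refine hx (apply_eq_zero_of_notMem_unitCube hu hc (fun z hz i => ?_) h)
    rw [abs_sub_comm]
    exact ha _ hz i
  have hlim := D.tendsto_sum_synth_mean (continuous_apply_translate u hφ) hvs 0
  have hterm : ∀ m, D.synth m (K.mean m fun y => u (φ.compSubConstCLM ℂ y)) 0 =
      ∫ t, D.synth m (K.localMean u m) t * φ t := fun m => by
    rw [show K.mean m (fun y => u (φ.compSubConstCLM ℂ y)) = _ from
      funext fun x => K.mean_translate u hφ m x]
    exact D.synth_integral_translate m φ.continuous hφ (K.continuous_localMean u m) (hgc m)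
  simp only [hterm, SchwartzMap.compSubConstCLM_zero, ContinuousLinearMap.id_apply] at hlim
  have hb : ∀ m, ∫⁻ t, ‖D.synth m (K.localMean u m) t * φ t‖ₑ ≤ w m * ∫⁻ t, ‖φ t‖ₑ := fun m => by
    rw [← lintegral_const_mul _ φ.continuous.enorm.measurable]
    refine lintegral_mono fun t => ?_
    rw [enorm_mul]
    gcongr
    exact (D.enorm_synth_le m _ t).trans (hw m t)
  have hbfin : ∑' m, ∫⁻ t, ‖D.synth m (K.localMean u m) t * φ t‖ₑ ≠ ⊤ := by
    refine ne_top_of_le_ne_top ?_ (ENNReal.tsum_le_tsum hb)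
    rw [ENNReal.tsum_mul_right]
    exact ENNReal.mul_ne_top hfin (lintegral_enorm_lt_top φ.continuous hφ).ne
  rw [hasSum_box (summable_of_tsum_enorm_ne_top (ne_top_of_le_ne_top hbfin
    (ENNReal.tsum_le_tsum fun m => enorm_integral_le_lintegral_enorm _))) hlim, ← integral_tsum]
  · simp only [tsum_mul_right]
  · exact fun m => ((D.continuous_synth m (K.continuous_localMean u m)
      (hgc m)).mul φ.continuous).aestronglyMeasurable
  · exact hbfin

end DualKernel

/-- The continuous representative of a distribution supported in the cube vanishes off the cube. -/
theorem IsContinuousRep.eq_zero {d : ℕ} {u : 𝓢'(Pt d, ℂ)} {f : Pt d → ℂ}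
    (hf : IsContinuousRep u f) (hu : Distribution.dsupport u ⊆ unitCube d) (x : Pt d)
    (hx : f x ≠ 0) : x ∈ unitCube d := by
  by_contra hxu
  have hopen : IsOpen (unitCube d)ᶜ := (isClosed_unitCube d).isOpen_compl
  have hae := hopen.ae_eq_zero_of_integral_contDiff_smul_eq_zero (μ := volume)
    (f := f) (hf.1.locallyIntegrable.locallyIntegrableOn _) fun g hg hgc hgs => by
      have hsm : ContDiff ℝ ∞ fun z => (g z : ℂ) := Complex.ofRealCLM.contDiff.comp hg
      have hcs : HasCompactSupport fun z => (g z : ℂ) := hgc.comp_left Complex.ofReal_zero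
      have hts : tsupport (fun z => (g z : ℂ)) ⊆ tsupport g :=
        closure_mono fun y hy h => hy (by simp [h])
      have h0 := apply_eq_zero_of_disjoint_dsupport u (φ := hcs.toSchwartzMap hsm) hcs
        (Set.disjoint_left.2 fun z hz hzu => hgs (hts hz) (hu hzu))
      have h1 : ∫ z, f z * (g z : ℂ) = 0 := (hf.2 (hcs.toSchwartzMap hsm) hcs).symm.trans h0
      rw [← h1]
      refine integral_congr_ae (Filter.Eventually.of_forall fun z => ?_)
      simp only [Complex.real_smul, mul_comm]
  have heq : Set.EqOn f 0 (unitCube d)ᶜ :=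
    Measure.eqOn_open_of_ae_eq (μ := volume)
      ((ae_restrict_iff' hopen.measurableSet).2 hae) hopen hf.1.continuousOn continuousOn_const
  exact hx (heq hxu)

/-! ### Upper bounds for norms that dominate a Besov norm -/

theorem optimalError_le {d n : ℕ} (F : Set (Pt d → ℂ)) (S : Finset (Pt d))
    (hS : ∀ x ∈ S, x ∈ unitCube d) (hcard : S.card ≤ n) (w : ℝ) :
    optimalError F n ≤ worstCaseError (fun f => (w : ℂ) * ∑ x ∈ S, f x) F := by
  have h0 : (0 : Pt d) ∈ unitCube d := fun i => by simp
  let e := S.equivFin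
  let x : Fin n → unitCube d := fun i => if h : (i : ℕ) < S.card then
    ⟨e.symm ⟨i, h⟩, hS _ (e.symm ⟨i, h⟩).2⟩ else ⟨0, h0⟩
  let v : Fin n → ℝ := fun i => if (i : ℕ) < S.card then w else 0
  refine (iInf₂_le x v).trans (le_of_eq ?_)
  congr 1
  funext f
  have h1 : ∑ x ∈ S, f x = ∑ j : Fin S.card, f (e.symm j) := by
    rw [← Finset.sum_coe_sort S f]
    exact (e.symm.sum_comp fun x : S => f x).symm
  have h2 : ∀ g : ℕ → ℂ, ∑ i : Fin n, (if (i : ℕ) < S.card then g i else 0) =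
      ∑ j : Fin S.card, g j := fun g => by
    rw [Fin.sum_univ_eq_sum_range (fun i => if i < S.card then g i else 0),
      Fin.sum_univ_eq_sum_range, ← Finset.sum_filter]
    congr 1
    ext i
    simp only [Finset.mem_filter, Finset.mem_range]
    omega
  have h3 := h2 fun i => if h : i < S.card then w * f (e.symm ⟨i, h⟩) else 0
  have h4 : ∀ j : Fin S.card, (if h : (j : ℕ) < S.card then (w : ℂ) * f (e.symm ⟨j, h⟩) else 0) =
      w * f (e.symm j) := fun j => by rw [dif_pos j.2]
  simp only [h4] at h3
  rw [h1, Finset.mul_sum, ← h3]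
  refine Finset.sum_congr rfl fun i _ => ?_
  by_cases h : (i : ℕ) < S.card
  · simp [x, v, h]
  · simp [v, h]

theorem exists_rate_div_le {d : ℕ} (hd : 1 ≤ d) {θ : ℝ≥0∞} (hθ : 1 ≤ θ) {s : ℝ} (hs : 0 ≤ s)
    {N : ℕ} (hN : 1 ≤ N) : ∃ C : ℝ≥0∞, C ≠ ⊤ ∧ ∀ n : ℕ, 2 * N ≤ n →
      rate d s θ (n / N) ≤ C * rate d s θ n := by
  refine ⟨ENNReal.ofReal ((2 * N) ^ s), ENNReal.ofReal_ne_top, fun n hn => ?_⟩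
  have hκ := logExponent_nonneg hd hθ
  rw [rate, rate, ← ENNReal.ofReal_mul (by positivity)]
  refine ENNReal.ofReal_le_ofReal ?_
  have h1 : 2 ≤ n / N := (Nat.le_div_iff_mul_le hN).2 hn
  have hN0 : (0 : ℝ) < N := by exact_mod_cast hN
  have h2 : n ≤ 2 * N * (n / N) := by
    have := Nat.lt_mul_div_succ n hN
    nlinarith
  have h3 : (0 : ℝ) < (n / N : ℕ) := by positivity
  have h4 : (0 : ℝ) < n := by
    have : 0 < n := by omega
    exact_mod_cast this
  have h5 : (((n / N : ℕ) : ℝ)) ^ (-s) ≤ (2 * N) ^ s * (n : ℝ) ^ (-s) := by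
    have h6 : (n : ℝ) / (2 * N) ≤ (n / N : ℕ) := by
      rw [div_le_iff₀ (by positivity), mul_comm]
      exact_mod_cast h2
    refine (Real.rpow_le_rpow_of_nonpos (by positivity) h6 (neg_nonpos.2 hs)).trans (le_of_eq ?_)
    rw [Real.div_rpow h4.le (by positivity), Real.rpow_neg (by positivity : (0 : ℝ) ≤ 2 * N)]
    field_simp
  have h7 : Real.log (n / N : ℕ) ≤ Real.log n :=
    Real.log_le_log h3 (by exact_mod_cast Nat.div_le_self n N)
  rw [← mul_assoc]
  have h8 : 0 ≤ Real.log (n / N : ℕ) := Real.log_natCast_nonneg _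
  exact mul_le_mul h5 (Real.rpow_le_rpow h8 h7 hκ) (by positivity) (by positivity)

theorem exists_le_rate {d : ℕ} (hd : 1 ≤ d) {θ : ℝ≥0∞} (hθ : 1 ≤ θ) {s : ℝ} (hs : 0 ≤ s)
    {N : ℕ} : ∃ C : ℝ≥0∞, C ≠ ⊤ ∧ ∀ n : ℕ, 2 ≤ n → n < 2 * N → 1 ≤ C * rate d s θ n := by
  have hκ := logExponent_nonneg hd hθ
  have hl2 : 0 < Real.log 2 := Real.log_pos one_lt_two
  refine ⟨ENNReal.ofReal ((2 * N) ^ s * (Real.log 2 ^ logExponent d θ)⁻¹),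
    ENNReal.ofReal_ne_top, fun n hn hnN => ?_⟩
  rw [rate, ← ENNReal.ofReal_mul (by positivity), ENNReal.one_le_ofReal]
  have h0 : (0 : ℝ) < n := by positivity
  have h1 : (1 : ℝ) ≤ (2 * N) ^ s * (n : ℝ) ^ (-s) := by
    rw [Real.rpow_neg h0.le, ← div_eq_mul_inv, one_le_div (by positivity)]
    have : (n : ℝ) ≤ 2 * N := by exact_mod_cast hnN.le
    gcongr
  have h2 : (1 : ℝ) ≤ (Real.log 2 ^ logExponent d θ)⁻¹ * Real.log n ^ logExponent d θ := by
    rw [inv_mul_eq_div, one_le_div (by positivity)]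
    have : (2 : ℝ) ≤ n := by exact_mod_cast hn
    gcongr
  calc (1 : ℝ) ≤ ((2 * N) ^ s * (n : ℝ) ^ (-s)) *
        ((Real.log 2 ^ logExponent d θ)⁻¹ * Real.log n ^ logExponent d θ) :=
        one_le_mul_of_one_le_of_one_le h1 h2
    _ = _ := by rw [logExponent]; ring

theorem frolovNodes_subset_unitCube (d n : ℕ) : frolovNodes d n ⊆ unitCube d :=
  fun _ hx i => ⟨(hx.2 i).1, (hx.2 i).2.le⟩

theorem lesssim_of_forall {a b : ℕ → ℝ≥0∞} {C : ℝ≥0∞} (hC : C ≠ ⊤)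
    (h : ∀ n, 2 ≤ n → a n ≤ C * b n) : Lesssim a b :=
  ⟨C.toNNReal, fun n hn => by rw [ENNReal.coe_toNNReal hC]; exact h n hn⟩

/-- Optimal cubature is at least as good as Frolov's rule. -/
theorem lesssim_optimalError {d : ℕ} (hd : 1 ≤ d) {θ : ℝ≥0∞} (hθ : 1 ≤ θ) {s : ℝ} (hs : 0 ≤ s)
    {F : Set (Pt d → ℂ)} {B : ℝ≥0∞} (hB : B ≠ ⊤)
    (hF : ∀ f ∈ F, ‖∫ x in unitCube d, f x‖ₑ ≤ B)
    (h : Lesssim (fun n => worstCaseError (frolovRule d n) F) (rate d s θ)) :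
    Lesssim (optimalError F) (rate d s θ) := by
  obtain ⟨C, hC⟩ := h
  obtain ⟨N₀, hN₀⟩ := exists_frolovNodes_encard_le hd
  set N := N₀ + 1
  have hNle : ∀ n : ℕ, 1 ≤ n → (frolovNodes d n).encard ≤ (N * n : ℕ) := fun n hn =>
    (hN₀ n hn).trans (by exact_mod_cast Nat.mul_le_mul_right n (Nat.le_succ N₀))
  obtain ⟨C₁, hC₁, h₁⟩ := exists_rate_div_le hd hθ hs (N := N) (by omega)
  obtain ⟨C₂, hC₂, h₂⟩ := exists_le_rate hd hθ hs (N := N)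
  refine lesssim_of_forall (C := C * C₁ + B * C₂) (by finiteness) fun n hn => ?_
  rcases le_or_gt (2 * N) n with hnN | hnN
  · have h2 : 2 ≤ n / N := (Nat.le_div_iff_mul_le (by omega)).2 hnN
    have hfin := frolovNodes_finite hd (n := n / N) (by omega)
    have hcard : hfin.toFinset.card ≤ n := by
      have h3 := hNle (n / N) (by omega)
      rw [hfin.encard_eq_coe_toFinset_card] at h3
      have h4 : hfin.toFinset.card ≤ N * (n / N) := by exact_mod_cast h3
      exact h4.trans (Nat.mul_div_le n N)
    have h5 := optimalError_le F hfin.toFinset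
      (fun x hx => frolovNodes_subset_unitCube d _ (hfin.mem_toFinset.1 hx)) hcard
      (1 / ((n / N : ℕ) : ℝ))
    have h6 : (fun f : Pt d → ℂ => ((1 / ((n / N : ℕ) : ℝ) : ℝ) : ℂ) * ∑ x ∈ hfin.toFinset, f x) =
        frolovRule d (n / N) := by
      funext f
      rw [frolovRule, finsum_mem_eq_finite_toFinset_sum _ hfin]
      push_cast
      rfl
    rw [h6] at h5
    calc optimalError F n ≤ C * rate d s θ (n / N) := h5.trans (hC _ h2)
      _ ≤ C * (C₁ * rate d s θ n) := by gcongr; exact h₁ n hnN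
      _ ≤ _ := by rw [← mul_assoc]; gcongr; exact le_self_add
  · have h5 := optimalError_le (n := n) F ∅ (by simp) (by simp) 0
    refine h5.trans ?_
    have h6 : worstCaseError (fun f : Pt d → ℂ => ((0 : ℝ) : ℂ) * ∑ x ∈ ∅, f x) F ≤ B :=
      iSup₂_le fun f hf => by simpa using hF f hf
    calc _ ≤ B * 1 := by rwa [mul_one]
      _ ≤ B * (C₂ * rate d s θ n) := by gcongr; exact h₂ n hn hnN
      _ ≤ _ := by rw [← mul_assoc]; gcongr; exact le_add_self

/-- The norm `N` dominates the norm of `𝐁^s_{p,θ}` for some `p` with `1 / p < s`, on distributions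
supported in the cube. -/
def DominatesBesov {L : ℕ} (K : LocalMeanKernel L) (d : ℕ) (s : ℝ) (θ : ℝ≥0∞)
    (N : 𝓢'(Pt d, ℂ) → ℝ≥0∞) : Prop :=
  ∃ p : ℝ≥0∞, 1 ≤ p ∧ (1 / p).toReal < s ∧ ∃ A : ℝ≥0∞, A ≠ ⊤ ∧ ∀ u : 𝓢'(Pt d, ℂ),
    Distribution.dsupport u ⊆ unitCube d → besovNorm K d s p θ u ≤ A * N u

namespace DominatesBesov

variable {L : ℕ} {K : LocalMeanKernel L} {d : ℕ} {s : ℝ} {θ : ℝ≥0∞} {N : 𝓢'(Pt d, ℂ) → ℝ≥0∞}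

theorem exists_isContinuousRep (hN : DominatesBesov K d s θ N) (hd : 1 ≤ d) (hθ : 1 ≤ θ) :
    ∀ u ∈ supportedSpace N, ∃ f, IsContinuousRep u f := by
  obtain ⟨p, hp, hs, A, hA, hle⟩ := hN
  obtain ⟨D⟩ := exists_dualKernel K
  rintro u ⟨hu, hsupp⟩
  have hfin : besovNorm K d s p θ u ≠ ⊤ :=
    ne_top_of_le_ne_top (ENNReal.mul_ne_top hA hu.ne) (hle u hsupp)
  obtain ⟨C, hC, h⟩ := D.exists_tsum_enorm_synth_le hd hp hθ hs
  obtain ⟨w, hw, hsum⟩ := h (K.localMean u) (K.continuous_localMean u)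
  exact ⟨_, D.isContinuousRep_tsum_synth hsupp hw
    (ne_top_of_le_ne_top (ENNReal.mul_ne_top hC hfin) hsum)
    (D.continuous_tsum_synth hd hp hθ hs (K.continuous_localMean u)
      (K.localMean_ne_zero hsupp) hfin)⟩

theorem eq_tsum_synth (D : DualKernel K) {p : ℝ≥0∞} (hd : 1 ≤ d) (hp : 1 ≤ p) (hθ : 1 ≤ θ)
    (hs : (1 / p).toReal < s) {u : 𝓢'(Pt d, ℂ)} (hsupp : Distribution.dsupport u ⊆ unitCube d)
    (hfin : besovNorm K d s p θ u ≠ ⊤) {f : Pt d → ℂ} (hf : IsContinuousRep u f) (x : Pt d) :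
    f x = ∑' m, D.synth m (K.localMean u m) x := by
  obtain ⟨C, hC, h⟩ := D.exists_tsum_enorm_synth_le hd hp hθ hs
  obtain ⟨w, hw, hsum⟩ := h (K.localMean u) (K.continuous_localMean u)
  have hlim := D.tendsto_sum_synth_mean hf.1
    (fun y hy => unitCube_subset_bigCube d (hf.eq_zero hsupp y hy)) x
  simp only [← K.localMean_eq_mean hf] at hlim
  refine DualKernel.hasSum_box (summable_of_tsum_enorm_ne_top (ne_top_of_le_ne_top
    (ne_top_of_le_ne_top (ENNReal.mul_ne_top hC hfin) hsum) (ENNReal.tsum_le_tsum fun m =>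
      (D.enorm_synth_le m _ x).trans (hw m x)))) hlim

theorem lesssim_frolovRule (hN : DominatesBesov K d s θ N) (hd : 1 ≤ d) (hθ : 1 ≤ θ) :
    Lesssim (fun n => worstCaseError (frolovRule d n) (unitBall N)) (rate d s θ) := by
  obtain ⟨p, hp, hs, A, hA, hle⟩ := hN
  obtain ⟨D⟩ := exists_dualKernel K
  obtain ⟨C, hC, h⟩ := D.exists_enorm_error_le (d := d) hd hp hθ hs (r := 1 + K.radius)
    (by linarith [K.radius_pos])
  refine lesssim_of_forall (C := C * A) (by finiteness) fun n hn => ?_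
  refine iSup₂_le fun f hf => ?_
  obtain ⟨u, ⟨-, hsupp⟩, hu1, hf⟩ := hf
  have hb : besovNorm K d s p θ u ≤ A :=
    (hle u hsupp).trans (mul_le_of_le_one_right' hu1)
  have hfin := ne_top_of_le_ne_top hA hb
  refine (h n hn (K.localMean u) (K.continuous_localMean u) (K.localMean_ne_zero hsupp) hfin f hf.1
    (hf.eq_zero hsupp) (eq_tsum_synth D hd hp hθ hs hsupp hfin hf)).trans ?_
  gcongr
  exact hb

theorem lesssim_optimalError (hN : DominatesBesov K d s θ N) (hd : 1 ≤ d) (hθ : 1 ≤ θ) :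
    Lesssim (optimalError (unitBall N)) (rate d s θ) := by
  have hfrolov := hN.lesssim_frolovRule hd hθ
  obtain ⟨p, hp, hs, A, hA, hle⟩ := hN
  obtain ⟨D⟩ := exists_dualKernel K
  have hs0 : 0 ≤ s := le_trans (by positivity) hs.le
  obtain ⟨C, hC, h⟩ := D.exists_enorm_tsum_synth_le (d := d) hd hp hθ hs
  have hvol : volume (unitCube d) ≠ ⊤ :=
    ((isCompact_bigCube d 1).of_isClosed_subset (isClosed_unitCube d)
      (unitCube_subset_bigCube d)).measure_lt_top.ne
  refine MixedSmoothness.lesssim_optimalError hd hθ hs0 (B := C * A * volume (unitCube d))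
    (by finiteness) (fun f hf => ?_) hfrolov
  obtain ⟨u, ⟨-, hsupp⟩, hu1, hf⟩ := hf
  have hb : besovNorm K d s p θ u ≤ A :=
    (hle u hsupp).trans (mul_le_of_le_one_right' hu1)
  have hfin := ne_top_of_le_ne_top hA hb
  refine (enorm_integral_le_lintegral_enorm _).trans ?_
  calc ∫⁻ x in unitCube d, ‖f x‖ₑ ≤ ∫⁻ _ in unitCube d, C * A := lintegral_mono fun x => by
        rw [eq_tsum_synth D hd hp hθ hs hsupp hfin hf x]
        refine (h _ (K.continuous_localMean u) x).trans ?_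
        gcongr
        exact hb
    _ = _ := setLIntegral_const _ _

end DominatesBesov

theorem dominatesBesov_besovNorm {L : ℕ} (K : LocalMeanKernel L) (d : ℕ) {s : ℝ} {p : ℝ≥0∞}
    (θ : ℝ≥0∞) (hp : 1 ≤ p) (hs : (1 / p).toReal < s) :
    DominatesBesov K d s θ (besovNorm K d s p θ) :=
  ⟨p, hp, hs, 1, ENNReal.one_ne_top, fun u _ => by rw [one_mul]⟩

/-! ### Triebel-Lizorkin norms dominate Besov norms -/

/-- Minkowski's integral inequality for sequences. -/
theorem tsum_lintegral_rpow_le {α ι : Type*} [Countable ι] [MeasurableSpace α] {μ : Measure α}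
    {b : ι → α → ℝ≥0∞} (hb : ∀ i, Measurable (b i)) {q : ℝ} (hq : 1 ≤ q) :
    (∑' i, (∫⁻ x, b i x ∂μ) ^ q) ^ (1 / q) ≤ ∫⁻ x, (∑' i, b i x ^ q) ^ (1 / q) ∂μ := by
  have hq0 : 0 < q := by linarith
  rcases hq.eq_or_lt with rfl | hq1
  · simp only [ENNReal.rpow_one, div_one]
    rw [lintegral_tsum fun i => (hb i).aemeasurable]
  set I := ∫⁻ x, (∑' i, b i x ^ q) ^ (1 / q) ∂μ with hI
  have hle : ∀ i, ∫⁻ x, b i x ∂μ ≤ I := fun i => lintegral_mono fun x => by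
    calc b i x = (b i x ^ q) ^ (1 / q) := by
          rw [← ENNReal.rpow_mul, mul_one_div_cancel hq0.ne', ENNReal.rpow_one]
      _ ≤ _ := by gcongr; exact ENNReal.le_tsum i
  rcases eq_or_ne I ⊤ with hIt | hIt
  · rw [hIt]; exact le_top
  rw [one_div, ENNReal.rpow_inv_le_iff hq0, ENNReal.tsum_eq_iSup_sum]
  refine iSup_le fun F => ?_
  rw [← ENNReal.rpow_inv_le_iff hq0, ← one_div]
  set B : ι → ℝ≥0∞ := fun i => ∫⁻ x, b i x ∂μ with hB
  have hBt : ∀ i, B i ≠ ⊤ := fun i => ne_top_of_le_ne_top hIt (hle i)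
  set S := ∑ i ∈ F, B i ^ q with hS
  have hSt : S ≠ ⊤ := ENNReal.sum_ne_top.2 fun i _ => ENNReal.rpow_ne_top_of_nonneg hq0.le (hBt i)
  have hconj : (Real.conjExponent q).HolderConjugate q :=
    (Real.HolderConjugate.conjExponent hq1).symm
  set q' := Real.conjExponent q with hq'
  have hq'0 : 0 < q' := hconj.pos
  have hqq : (q - 1) * q' = q := by
    rw [hq', Real.conjExponent]
    field_simp [sub_ne_zero.2 hq1.ne']
  have hmul : S ≤ S ^ (1 / q') * I := by
    calc S = ∑ i ∈ F, B i ^ (q - 1) * B i := Finset.sum_congr rfl fun i _ => by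
          nth_rw 3 [← ENNReal.rpow_one (B i)]
          rw [← ENNReal.rpow_add_of_nonneg _ _ (by linarith) zero_le_one, sub_add_cancel]
      _ = ∫⁻ x, ∑ i ∈ F, B i ^ (q - 1) * b i x ∂μ := by
          rw [lintegral_finsetSum _ fun i _ => (hb i).const_mul _]
          refine Finset.sum_congr rfl fun i _ => ?_
          rw [lintegral_const_mul _ (hb i)]
      _ ≤ ∫⁻ x, S ^ (1 / q') * (∑' i, b i x ^ q) ^ (1 / q) ∂μ := lintegral_mono fun x => by
          refine (ENNReal.inner_le_Lp_mul_Lq F (fun i => B i ^ (q - 1)) (fun i => b i x)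
            hconj).trans ?_
          simp only [← ENNReal.rpow_mul, hqq]
          gcongr
          exact ENNReal.sum_le_tsum F
      _ = _ := by
          rw [lintegral_const_mul]
          exact (Measurable.tsum fun i => (hb i).pow_const q).pow_const _
  rcases eq_or_ne S 0 with h0 | h0
  · rw [h0, ENNReal.zero_rpow_of_pos (by positivity)]
    exact zero_le
  have hsplit : S = S ^ (1 / q') * S ^ (1 / q) := by
    rw [← ENNReal.rpow_add _ _ h0 hSt, one_div, one_div, hconj.inv_add_inv_eq_one,
      ENNReal.rpow_one]
  rw [hsplit] at hmul
  nth_rw 2 [← hsplit] at hmul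
  refine (ENNReal.mul_le_mul_iff_right ?_ ?_).1 hmul
  · exact (ENNReal.rpow_pos (pos_iff_ne_zero.2 h0) hSt).ne'
  · exact ENNReal.rpow_ne_top_of_nonneg (by positivity) hSt

theorem weight_mul_eLpNorm {d : ℕ} (s : ℝ) (m : Fin d → ℕ) {p : ℝ≥0∞} (hp0 : p ≠ 0) (hp : p ≠ ⊤)
    {g : Pt d → ℂ} (hg : Continuous g) : weight s m * eLpNorm g p volume =
      (∫⁻ x, (weight s m * ‖g x‖ₑ) ^ p.toReal) ^ (1 / p.toReal) := by
  have hp' : 0 < p.toReal := ENNReal.toReal_pos hp0 hp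
  rw [eLpNorm_eq_lintegral_rpow_enorm_toReal hp0 hp]
  simp only [ENNReal.mul_rpow_of_nonneg _ _ hp'.le]
  rw [lintegral_const_mul _ (hg.enorm.measurable.pow_const _),
    ENNReal.mul_rpow_of_nonneg _ _ (by positivity), ← ENNReal.rpow_mul,
    mul_one_div_cancel hp'.ne', ENNReal.rpow_one]

theorem measurable_seqNorm {d : ℕ} (θ : ℝ≥0∞) {a : (Fin d → ℕ) → Pt d → ℝ≥0∞}
    (ha : ∀ m, Measurable (a m)) : Measurable fun x => seqNorm θ fun m => a m x := by
  unfold seqNorm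
  split_ifs
  · exact Measurable.iSup ha
  · exact (Measurable.tsum fun m => (ha m).pow_const _).pow_const _

theorem le_seqNorm {ι : Type*} {θ : ℝ≥0∞} (hθ : θ ≠ 0) (a : ι → ℝ≥0∞) (i : ι) :
    a i ≤ seqNorm θ a := by
  unfold seqNorm
  split_ifs with h
  · exact le_iSup a i
  · have h0 := ENNReal.toReal_pos hθ h
    calc a i = (a i ^ θ.toReal) ^ (1 / θ.toReal) := by
          rw [← ENNReal.rpow_mul, mul_one_div_cancel h0.ne', ENNReal.rpow_one]
      _ ≤ _ := by gcongr; exact ENNReal.le_tsum i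

variable {L : ℕ} {d : ℕ}

theorem besovNorm_le_triebelLizorkinNorm (K : LocalMeanKernel L) (s : ℝ) {p θ : ℝ≥0∞} (hp : 1 ≤ p)
    (hpt : p ≠ ⊤) (hpθ : p ≤ θ) (u : 𝓢'(Pt d, ℂ)) :
    besovNorm K d s p θ u ≤ triebelLizorkinNorm K d s p θ u := by
  have hp0 : p ≠ 0 := (zero_lt_one.trans_le hp).ne'
  have hP : 0 < p.toReal := ENNReal.toReal_pos hp0 hpt
  have hθ0 : θ ≠ 0 := (zero_lt_one.trans_le (hp.trans hpθ)).ne'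
  have hmeas : ∀ m, Measurable fun x => weight s m * ‖K.localMean u m x‖ₑ := fun m =>
    (K.continuous_localMean u m).enorm.measurable.const_mul _
  have hF : triebelLizorkinNorm K d s p θ u = (∫⁻ x, (seqNorm θ fun m : Fin d → ℕ =>
      weight s m * ‖K.localMean u m x‖ₑ) ^ p.toReal) ^ (1 / p.toReal) := by
    rw [triebelLizorkinNorm, eLpNorm_eq_lintegral_rpow_enorm_toReal hp0 hpt]
    simp only [enorm_eq_self]
  rw [hF, besovNorm]
  simp only [weight_mul_eLpNorm s _ hp0 hpt (K.continuous_localMean u _)]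
  rcases eq_or_ne θ ⊤ with rfl | hθ
  · rw [seqNorm, if_pos rfl]
    refine iSup_le fun m => ?_
    gcongr with x
    exact le_seqNorm hθ0 (fun m => weight s m * ‖K.localMean u m x‖ₑ) m
  · have hT : 0 < θ.toReal := ENNReal.toReal_pos hθ0 hθ
    have hq : 1 ≤ θ.toReal / p.toReal := by
      rw [one_le_div hP]
      exact ENNReal.toReal_mono hθ hpθ
    have h := tsum_lintegral_rpow_le (μ := (volume : Measure (Pt d)))
      (fun m => (hmeas m).pow_const p.toReal) hq
    simp only [seqNorm, if_neg hθ, ← ENNReal.rpow_mul] at h ⊢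
    rw [one_div_mul_eq_div]
    have e1 : p.toReal * (θ.toReal / p.toReal) = θ.toReal := by field_simp
    rw [e1, one_div_div] at h
    calc _ = ((∑' m : Fin d → ℕ, (∫⁻ x, (weight s m * ‖K.localMean u m x‖ₑ) ^ p.toReal) ^
          (θ.toReal / p.toReal)) ^ (p.toReal / θ.toReal)) ^ (1 / p.toReal) := by
          rw [← ENNReal.rpow_mul]
          congr 1
          field_simp
      _ ≤ _ := by
          rw [one_div_mul_eq_div]
          gcongr

theorem exists_besovNorm_le_triebelLizorkinNorm (K : LocalMeanKernel L) (s : ℝ) {p θ : ℝ≥0∞}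
    (hθ : 1 ≤ θ) (hθt : θ ≠ ⊤) (hpθ : θ ≤ p) : ∃ C : ℝ≥0∞, C ≠ ⊤ ∧ ∀ u : 𝓢'(Pt d, ℂ),
      Distribution.dsupport u ⊆ unitCube d →
        besovNorm K d s θ θ u ≤ C * triebelLizorkinNorm K d s p θ u := by
  have hθ0 : θ ≠ 0 := (zero_lt_one.trans_le hθ).ne'
  have hT : 0 < θ.toReal := ENNReal.toReal_pos hθ0 hθt
  have hvol : volume (bigCube d (1 + K.radius)) ≠ ⊤ := (isCompact_bigCube d _).measure_lt_top.ne
  have hexp : 0 ≤ 1 / θ.toReal - 1 / p.toReal := by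
    rcases eq_or_ne p ⊤ with rfl | hp
    · simp
    · rw [sub_nonneg]
      exact one_div_le_one_div_of_le hT (ENNReal.toReal_mono hp hpθ)
  refine ⟨volume (bigCube d (1 + K.radius)) ^ (1 / θ.toReal - 1 / p.toReal),
    ENNReal.rpow_ne_top_of_nonneg hexp hvol, fun u hu => ?_⟩
  have hmeas : ∀ m, Measurable fun x => weight s m * ‖K.localMean u m x‖ₑ := fun m =>
    (K.continuous_localMean u m).enorm.measurable.const_mul _
  set G : Pt d → ℝ≥0∞ := fun x => seqNorm θ fun m : Fin d → ℕ =>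
    weight s m * ‖K.localMean u m x‖ₑ with hG
  have hGm : Measurable G := measurable_seqNorm θ hmeas
  have h1 : besovNorm K d s θ θ u = eLpNorm G θ volume := by
    rw [besovNorm, eLpNorm_eq_lintegral_rpow_enorm_toReal hθ0 hθt]
    simp only [weight_mul_eLpNorm s _ hθ0 hθt (K.continuous_localMean u _), enorm_eq_self, hG,
      seqNorm, if_neg hθt, ← ENNReal.rpow_mul, one_div_mul_cancel hT.ne', ENNReal.rpow_one]
    rw [lintegral_tsum fun m => ((hmeas m).pow_const _).aemeasurable]
  have h2 : Function.support G ⊆ bigCube d (1 + K.radius) := fun x hx => by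
    by_contra h
    refine hx ?_
    have h3 : ∀ m, K.localMean u m x = 0 := fun m => by_contra fun hne =>
      h (K.localMean_ne_zero hu m x hne)
    simp [hG, seqNorm, hθt, h3, hT]
  rw [h1, triebelLizorkinNorm, ← eLpNorm_restrict_eq_of_support_subset h2]
  refine (eLpNorm_le_eLpNorm_mul_rpow_measure_univ hpθ hGm.aestronglyMeasurable).trans ?_
  rw [Measure.restrict_apply_univ, mul_comm]
  gcongr
  exact Measure.restrict_le_self

theorem dominatesBesov_triebelLizorkinNorm (K : LocalMeanKernel L) (d : ℕ) {s : ℝ}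
    {p θ : ℝ≥0∞} (hp : 1 ≤ p) (hθ : 1 ≤ θ) (hpt : p ≠ ⊤)
    (hs : max (1 / p).toReal (1 / θ).toReal < s) :
    DominatesBesov K d s θ (triebelLizorkinNorm K d s p θ) := by
  rcases le_total p θ with h | h
  · exact ⟨p, hp, (le_max_left _ _).trans_lt hs, 1, ENNReal.one_ne_top, fun u _ => by
      rw [one_mul]; exact besovNorm_le_triebelLizorkinNorm K s hp hpt h u⟩
  · obtain ⟨C, hC, hle⟩ := exists_besovNorm_le_triebelLizorkinNorm (d := d) K s hθ
      (ne_top_of_le_ne_top hpt h) h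
    exact ⟨θ, hθ, (le_max_right _ _).trans_lt hs, C, hC, hle⟩

/-! ### Local means of dilated bumps -/

theorem exists_bump : ∃ b : ℝ → ℝ, ContDiff ℝ ∞ b ∧ HasCompactSupport b ∧ (∀ t, 0 ≤ b t) ∧
    (∀ t, b t ≤ 1) ∧ (∀ t, b t ≠ 0 → t ∈ Set.Ioo (0 : ℝ) 1) ∧ 0 < ∫ t, b t := by
  let f : ContDiffBump (1 / 2 : ℝ) := ⟨1 / 8, 1 / 4, by norm_num, by norm_num⟩
  refine ⟨f, f.contDiff, f.hasCompactSupport, fun t => f.nonneg, fun t => f.le_one, fun t ht => ?_,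
    f.integral_pos⟩
  have h : t ∈ Function.support f := ht
  rw [f.support_eq, Real.ball_eq_Ioo] at h
  change t ∈ Set.Ioo (1 / 2 - 1 / 4 : ℝ) (1 / 2 + 1 / 4) at h
  constructor <;> linarith [h.1, h.2]

/-- A smooth bump function supported in `(0, 1)`. -/
def bump : ℝ → ℝ := exists_bump.choose

theorem contDiff_bump : ContDiff ℝ ∞ bump := exists_bump.choose_spec.1

theorem hasCompactSupport_bump : HasCompactSupport bump := exists_bump.choose_spec.2.1

theorem bump_nonneg (t : ℝ) : 0 ≤ bump t := exists_bump.choose_spec.2.2.1 t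

theorem bump_le_one (t : ℝ) : bump t ≤ 1 := exists_bump.choose_spec.2.2.2.1 t

theorem mem_Ioo_of_bump_ne_zero {t : ℝ} (h : bump t ≠ 0) : t ∈ Set.Ioo (0 : ℝ) 1 :=
  exists_bump.choose_spec.2.2.2.2.1 t h

theorem integral_bump_pos : 0 < ∫ t, bump t := exists_bump.choose_spec.2.2.2.2.2

theorem eq_of_bump_ne_zero {t : ℝ} {k l : ℕ} (hk : bump (t - k) ≠ 0) (hl : bump (t - l) ≠ 0) :
    k = l := by
  have h1 := mem_Ioo_of_bump_ne_zero hk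
  have h2 := mem_Ioo_of_bump_ne_zero hl
  have h3 : (k : ℝ) < l + 1 := by linarith [h1.1, h2.2]
  have h4 : (l : ℝ) < k + 1 := by linarith [h1.2, h2.1]
  have h5 : k < l + 1 := by exact_mod_cast h3
  have h6 : l < k + 1 := by exact_mod_cast h4
  omega

theorem sum_bump_le_one (F : Finset ℕ) (t : ℝ) : ∑ k ∈ F, bump (t - k) ≤ 1 := by
  by_cases h : ∃ k ∈ F, bump (t - k) ≠ 0
  · obtain ⟨k, hk, hne⟩ := h
    rw [Finset.sum_eq_single_of_mem k hk fun l _ hl => by_contra fun h =>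
      hl (eq_of_bump_ne_zero h hne)]
    exact bump_le_one _
  · push Not at h
    rw [Finset.sum_eq_zero h]
    exact zero_le_one

/-- Taylor approximation with a uniform remainder. -/
theorem exists_taylor_coeff (N : ℕ) {b : ℝ → ℝ} (hb : ContDiff ℝ ∞ b) {B : ℝ}
    (hB : ∀ t, |iteratedDeriv N b t| ≤ B) (a : ℝ) :
    ∃ c : ℕ → ℝ, ∀ x, |b (a + x) - ∑ α ∈ Finset.range N, c α * x ^ α| ≤ B * |x| ^ N := by
  induction N generalizing b with
  | zero => exact ⟨0, fun x => by simpa using hB (a + x)⟩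
  | succ N ih =>
    have hb' : ContDiff ℝ ∞ (deriv b) := (contDiff_infty_iff_deriv.1 hb).2
    obtain ⟨c, hc⟩ := ih hb' fun t => by rw [← iteratedDeriv_succ']; exact hB t
    refine ⟨fun α => if α = 0 then b a else c (α - 1) / α, fun x => ?_⟩
    set g : ℝ → ℝ := fun x => b (a + x) - (∑ α ∈ Finset.range N, c α / (α + 1) * x ^ (α + 1) + b a)
    have hg : ∀ y, HasDerivAt g (deriv b (a + y) - ∑ α ∈ Finset.range N, c α * y ^ α) y := fun y => by
      have h1 : HasDerivAt (fun x => b (a + x)) (deriv b (a + y)) y :=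
        ((hb.differentiable (by simp)) (a + y)).hasDerivAt.comp_const_add a y
      have h2 : HasDerivAt (fun x => ∑ α ∈ Finset.range N, c α / (α + 1) * x ^ (α + 1))
          (∑ α ∈ Finset.range N, c α * y ^ α) y := by
        refine HasDerivAt.fun_sum fun α _ => ?_
        have h3 := (hasDerivAt_pow (α + 1) y).const_mul (c α / (α + 1))
        refine h3.congr_deriv ?_
        push_cast
        field_simp
      exact h1.sub (h2.add_const _)
    have h4 := (convex_closedBall (0 : ℝ) |x|).norm_image_sub_le_of_norm_hasDerivWithin_le
      (f := g) (C := B * |x| ^ N) (x := 0) (y := x) (fun y _ => (hg y).hasDerivWithinAt)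
      (fun y hy => (hc y).trans (by
        have hB0 : 0 ≤ B := (abs_nonneg _).trans (hB 0)
        have : |y| ≤ |x| := by simpa using hy
        gcongr)) (by simp) (by simp)
    have hg0 : g 0 = 0 := by simp [g]
    rw [hg0, sub_zero, sub_zero, Real.norm_eq_abs, Real.norm_eq_abs] at h4
    rw [Finset.sum_range_succ']
    simpa [g, pow_succ, mul_assoc] using h4

namespace LocalMeanKernel

variable {L : ℕ} (K : LocalMeanKernel L)

theorem integral_Ψ₁_mul_pow {α : ℕ} (hα : α ≤ L) : ∫ v, K.Ψ₁ v * (v : ℂ) ^ α = 0 := by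
  have hint : ∀ n : ℕ, (n : ℕ∞) ≤ ⊤ → Integrable fun x : ℝ => x ^ n • K.Ψ₁ x := fun n _ =>
    ((continuous_pow n).smul K.contDiff₁.continuous).integrable_of_hasCompactSupport
      K.hasCompactSupport₁.smul_left
  have h := K.moment α hα
  rw [Real.iteratedDeriv_fourier (N := ⊤) hint le_top, Real.fourier_eq'] at h
  simp only [inner_zero_right, mul_zero, Complex.ofReal_zero, zero_mul, Complex.exp_zero, mul_pow,
    smul_eq_mul] at h
  have h2 : ∫ v : ℝ, ((-2 : ℂ) ^ α * (Real.pi : ℂ) ^ α * Complex.I ^ α) * (K.Ψ₁ v * (v : ℂ) ^ α) = 0 := by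
    rw [← h]
    refine integral_congr_ae (Filter.Eventually.of_forall fun v => ?_)
    ring
  rw [integral_const_mul] at h2
  refine (mul_eq_zero.1 h2).resolve_left ?_
  have : (Real.pi : ℂ) ≠ 0 := by exact_mod_cast Real.pi_ne_zero
  simp [this]

/-- A bound for the `L_1` norms of the kernels. -/
def mass : ℝ := (∫ t, ‖K.Ψ₀ t‖) + ∫ t, ‖K.Ψ₁ t‖

theorem mass_nonneg : 0 ≤ K.mass := by
  unfold mass
  positivity

theorem integrable_dilate (j : ℕ) : Integrable (K.dilate j) :=
  (K.contDiff_dilate j).continuous.integrable_of_hasCompactSupport (K.hasCompactSupport_dilate j)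

theorem integral_norm_dilate_le (j : ℕ) : ∫ t, ‖K.dilate j t‖ ≤ K.mass := by
  cases j with
  | zero => exact le_add_of_nonneg_right (by positivity)
  | succ j =>
    refine le_trans (le_of_eq ?_) (le_add_of_nonneg_left (by positivity))
    have h := Measure.integral_comp_mul_left (fun t => ‖K.Ψ₁ t‖) ((2 : ℝ) ^ j)
    simp only [dilate, norm_mul, norm_pow, Complex.norm_ofNat]
    rw [integral_const_mul, h, abs_of_pos (by positivity), smul_eq_mul,
      mul_inv_cancel_left₀ (by positivity)]

/-- The local mean `Ψ_j * b(2^l · - k)`. -/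
def bumpMean (j l k : ℕ) (t : ℝ) : ℂ := ∫ y, K.dilate j (t - y) * (bump (2 ^ l * y - k) : ℂ)

theorem bumpMean_eq (j l k : ℕ) (t : ℝ) :
    K.bumpMean j l k t = ∫ z, K.dilate j z * (bump (2 ^ l * (t - z) - k) : ℂ) := by
  rw [bumpMean, ← integral_sub_left_eq_self _ volume t]
  simp only [sub_sub_cancel]

theorem continuous_bump_comp (l k : ℕ) (t : ℝ) :
    Continuous fun z : ℝ => (bump (2 ^ l * (t - z) - k) : ℂ) :=
  Complex.continuous_ofReal.comp (contDiff_bump.continuous.comp (by fun_prop))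

theorem sum_norm_bumpMean_le_mass (j l : ℕ) (F : Finset ℕ) (t : ℝ) :
    ∑ k ∈ F, ‖K.bumpMean j l k t‖ ≤ K.mass := by
  have hint : ∀ k : ℕ, Integrable fun z => ‖K.dilate j z * (bump (2 ^ l * (t - z) - k) : ℂ)‖ :=
    fun k => (((K.contDiff_dilate j).continuous.mul
      (continuous_bump_comp l k t)).integrable_of_hasCompactSupport
        (K.hasCompactSupport_dilate j).mul_right).norm
  calc ∑ k ∈ F, ‖K.bumpMean j l k t‖
      ≤ ∑ k ∈ F, ∫ z, ‖K.dilate j z * (bump (2 ^ l * (t - z) - k) : ℂ)‖ :=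
        Finset.sum_le_sum fun k _ => by
          rw [bumpMean_eq]
          exact norm_integral_le_integral_norm _
    _ = ∫ z, ∑ k ∈ F, ‖K.dilate j z * (bump (2 ^ l * (t - z) - k) : ℂ)‖ :=
        (integral_finsetSum _ fun k _ => hint k).symm
    _ ≤ ∫ z, ‖K.dilate j z‖ := by
        refine integral_mono (integrable_finsetSum _ fun k _ => hint k) (K.integrable_dilate j).norm
          fun z => ?_
        simp only [norm_mul, ← Finset.mul_sum, Complex.norm_real, Real.norm_eq_abs,
          abs_of_nonneg (bump_nonneg _)]
        exact mul_le_of_le_one_right (norm_nonneg _) (sum_bump_le_one F _)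
    _ ≤ K.mass := K.integral_norm_dilate_le j

theorem exists_norm_bumpMean_le : ∃ C : ℝ, 0 ≤ C ∧ ∀ (j l k : ℕ) (t : ℝ),
    ‖K.bumpMean (j + 1) l k t‖ ≤ C * (2 ^ l / 2 ^ j) ^ (L + 1) := by
  have hcont : Continuous (iteratedDeriv (L + 1) bump) :=
    contDiff_bump.continuous_iteratedDeriv _ (by exact_mod_cast le_top)
  obtain ⟨B, hB⟩ := hcont.bounded_above_of_compact_support
    (by
      have := hasCompactSupport_bump.iteratedFDeriv (𝕜 := ℝ) (L + 1)
      refine this.comp_left (g := fun A => A fun _ => 1) rfl)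
  have hB0 : 0 ≤ B := (norm_nonneg _).trans (hB 0)
  refine ⟨B * K.radius ^ (L + 1) * ∫ v, ‖K.Ψ₁ v‖, by
    have := K.radius_pos; positivity, fun j l k t => ?_⟩
  set h : ℝ := 2 ^ l / 2 ^ j with hh
  have hh0 : 0 < h := by positivity
  set a : ℝ := 2 ^ l * t - k with ha
  have hsub : K.bumpMean (j + 1) l k t = ∫ v, K.Ψ₁ v * (bump (a + -h * v) : ℂ) := by
    have h1 := Measure.integral_comp_mul_left (fun v => K.Ψ₁ v * (bump (a + -h * v) : ℂ)) ((2 : ℝ) ^ j)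
    rw [bumpMean_eq]
    have h2 : ∀ z : ℝ, K.dilate (j + 1) z * (bump (2 ^ l * (t - z) - k) : ℂ) =
        2 ^ j * (K.Ψ₁ (2 ^ j * z) * (bump (a + -h * (2 ^ j * z)) : ℂ)) := fun z => by
      have h3 : a + -h * (2 ^ j * z) = 2 ^ l * (t - z) - k := by
        rw [ha, hh]; field_simp; ring
      rw [h3, dilate, mul_assoc]
    simp only [h2]
    rw [integral_const_mul, h1, abs_of_pos (by positivity), Complex.real_smul]
    push_cast
    rw [mul_inv_cancel_left₀ (pow_ne_zero _ two_ne_zero)]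
  obtain ⟨c, hc⟩ := exists_taylor_coeff (L + 1) contDiff_bump (B := B) hB a
  have hcs : ∀ g : ℝ → ℂ, Continuous g → Integrable fun v => K.Ψ₁ v * g v := fun g hg =>
    (K.contDiff₁.continuous.mul hg).integrable_of_hasCompactSupport K.hasCompactSupport₁.mul_right
  have hpoly : ∫ v, K.Ψ₁ v * ((∑ α ∈ Finset.range (L + 1), c α * (-h * v) ^ α : ℝ) : ℂ) = 0 := by
    have h1 : ∀ v : ℝ, K.Ψ₁ v * ((∑ α ∈ Finset.range (L + 1), c α * (-h * v) ^ α : ℝ) : ℂ) =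
        ∑ α ∈ Finset.range (L + 1), ((c α * (-h) ^ α : ℝ) : ℂ) * (K.Ψ₁ v * (v : ℂ) ^ α) := fun v => by
      push_cast
      rw [Finset.mul_sum]
      refine Finset.sum_congr rfl fun α _ => ?_
      ring
    simp only [h1]
    rw [integral_finsetSum _ fun α _ => (hcs _ (by fun_prop)).const_mul _]
    refine Finset.sum_eq_zero fun α hα => ?_
    rw [integral_const_mul, K.integral_Ψ₁_mul_pow (by have := Finset.mem_range.1 hα; omega), mul_zero]
  have hc1 : Continuous fun v : ℝ => (bump (a + -h * v) : ℂ) :=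
    Complex.continuous_ofReal.comp (contDiff_bump.continuous.comp (by fun_prop))
  have hc2 : Continuous fun v : ℝ =>
      ((∑ α ∈ Finset.range (L + 1), c α * (-h * v) ^ α : ℝ) : ℂ) :=
    Complex.continuous_ofReal.comp (by fun_prop)
  rw [hsub, ← sub_zero (∫ v, _), ← hpoly, ← integral_sub (hcs _ hc1) (hcs _ hc2)]
  calc _ ≤ ∫ v, B * (h * K.radius) ^ (L + 1) * ‖K.Ψ₁ v‖ := by
        refine norm_integral_le_of_norm_le ((K.contDiff₁.continuous.integrable_of_hasCompactSupport
          K.hasCompactSupport₁).norm.const_mul _) (Filter.Eventually.of_forall fun v => ?_)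
        rw [← mul_sub, norm_mul, ← Complex.ofReal_sub, Complex.norm_real, Real.norm_eq_abs, mul_comm]
        by_cases hv : K.Ψ₁ v = 0
        · simp [hv]
        · have hv' : |v| ≤ K.radius := K.abs_le_radius (j := 1) (by simpa [dilate] using hv)
          refine mul_le_mul_of_nonneg_right ((hc (-h * v)).trans ?_) (norm_nonneg _)
          rw [abs_mul, abs_neg, abs_of_pos hh0]
          gcongr
    _ = _ := by
        rw [integral_const_mul]
        ring

theorem exists_sum_enorm_bumpMean_le : ∃ C : ℝ≥0∞, C ≠ ⊤ ∧ ∀ (j l : ℕ) (F : Finset ℕ) (t : ℝ),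
    ∑ k ∈ F, ‖K.bumpMean j l k t‖ₑ ≤ C * (2 ^ ((L + 1) * (j - l)))⁻¹ := by
  obtain ⟨C, hC0, hC⟩ := K.exists_norm_bumpMean_le
  have hr := K.radius_pos
  suffices h : ∃ C : ℝ, 0 ≤ C ∧ ∀ (j l : ℕ) (F : Finset ℕ) (t : ℝ),
      ∑ k ∈ F, ‖K.bumpMean j l k t‖ ≤ C * (2 ^ ((L + 1) * (j - l)))⁻¹ by
    obtain ⟨C, hC0, hC⟩ := h
    refine ⟨ENNReal.ofReal C, ENNReal.ofReal_ne_top, fun j l F t => ?_⟩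
    simp only [← ofReal_norm]
    rw [← ENNReal.ofReal_sum_of_nonneg fun _ _ => norm_nonneg _]
    refine (ENNReal.ofReal_le_ofReal (hC j l F t)).trans (le_of_eq ?_)
    rw [ENNReal.ofReal_mul hC0, ENNReal.ofReal_inv_of_pos (by positivity),
      ENNReal.ofReal_pow (by norm_num), ENNReal.ofReal_ofNat]
  refine ⟨max K.mass ((2 * K.radius + 2) * C * 2 ^ (L + 1)), le_max_of_le_left K.mass_nonneg,
    fun j l F t => ?_⟩
  rcases le_or_gt j l with hjl | hjl
  · rw [Nat.sub_eq_zero_of_le hjl]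
    simpa using Or.inl (K.sum_norm_bumpMean_le_mass j l F t)
  obtain ⟨j, rfl⟩ : ∃ i, j = i + 1 := ⟨j - 1, by omega⟩
  have hjl' : l ≤ j := by omega
  have hh : (2 : ℝ) ^ l / 2 ^ j ≤ 1 := by
    rw [div_le_one (by positivity)]
    exact pow_le_pow_right₀ (by norm_num) hjl'
  have hpow : ((2 : ℝ) ^ l / 2 ^ j) ^ (L + 1) = 2 ^ (L + 1) * (2 ^ ((L + 1) * (j + 1 - l)))⁻¹ := by
    obtain ⟨i, rfl⟩ := Nat.exists_eq_add_of_le hjl'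
    have hbase : (2 : ℝ) ^ l / 2 ^ (l + i) = 2 * (2 ^ (i + 1))⁻¹ := by
      rw [pow_add, pow_succ]
      field_simp
    rw [show l + i + 1 - l = i + 1 by omega, hbase, mul_pow, inv_pow, ← pow_mul, mul_comm (i + 1)]
  set F' := F.filter fun k => K.bumpMean (j + 1) l k t ≠ 0
  have hcard : (F'.card : ℝ) ≤ 2 * K.radius + 2 := by
    have hmem : ∀ k ∈ F', (k : ℤ) ∈ Finset.Icc ⌈2 ^ l * t - 1 - K.radius⌉ ⌊2 ^ l * t + K.radius⌋ :=
      fun k hk => by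
        have hne := (Finset.mem_filter.1 hk).2
        rw [bumpMean_eq] at hne
        obtain ⟨z, hz⟩ : ∃ z, K.dilate (j + 1) z * (bump (2 ^ l * (t - z) - k) : ℂ) ≠ 0 := by
          by_contra! h
          exact hne (by simp [h])
        have h1 : |2 ^ j * z| ≤ K.radius := by
          have : K.Ψ₁ (2 ^ j * z) ≠ 0 := right_ne_zero_of_mul (left_ne_zero_of_mul hz)
          exact K.abs_le_radius (j := 1) (by simpa [dilate] using this)
        have h2 : |2 ^ l * z| ≤ K.radius := by
          refine le_trans ?_ h1
          have h2 : (2 : ℝ) ^ l ≤ 2 ^ j := pow_le_pow_right₀ (by norm_num) hjl'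
          rw [abs_mul, abs_mul, abs_of_pos (by positivity : (0 : ℝ) < 2 ^ l),
            abs_of_pos (by positivity : (0 : ℝ) < 2 ^ j)]
          gcongr
        have h3 := mem_Ioo_of_bump_ne_zero (t := 2 ^ l * (t - z) - k) (by exact_mod_cast right_ne_zero_of_mul hz)
        have h4 := abs_le.1 h2
        rw [mul_sub] at h3
        refine Finset.mem_Icc.2 ⟨Int.ceil_le.2 ?_, Int.le_floor.2 ?_⟩
        · push_cast; linarith [h3.2, h4.2]
        · push_cast; linarith [h3.1, h4.1]
    have h5 : F'.card ≤ (Finset.Icc ⌈2 ^ l * t - 1 - K.radius⌉ ⌊2 ^ l * t + K.radius⌋).card :=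
      Finset.card_le_card_of_injOn (fun k : ℕ => (k : ℤ)) hmem fun a _ b _ h => by simpa using h
    rw [Int.card_Icc] at h5
    have h6 : ((⌊2 ^ l * t + K.radius⌋ + 1 - ⌈2 ^ l * t - 1 - K.radius⌉ : ℤ) : ℝ) ≤
        2 * K.radius + 2 := by
      push_cast
      linarith [Int.floor_le (2 ^ l * t + K.radius), Int.le_ceil (2 ^ l * t - 1 - K.radius)]
    have h7 : (F'.card : ℝ) ≤
        ((⌊2 ^ l * t + K.radius⌋ + 1 - ⌈2 ^ l * t - 1 - K.radius⌉).toNat : ℝ) := by exact_mod_cast h5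
    refine h7.trans ?_
    rcases le_total 0 (⌊2 ^ l * t + K.radius⌋ + 1 - ⌈2 ^ l * t - 1 - K.radius⌉) with h8 | h8
    · have h9 : (((⌊2 ^ l * t + K.radius⌋ + 1 - ⌈2 ^ l * t - 1 - K.radius⌉).toNat : ℤ) : ℝ) =
        ((⌊2 ^ l * t + K.radius⌋ + 1 - ⌈2 ^ l * t - 1 - K.radius⌉ : ℤ) : ℝ) := by
        rw [Int.toNat_of_nonneg h8]
      rw [Int.cast_natCast] at h9
      rw [h9]
      exact h6
    · rw [Int.toNat_of_nonpos h8]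
      simp only [Nat.cast_zero]
      positivity
  calc ∑ k ∈ F, ‖K.bumpMean (j + 1) l k t‖ = ∑ k ∈ F', ‖K.bumpMean (j + 1) l k t‖ := by
        rw [Finset.sum_filter]
        refine Finset.sum_congr rfl fun k _ => ?_
        by_cases hk : K.bumpMean (j + 1) l k t = 0 <;> simp [hk]
    _ ≤ F'.card • (C * (2 ^ l / 2 ^ j) ^ (L + 1)) := Finset.sum_le_card_nsmul _ _ _ fun k _ => hC j l k t
    _ ≤ (2 * K.radius + 2) * (C * (2 ^ (L + 1) * (2 ^ ((L + 1) * (j + 1 - l)))⁻¹)) := by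
        rw [nsmul_eq_mul, hpow]
        gcongr
    _ = ((2 * K.radius + 2) * C * 2 ^ (L + 1)) * (2 ^ ((L + 1) * (j + 1 - l)))⁻¹ := by ring
    _ ≤ _ := by
        gcongr
        exact le_max_right _ _

end LocalMeanKernel

/-! ### Norms of sums over one level -/

theorem seqNorm_le_rpow {ι : Type*} {θ : ℝ≥0∞} (hθ : 1 ≤ θ) {a : ι → ℝ≥0∞} {B T : ℝ≥0∞}
    (hB : ∀ i, a i ≤ B) (hT : ∑' i, a i ≤ T) :
    seqNorm θ a ≤ B ^ (1 - (1 / θ).toReal) * T ^ (1 / θ).toReal := by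
  rw [seqNorm]
  split_ifs with h
  · simpa [h] using hB
  · have hθ1 : 1 ≤ θ.toReal := by
      rw [← ENNReal.toReal_one]
      exact ENNReal.toReal_mono h hθ
    have h0 : 0 < θ.toReal := by linarith
    rw [one_div_toReal]
    have h1 : ∑' i, a i ^ θ.toReal ≤ B ^ (θ.toReal - 1) * T := by
      refine le_trans ?_ (mul_le_mul_right hT _)
      rw [← ENNReal.tsum_mul_left]
      refine ENNReal.tsum_le_tsum fun i => ?_
      calc a i ^ θ.toReal = a i ^ (θ.toReal - 1) * a i := by
            nth_rw 3 [← ENNReal.rpow_one (a i)]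
            rw [← ENNReal.rpow_add_of_nonneg _ _ (by linarith) zero_le_one, sub_add_cancel]
        _ ≤ _ := by
            gcongr
            exact hB i
    refine (ENNReal.rpow_le_rpow h1 (by positivity)).trans (le_of_eq ?_)
    rw [ENNReal.mul_rpow_of_nonneg _ _ (by positivity), ← ENNReal.rpow_mul]
    congr 2
    field_simp

/-- The decay of the local means of frequency `2^m` of bumps of side lengths `2^{-l}`, `|l|₁ = M`. -/
def levelDecay {d : ℕ} (L M : ℕ) (m : Fin d → ℕ) : ℝ≥0∞ :=
  ∑ l ∈ level d M, ∏ i, (2 ^ ((L + 1) * (m i - l i)) : ℝ≥0∞)⁻¹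

theorem weight_eq_prod {d : ℕ} (s : ℝ) (m : Fin d → ℕ) :
    weight s m = ∏ i, (2 : ℝ≥0∞) ^ (s * m i) := by
  rw [weight, ← ENNReal.ofReal_ofNat, ENNReal.ofReal_rpow_of_pos two_pos, Nat.cast_sum,
    Finset.mul_sum, Real.rpow_sum_of_pos two_pos, ENNReal.ofReal_prod_of_nonneg fun _ _ => by positivity]
  exact Finset.prod_congr rfl fun i _ => (ENNReal.ofReal_rpow_of_pos two_pos).symm

theorem exists_two_rpow_mul_le {L : ℕ} {s : ℝ} (hs : 0 < s) (hL : s < (L : ℝ) + 1) :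
    ∃ e : ℤ → ℝ≥0∞, ∑' z, e z ≠ ⊤ ∧ ∀ j l : ℕ,
      (2 : ℝ≥0∞) ^ (s * j) * (2 ^ ((L + 1) * (j - l)))⁻¹ ≤ (2 : ℝ≥0∞) ^ (s * l) * e (j - l) := by
  set η := min s (L + 1 - s) with hη
  have hη0 : 0 < η := lt_min hs (by linarith)
  set r : ℝ := 2 ^ (-η) with hr
  have hr0 : 0 < r := by positivity
  have hr1 : r < 1 := Real.rpow_lt_one_of_one_lt_of_neg one_lt_two (neg_lt_zero.2 hη0)
  have hgeom := summable_geometric_of_lt_one hr0.le hr1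
  have hsum : Summable fun z : ℤ => r ^ z.natAbs :=
    Summable.of_nat_of_neg (by simpa using hgeom) (by simpa using hgeom)
  refine ⟨fun z => ENNReal.ofReal (r ^ z.natAbs), hsum.tsum_ofReal_ne_top, fun j l => ?_⟩
  rw [← ENNReal.ofReal_ofNat, ENNReal.ofReal_rpow_of_pos two_pos, ENNReal.ofReal_rpow_of_pos two_pos,
    ← ENNReal.ofReal_pow two_pos.le, ← ENNReal.ofReal_inv_of_pos (by positivity),
    ← ENNReal.ofReal_mul (by positivity), ← ENNReal.ofReal_mul (by positivity)]
  refine ENNReal.ofReal_le_ofReal ?_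
  rw [hr, ← Real.rpow_natCast, ← Real.rpow_natCast, ← Real.rpow_neg two_pos.le,
    ← Real.rpow_mul two_pos.le, ← Real.rpow_add two_pos, ← Real.rpow_add two_pos]
  refine Real.rpow_le_rpow_of_exponent_le one_le_two ?_
  rcases le_total l j with h | h
  · obtain ⟨i, rfl⟩ := Nat.exists_eq_add_of_le h
    have h1 : ((l + i : ℕ) : ℤ) - (l : ℤ) = (i : ℕ) := by push_cast; ring
    rw [h1, Int.natAbs_natCast, Nat.add_sub_cancel_left]
    push_cast
    have h2 : η * i ≤ (L + 1 - s) * i := by gcongr; exact min_le_right _ _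
    linarith
  · obtain ⟨i, rfl⟩ := Nat.exists_eq_add_of_le h
    have h1 : (j : ℤ) - ((j + i : ℕ) : ℤ) = -(i : ℕ) := by push_cast; ring
    rw [h1, Int.natAbs_neg, Int.natAbs_natCast, Nat.sub_eq_zero_of_le h]
    push_cast
    have h2 : η * i ≤ s * i := by gcongr; exact min_le_left _ _
    linarith

theorem exists_seqNorm_levelDecay_le (d : ℕ) {L : ℕ} {s : ℝ} (hs : 0 < s) (hL : s < (L : ℝ) + 1)
    {θ : ℝ≥0∞} (hθ : 1 ≤ θ) : ∃ C : ℝ≥0∞, C ≠ ⊤ ∧ ∀ M : ℕ,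
      (seqNorm θ fun m : Fin d → ℕ => weight s m * levelDecay L M m) ≤
        C * (2 : ℝ≥0∞) ^ (s * M) * ((level d M).card : ℝ≥0∞) ^ (1 / θ).toReal := by
  obtain ⟨e, he, hle⟩ := exists_two_rpow_mul_le (L := L) hs hL
  set S := (∑' z, e z) ^ d with hS
  refine ⟨S, ENNReal.pow_ne_top he, fun M => ?_⟩
  have hz : ∑' z : Fin d → ℤ, ∏ i, e (z i) ≤ S := tsum_pi_prod_le d e
  have hsumm : ∀ l : Fin d → ℕ, ∑' m : Fin d → ℕ, ∏ i, e (m i - l i) ≤ S := fun l =>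
    (ENNReal.tsum_comp_le_tsum_of_injective (f := fun (m : Fin d → ℕ) i => (m i : ℤ) - l i)
      (fun m m' h => funext fun i => by have := congrFun h i; simp only at this; omega)
      fun z => ∏ i, e (z i)).trans hz
  have hsuml : ∀ m : Fin d → ℕ, ∑ l ∈ level d M, ∏ i, e (m i - l i) ≤ S := fun m =>
    (ENNReal.sum_le_tsum (f := fun l : Fin d → ℕ => ∏ i, e (m i - l i)) _).trans
      ((ENNReal.tsum_comp_le_tsum_of_injective (f := fun (l : Fin d → ℕ) i => (m i : ℤ) - l i)
      (fun m m' h => funext fun i => by have := congrFun h i; simp only at this; omega)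
      fun z => ∏ i, e (z i)).trans hz)
  have hpt : ∀ m : Fin d → ℕ, weight s m * levelDecay L M m ≤
      (2 : ℝ≥0∞) ^ (s * M) * ∑ l ∈ level d M, ∏ i, e (m i - l i) := fun m => by
    rw [levelDecay, Finset.mul_sum, Finset.mul_sum]
    refine Finset.sum_le_sum fun l hl => ?_
    have hwl : (2 : ℝ≥0∞) ^ (s * M) = weight s l := by rw [weight, mem_level.1 hl]
    rw [hwl, weight_eq_prod, weight_eq_prod, ← Finset.prod_mul_distrib, ← Finset.prod_mul_distrib]
    exact Finset.prod_le_prod' fun i _ => hle (m i) (l i)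
  have h1 := seqNorm_le_rpow hθ (a := fun m : Fin d → ℕ => weight s m * levelDecay L M m)
    (B := (2 : ℝ≥0∞) ^ (s * M) * S) (T := (2 : ℝ≥0∞) ^ (s * M) * ((level d M).card * S))
    (fun m => (hpt m).trans (by gcongr; exact hsuml m)) (by
      refine (ENNReal.tsum_le_tsum hpt).trans ?_
      rw [ENNReal.tsum_mul_left]
      gcongr
      rw [Summable.tsum_finsetSum fun _ _ => ENNReal.summable, ← nsmul_eq_mul]
      exact Finset.sum_le_card_nsmul _ _ _ fun l _ => hsumm l)
  refine h1.trans (le_of_eq ?_)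
  have ht1 := one_div_toReal_le_one hθ
  have ht0 : 0 ≤ (1 / θ).toReal := ENNReal.toReal_nonneg
  set τ := (1 / θ).toReal
  have h2 : (2 : ℝ≥0∞) ^ (s * M) * ((level d M).card * S) =
      ((2 : ℝ≥0∞) ^ (s * M) * S) * (level d M).card := by ring
  rw [h2, ENNReal.mul_rpow_of_nonneg _ _ ht0, ← mul_assoc,
    ← ENNReal.rpow_add_of_nonneg _ _ (by linarith) ht0, sub_add_cancel, ENNReal.rpow_one,
    mul_comm S]

/-! ### Fooling functions -/

/-- The tensor product bump on the dyadic box with index `(l, k)`. -/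
def bumpTensor {d : ℕ} (l k : Fin d → ℕ) (x : Pt d) : ℂ := ∏ i, (bump (2 ^ l i * x i - k i) : ℂ)

/-- The indices of the dyadic boxes of shape `l` in the unit cube. -/
def boxIndex {d : ℕ} (l : Fin d → ℕ) : Finset (Fin d → ℕ) :=
  Fintype.piFinset fun i => Finset.range (2 ^ l i)

theorem card_boxIndex {d : ℕ} (l : Fin d → ℕ) : (boxIndex l).card = 2 ^ ∑ i, l i := by
  rw [boxIndex, Fintype.card_piFinset]
  simp only [Finset.card_range]
  exact Finset.prod_pow_eq_pow_sum _ _ _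

/-- A linear combination of bumps on dyadic boxes of volume `2^{-M}`. -/
def fooling {d : ℕ} (c : ℝ) (M : ℕ) (G : (Fin d → ℕ) → Finset (Fin d → ℕ)) (x : Pt d) : ℂ :=
  c * ∑ l ∈ level d M, ∑ k ∈ G l, bumpTensor l k x

section Fooling

variable {d : ℕ}

theorem contDiff_bumpTensor (l k : Fin d → ℕ) : ContDiff ℝ ∞ (bumpTensor l k) := by
  refine contDiff_prod fun i _ => Complex.ofRealCLM.contDiff.comp (contDiff_bump.comp ?_)
  fun_prop

theorem mem_Ioo_of_bumpTensor_ne_zero {l k : Fin d → ℕ} {x : Pt d} (h : bumpTensor l k x ≠ 0)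
    (i : Fin d) : 2 ^ l i * x i - k i ∈ Set.Ioo (0 : ℝ) 1 :=
  mem_Ioo_of_bump_ne_zero
    (Complex.ofReal_ne_zero.1 (Finset.prod_ne_zero_iff.1 h i (Finset.mem_univ i)))

theorem mem_unitCube_of_bumpTensor_ne_zero {l k : Fin d → ℕ} (hk : k ∈ boxIndex l) {x : Pt d}
    (h : bumpTensor l k x ≠ 0) : x ∈ unitCube d := fun i => by
  have h1 := mem_Ioo_of_bumpTensor_ne_zero h i
  have h2 : k i < 2 ^ l i := Finset.mem_range.1 (Fintype.mem_piFinset.1 hk i)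
  have h3 : (k i : ℝ) + 1 ≤ 2 ^ l i := by exact_mod_cast h2
  have h4 : (0 : ℝ) < 2 ^ l i := by positivity
  have h5 : (0 : ℝ) ≤ k i := Nat.cast_nonneg _
  constructor
  · by_contra! h
    nlinarith [h1.1]
  · by_contra! h
    nlinarith [h1.2]

theorem hasCompactSupport_of_unitCube {f : Pt d → ℂ} (h : ∀ x, f x ≠ 0 → x ∈ unitCube d) :
    HasCompactSupport f :=
  DualKernel.hasCompactSupport_of_bigCube fun x hx => unitCube_subset_bigCube d (h x hx)

variable {c : ℝ} {M : ℕ} {G : (Fin d → ℕ) → Finset (Fin d → ℕ)}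

theorem contDiff_fooling : ContDiff ℝ ∞ (fooling c M G) :=
  contDiff_const.mul (ContDiff.sum fun l _ => ContDiff.sum fun k _ => contDiff_bumpTensor l k)

theorem mem_unitCube_of_fooling_ne_zero (hG : ∀ l, G l ⊆ boxIndex l) (x : Pt d)
    (h : fooling c M G x ≠ 0) : x ∈ unitCube d := by
  obtain ⟨l, -, hl⟩ := Finset.exists_ne_zero_of_sum_ne_zero (right_ne_zero_of_mul h)
  obtain ⟨k, hk, hne⟩ := Finset.exists_ne_zero_of_sum_ne_zero hl
  exact mem_unitCube_of_bumpTensor_ne_zero (hG l hk) hne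

theorem integrable_bumpTensor {l k : Fin d → ℕ} (hk : k ∈ boxIndex l) :
    Integrable (bumpTensor l k) :=
  (contDiff_bumpTensor l k).continuous.integrable_of_hasCompactSupport
    (hasCompactSupport_of_unitCube fun _ h => mem_unitCube_of_bumpTensor_ne_zero hk h)

theorem integral_bumpTensor (l k : Fin d → ℕ) :
    ∫ x, bumpTensor l k x = ((((2 : ℝ) ^ ∑ i, l i)⁻¹ * (∫ t, bump t) ^ d : ℝ) : ℂ) := by
  have h1 : ∀ i, ∫ t : ℝ, (bump (2 ^ l i * t - k i) : ℂ) = ((((2 : ℝ) ^ l i)⁻¹ * ∫ t, bump t : ℝ) : ℂ) :=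
    fun i => by
      rw [integral_complex_ofReal]
      congr 1
      have h2 := Measure.integral_comp_mul_left (fun t => bump (t - k i)) ((2 : ℝ) ^ l i)
      rw [h2, abs_of_pos (by positivity), smul_eq_mul, integral_sub_right_eq_self]
  have h3 := integral_prod_coord (𝕜 := ℂ) fun (i : Fin d) t => (bump (2 ^ l i * t - k i) : ℂ)
  refine Eq.trans h3 ?_
  simp only [h1]
  rw [← Complex.ofReal_prod, Finset.prod_mul_distrib, Finset.prod_inv_distrib,
    Finset.prod_pow_eq_pow_sum]
  simp

theorem integral_fooling (hG : ∀ l, G l ⊆ boxIndex l) : ∫ x, fooling c M G x =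
    ((c * ∑ l ∈ level d M, (G l).card * (((2 : ℝ) ^ M)⁻¹ * (∫ t, bump t) ^ d) : ℝ) : ℂ) := by
  simp only [fooling]
  rw [integral_const_mul, integral_finsetSum _ fun l _ => integrable_finsetSum _ fun k hk =>
    integrable_bumpTensor (hG l hk)]
  push_cast
  congr 1
  refine Finset.sum_congr rfl fun l hl => ?_
  rw [integral_finsetSum _ fun k hk => integrable_bumpTensor (hG l hk)]
  simp only [integral_bumpTensor, mem_level.1 hl]
  rw [Finset.sum_const, nsmul_eq_mul]
  push_cast
  rfl

theorem LocalMeanKernel.mean_bumpTensor {L : ℕ} (K : LocalMeanKernel L) (m l k : Fin d → ℕ)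
    (x : Pt d) : ∫ y, K.reflected m x y * bumpTensor l k y =
      ∏ i, K.bumpMean (m i) (l i) (k i) (x i) := by
  have h := integral_prod_coord (𝕜 := ℂ) fun (i : Fin d) t =>
    K.dilate (m i) (x i - t) * (bump (2 ^ l i * t - k i) : ℂ)
  refine Eq.trans ?_ h
  refine integral_congr_ae (Filter.Eventually.of_forall fun y => ?_)
  exact Finset.prod_mul_distrib.symm

/-- The local means of the fooling functions. -/
theorem LocalMeanKernel.exists_enorm_mean_fooling_le {L : ℕ} (K : LocalMeanKernel L) (d : ℕ) :
    ∃ C : ℝ≥0∞, C ≠ ⊤ ∧ ∀ (c : ℝ) (M : ℕ) (G : (Fin d → ℕ) → Finset (Fin d → ℕ)),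
      (∀ l, G l ⊆ boxIndex l) → ∀ (m : Fin d → ℕ) (x : Pt d),
        ‖K.mean m (fooling c M G) x‖ₑ ≤ ‖c‖ₑ * C * levelDecay L M m := by
  obtain ⟨C, hC, h⟩ := K.exists_sum_enorm_bumpMean_le
  refine ⟨C ^ d, ENNReal.pow_ne_top hC, fun c M G hG m x => ?_⟩
  have hint : ∀ l, ∀ k ∈ G l, Integrable fun y => K.reflected m x y * bumpTensor l k y :=
    fun l k _ => ((K.contDiff_reflected m x).continuous.mul
      (contDiff_bumpTensor l k).continuous).integrable_of_hasCompactSupport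
        (K.hasCompactSupport_reflected m x).mul_right
  have h1 : K.mean m (fooling c M G) x = c * ∑ l ∈ level d M, ∑ k ∈ G l,
      ∏ i, K.bumpMean (m i) (l i) (k i) (x i) := by
    simp only [LocalMeanKernel.mean, fooling, mul_left_comm _ (c : ℂ), Finset.mul_sum]
    simp only [← Finset.mul_sum]
    rw [integral_const_mul]
    simp only [Finset.mul_sum]
    rw [integral_finsetSum _ fun l _ => integrable_finsetSum _ (hint l)]
    simp only [← Finset.mul_sum]
    congr 1
    refine Finset.sum_congr rfl fun l _ => ?_
    simp only [Finset.mul_sum]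
    rw [integral_finsetSum _ (hint l)]
    exact Finset.sum_congr rfl fun k _ => K.mean_bumpTensor m l k x
  rw [h1, enorm_mul, mul_assoc]
  have hc : ‖(c : ℂ)‖ₑ = ‖c‖ₑ := by
    rw [← ofReal_norm, ← ofReal_norm, Complex.norm_real]
  rw [hc, levelDecay, Finset.mul_sum]
  gcongr
  refine (enorm_sum_le _ _).trans (Finset.sum_le_sum fun l _ => ?_)
  calc ‖∑ k ∈ G l, ∏ i, K.bumpMean (m i) (l i) (k i) (x i)‖ₑ
      ≤ ∑ k ∈ boxIndex l, ∏ i, ‖K.bumpMean (m i) (l i) (k i) (x i)‖ₑ := by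
        refine (enorm_sum_le _ _).trans ?_
        simp only [enorm_prod]
        exact Finset.sum_le_sum_of_subset (hG l)
    _ = ∏ i, ∑ k ∈ Finset.range (2 ^ l i), ‖K.bumpMean (m i) (l i) k (x i)‖ₑ :=
        (Finset.prod_univ_sum (fun i => Finset.range (2 ^ l i))
          fun i k => ‖K.bumpMean (m i) (l i) k (x i)‖ₑ).symm
    _ ≤ ∏ i, C * (2 ^ ((L + 1) * (m i - l i)))⁻¹ :=
        Finset.prod_le_prod' fun i _ => h _ _ _ _
    _ = _ := by
        rw [Finset.prod_mul_distrib]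
        simp

end Fooling

/-! ### Lower bounds -/

theorem seqNorm_mono {ι : Type*} {θ : ℝ≥0∞} {a b : ι → ℝ≥0∞} (h : ∀ i, a i ≤ b i) :
    seqNorm θ a ≤ seqNorm θ b := by
  unfold seqNorm
  split_ifs
  · exact iSup_mono h
  · gcongr with i
    exact h i

theorem seqNorm_const_mul {ι : Type*} {θ : ℝ≥0∞} (hθ : 1 ≤ θ) (c : ℝ≥0∞) (a : ι → ℝ≥0∞) :
    (seqNorm θ fun i => c * a i) = c * seqNorm θ a := by
  unfold seqNorm
  split_ifs with h
  · exact (ENNReal.mul_iSup _ _).symm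
  · have h0 : 0 < θ.toReal := ENNReal.toReal_pos (zero_lt_one.trans_le hθ).ne' h
    simp only [ENNReal.mul_rpow_of_nonneg _ _ h0.le]
    rw [ENNReal.tsum_mul_left, ENNReal.mul_rpow_of_nonneg _ _ (by positivity), ← ENNReal.rpow_mul,
      mul_one_div_cancel h0.ne', ENNReal.rpow_one]

theorem eLpNorm_le_of_support_subset {d : ℕ} {S : Set (Pt d)} {G : Pt d → ℝ≥0∞} (hG : Measurable G)
    (hS : Function.support G ⊆ S) {a : ℝ≥0∞} (ha : ∀ x, G x ≤ a) (p : ℝ≥0∞) :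
    eLpNorm G p volume ≤ volume S ^ (1 / p.toReal) * a := by
  rw [← eLpNorm_restrict_eq_of_support_subset hS]
  refine (eLpNorm_le_eLpNorm_mul_rpow_measure_univ le_top hG.aestronglyMeasurable).trans ?_
  rw [Measure.restrict_apply_univ, ENNReal.toReal_top, div_zero, sub_zero, mul_comm,
    eLpNorm_exponent_top]
  gcongr
  exact eLpNormEssSup_le_of_ae_enorm_bound (Filter.Eventually.of_forall ha)

/-- On distributions supported in the cube, the norm `N` is controlled by uniform bounds for the
local means. -/
def ControlledByMeans {L : ℕ} (K : LocalMeanKernel L) (d : ℕ) (s : ℝ) (θ : ℝ≥0∞)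
    (N : 𝓢'(Pt d, ℂ) → ℝ≥0∞) : Prop :=
  ∃ A : ℝ≥0∞, A ≠ ⊤ ∧ ∀ u : 𝓢'(Pt d, ℂ), Distribution.dsupport u ⊆ unitCube d →
    ∀ a : (Fin d → ℕ) → ℝ≥0∞, (∀ m x, ‖K.localMean u m x‖ₑ ≤ a m) →
      N u ≤ A * seqNorm θ fun m => weight s m * a m

section

variable {L : ℕ} (K : LocalMeanKernel L) (d : ℕ) (s : ℝ) (p : ℝ≥0∞) {θ : ℝ≥0∞}

theorem volume_bigCube_rpow_ne_top (r : ℝ) : volume (bigCube d r) ^ (1 / p.toReal) ≠ ⊤ :=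
  ENNReal.rpow_ne_top_of_nonneg (by positivity) (isCompact_bigCube d _).measure_lt_top.ne

theorem controlledByMeans_besovNorm (hθ : 1 ≤ θ) :
    ControlledByMeans K d s θ (besovNorm K d s p θ) := by
  refine ⟨_, volume_bigCube_rpow_ne_top d p (1 + K.radius), fun u hu a ha => ?_⟩
  rw [← seqNorm_const_mul hθ]
  refine seqNorm_mono fun m => ?_
  rw [mul_left_comm, ← eLpNorm_enorm]
  gcongr
  refine eLpNorm_le_of_support_subset (K.continuous_localMean u m).enorm.measurable
    (fun x hx => K.localMean_ne_zero hu m x fun h => hx ?_) (ha m) p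
  simp [h]

theorem controlledByMeans_triebelLizorkinNorm (hθ : 1 ≤ θ) :
    ControlledByMeans K d s θ (triebelLizorkinNorm K d s p θ) := by
  refine ⟨_, volume_bigCube_rpow_ne_top d p (1 + K.radius), fun u hu a ha => ?_⟩
  refine eLpNorm_le_of_support_subset (measurable_seqNorm θ fun m =>
    (K.continuous_localMean u m).enorm.measurable.const_mul _) (fun x hx => ?_)
    (fun x => seqNorm_mono fun m => mul_le_mul_right (ha m x) _) p
  by_contra h
  have h3 : ∀ m, K.localMean u m x = 0 := fun m => by_contra fun hne =>
    h (K.localMean_ne_zero hu m x hne)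
  refine hx ?_
  have h4 := seqNorm_const_mul hθ 0 fun m : Fin d → ℕ => weight s m
  simp only [zero_mul] at h4
  simp [h3, h4]

end

/-- A smooth function supported in the cube, as a distribution supported in the cube. -/
theorem exists_isContinuousRep_of_contDiff {d : ℕ} {f : Pt d → ℂ} (hf : ContDiff ℝ ∞ f)
    (hs : ∀ x, f x ≠ 0 → x ∈ unitCube d) :
    ∃ u : 𝓢'(Pt d, ℂ), Distribution.dsupport u ⊆ unitCube d ∧ IsContinuousRep u f := by
  have hc : HasCompactSupport f := hasCompactSupport_of_unitCube hs
  let u : 𝓢'(Pt d, ℂ) := SchwartzMap.toTemperedDistributionCLM (Pt d) ℂ volume (hc.toSchwartzMap hf)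
  have hu : ∀ φ : 𝓢(Pt d, ℂ), u φ = ∫ x, f x * φ x := fun φ => by
    refine (SchwartzMap.toTemperedDistributionCLM_apply_apply volume (hc.toSchwartzMap hf) φ).trans ?_
    exact integral_congr_ae (Filter.Eventually.of_forall fun x => mul_comm _ _)
  refine ⟨u, fun x hx => ?_, hf.continuous, fun φ _ => hu φ⟩
  by_contra h
  refine (Distribution.notMem_dsupport_iff x).2 ⟨(unitCube d)ᶜ, fun φ hφ => ?_,
    (isClosed_unitCube d).isOpen_compl, h⟩ hx
  rw [hu]
  have : ∀ x, f x * φ x = 0 := fun x => by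
    by_contra hne
    exact hφ (subset_tsupport _ (right_ne_zero_of_mul hne)) (hs x (left_ne_zero_of_mul hne))
  simp [this]

/-- For every set of `n` points, many of the boxes of a given shape avoid them. -/
theorem card_filter_bumpTensor_eq_zero {d n : ℕ} (l : Fin d → ℕ) (x : Fin n → Pt d) :
    2 ^ ∑ i, l i ≤ ((boxIndex l).filter fun k => ∀ j, bumpTensor l k (x j) = 0).card + n := by
  classical
  rw [← card_boxIndex, ← Finset.card_filter_add_card_filter_not
    (fun k => ∀ j, bumpTensor l k (x j) = 0)]
  gcongr
  have h : ∀ k ∈ (boxIndex l).filter fun k => ¬∀ j, bumpTensor l k (x j) = 0,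
      ∃ j, bumpTensor l k (x j) ≠ 0 := fun k hk => by
    simpa using (Finset.mem_filter.1 hk).2
  rcases Finset.eq_empty_or_nonempty
    ((boxIndex l).filter fun k => ¬∀ j, bumpTensor l k (x j) = 0) with he | ⟨k₀, hk₀⟩
  · rw [he, Finset.card_empty]
    exact Nat.zero_le n
  have : Nonempty (Fin n) := ⟨(h k₀ hk₀).choose⟩
  choose! φ hφ using h
  have hcard := Finset.card_le_card_of_injOn (t := Finset.univ) φ (fun _ _ => Finset.mem_univ _)
    fun k hk k' hk' hkk => funext fun i => by
      have h1 := mem_Ioo_of_bumpTensor_ne_zero (hφ k hk) i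
      have h2 := mem_Ioo_of_bumpTensor_ne_zero (hφ k' hk') i
      rw [hkk] at h1
      have h3 : (k i : ℝ) < k' i + 1 := by linarith [h1.1, h2.2]
      have h4 : (k' i : ℝ) < k i + 1 := by linarith [h1.2, h2.1]
      have h5 : k i < k' i + 1 := by exact_mod_cast h3
      have h6 : k' i < k i + 1 := by exact_mod_cast h4
      omega
  simpa using hcard

theorem exists_rate_le_level {d : ℕ} (hd : 1 ≤ d) {θ : ℝ≥0∞} (hθ : 1 ≤ θ) {s : ℝ} (hs : 0 ≤ s) :
    ∃ C : ℝ, 0 < C ∧ ∀ n M : ℕ, 2 ≤ n → n ≤ 2 ^ M → 2 ^ M ≤ 4 * n →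
      rate d s θ n ≤ ENNReal.ofReal (C * (((2 : ℝ) ^ (s * M))⁻¹ *
        ((level d M).card : ℝ) ^ (1 - (1 / θ).toReal))) := by
  have hτ := one_div_toReal_le_one hθ
  have hd0 : (0 : ℝ) < d := by exact_mod_cast hd
  refine ⟨4 ^ s * ((d : ℝ) ^ (d - 1)) ^ (1 - (1 / θ).toReal), by positivity,
    fun n M hn hnM hMn => ENNReal.ofReal_le_ofReal ?_⟩
  have hn0 : (0 : ℝ) < n := by positivity
  have h1 : (n : ℝ) ^ (-s) ≤ 4 ^ s * ((2 : ℝ) ^ (s * M))⁻¹ := by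
    have h2 : (2 : ℝ) ^ M / 4 ≤ n := by
      rw [div_le_iff₀ (by norm_num), mul_comm]
      exact_mod_cast hMn
    refine (Real.rpow_le_rpow_of_nonpos (by positivity) h2 (neg_nonpos.2 hs)).trans (le_of_eq ?_)
    rw [Real.div_rpow (by positivity) (by norm_num), ← Real.rpow_natCast, ← Real.rpow_mul two_pos.le,
      Real.rpow_neg (by norm_num : (0 : ℝ) ≤ 4), mul_neg, Real.rpow_neg two_pos.le, mul_comm (M : ℝ)]
    field_simp
  have hl0 : 0 ≤ Real.log n := Real.log_natCast_nonneg n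
  have h3 : Real.log n ≤ d * ((M / d : ℕ) + 1) := by
    have h4 : Real.log n ≤ M * Real.log 2 := by
      rw [← Real.log_pow]
      exact Real.log_le_log hn0 (by exact_mod_cast hnM)
    have h5 : Real.log 2 ≤ 1 := by linarith [Real.log_two_lt_d9]
    have h6 : (M : ℝ) ≤ d * ((M / d : ℕ) + 1) := by
      exact_mod_cast (Nat.lt_mul_div_succ M hd).le
    have h7 : (0 : ℝ) ≤ M := Nat.cast_nonneg M
    nlinarith
  have h8 : Real.log n ^ ((d : ℝ) - 1) ≤ (d : ℝ) ^ (d - 1) * (level d M).card := by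
    rw [show ((d : ℝ) - 1) = ((d - 1 : ℕ) : ℝ) by rw [Nat.cast_sub hd]; simp, Real.rpow_natCast]
    calc Real.log n ^ (d - 1) ≤ (d * ((M / d : ℕ) + 1)) ^ (d - 1) := by gcongr
      _ = (d : ℝ) ^ (d - 1) * (((M / d + 1) ^ (d - 1) : ℕ) : ℝ) := by rw [mul_pow]; push_cast; rfl
      _ ≤ _ := by
        gcongr
        exact le_card_level hd M
  rw [Real.rpow_mul hl0]
  calc _ ≤ (4 ^ s * ((2 : ℝ) ^ (s * M))⁻¹) *
        ((d : ℝ) ^ (d - 1) * (level d M).card) ^ (1 - (1 / θ).toReal) := by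
        have : 0 ≤ 1 - (1 / θ).toReal := by linarith
        gcongr
    _ = _ := by
        rw [Real.mul_rpow (by positivity) (by positivity)]
        ring

theorem mul_card_level_le_sum {d M : ℕ} {g : (Fin d → ℕ) → ℕ}
    (hg : ∀ l ∈ level d M, (2 : ℝ) ^ M / 2 ≤ g l) {b : ℝ} (hb : 0 ≤ b) :
    ((level d M).card : ℝ) * b / 2 ≤ ∑ l ∈ level d M, (g l : ℝ) * (((2 : ℝ) ^ M)⁻¹ * b) := by
  have h := Finset.card_nsmul_le_sum (level d M)
    (fun l => (g l : ℝ) * (((2 : ℝ) ^ M)⁻¹ * b)) (b / 2) fun l hl => by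
      calc b / 2 = (2 : ℝ) ^ M / 2 * (((2 : ℝ) ^ M)⁻¹ * b) := by field_simp
        _ ≤ _ := mul_le_mul_of_nonneg_right (hg l hl) (by positivity)
  rw [nsmul_eq_mul] at h
  linarith

theorem inv_mul_rpow_one_sub {a b C κ Λ τ : ℝ} (hΛ : Λ ≠ 0) (ha : a ≠ 0) (hκ : 0 < κ)
    (hb : b ≠ 0) : C * (a⁻¹ * κ ^ (1 - τ)) =
      C * (2 * Λ / b) * ((Λ * (a * κ ^ τ))⁻¹ * (κ * b / 2)) := by
  have h : κ ^ τ ≠ 0 := (Real.rpow_pos_of_pos hκ τ).ne'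
  rw [Real.rpow_sub hκ, Real.rpow_one]
  field_simp

theorem ControlledByMeans.lesssim_rate {L : ℕ} {K : LocalMeanKernel L} {d : ℕ} {s : ℝ}
    {θ : ℝ≥0∞} {N : 𝓢'(Pt d, ℂ) → ℝ≥0∞} (hN : ControlledByMeans K d s θ N) (hd : 1 ≤ d)
    (hθ : 1 ≤ θ) (hs : 0 < s) (hL : s < (L : ℝ) + 1) :
    Lesssim (rate d s θ) (optimalError (unitBall N)) := by
  classical
  obtain ⟨A, hA, hNA⟩ := hN
  obtain ⟨C₁, hC₁, h₁⟩ := exists_seqNorm_levelDecay_le d (L := L) hs hL hθ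
  obtain ⟨C₂, hC₂, h₂⟩ := K.exists_enorm_mean_fooling_le d
  obtain ⟨C₃, hC₃, h₃⟩ := exists_rate_le_level hd hθ hs.le
  set τ := (1 / θ).toReal with hτ
  have hτ0 : 0 ≤ τ := ENNReal.toReal_nonneg
  set Λ : ℝ := (A * C₂ * C₁).toReal + 1 with hΛ
  have hΛ0 : 0 < Λ := by positivity
  have hΛle : A * C₂ * C₁ ≤ ENNReal.ofReal Λ := by
    rw [← ENNReal.ofReal_toReal (a := A * C₂ * C₁) (by finiteness)]
    exact ENNReal.ofReal_le_ofReal (by linarith)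
  have hβ := integral_bump_pos
  set β := ∫ t, bump t
  refine lesssim_of_forall (C := ENNReal.ofReal (C₃ * (2 * Λ / β ^ d))) ENNReal.ofReal_ne_top
    fun n hn => ?_
  set M := Nat.log 2 n + 2 with hM
  have hM1 : 2 * n ≤ 2 ^ M := by
    have := Nat.lt_pow_succ_log_self one_lt_two n
    rw [hM, pow_succ]
    omega
  have hM2 : 2 ^ M ≤ 4 * n := by
    have := Nat.pow_log_le_self 2 (x := n) (by omega)
    rw [hM, pow_add]
    omega
  refine (h₃ n M hn (by omega) hM2).trans ?_
  have hK : ENNReal.ofReal (C₃ * (2 * Λ / β ^ d)) ≠ 0 :=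
    (ENNReal.ofReal_pos.2 (by positivity)).ne'
  rw [optimalError, ENNReal.mul_iInf_of_ne hK ENNReal.ofReal_ne_top]
  refine le_iInf fun x => ?_
  rw [ENNReal.mul_iInf_of_ne hK ENNReal.ofReal_ne_top]
  refine le_iInf fun w => ?_
  set G : (Fin d → ℕ) → Finset (Fin d → ℕ) := fun l =>
    (boxIndex l).filter fun k => ∀ j, bumpTensor l k (x j) = 0 with hG
  have hGsub : ∀ l, G l ⊆ boxIndex l := fun l => Finset.filter_subset _ _
  have hcard0 : 0 < ((level d M).card : ℝ) := by
    have : 0 < (level d M).card := lt_of_lt_of_le (by positivity) (le_card_level hd M)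
    exact_mod_cast this
  set κ := ((level d M).card : ℝ)
  set c : ℝ := (Λ * ((2 : ℝ) ^ (s * M) * κ ^ τ))⁻¹ with hc
  have hc0 : 0 < c := by positivity
  have hsupp := mem_unitCube_of_fooling_ne_zero (c := c) (M := M) hGsub
  obtain ⟨u, hu, hrep⟩ := exists_isContinuousRep_of_contDiff
    (contDiff_fooling (c := c) (M := M) (G := G)) hsupp
  have hNu : N u ≤ 1 := by
    have h4 := hNA u hu (fun m => ‖c‖ₑ * C₂ * levelDecay L M m) fun m y => by
      rw [K.localMean_eq_mean hrep]
      exact h₂ c M G hGsub m y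
    simp only [mul_left_comm (weight s _)] at h4
    rw [seqNorm_const_mul hθ] at h4
    refine h4.trans ?_
    have hce : ‖c‖ₑ = ENNReal.ofReal c := by
      rw [← ofReal_norm, Real.norm_eq_abs, abs_of_pos hc0]
    have hκe : ((level d M).card : ℝ≥0∞) ^ τ = ENNReal.ofReal (κ ^ τ) := by
      rw [← ENNReal.ofReal_rpow_of_pos hcard0, ENNReal.ofReal_natCast]
    have h2e : (2 : ℝ≥0∞) ^ (s * M) = ENNReal.ofReal (2 ^ (s * M)) := by
      rw [← ENNReal.ofReal_rpow_of_pos two_pos, ENNReal.ofReal_ofNat]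
    calc A * (‖c‖ₑ * C₂ * seqNorm θ fun m : Fin d → ℕ => weight s m * levelDecay L M m)
        ≤ A * (‖c‖ₑ * C₂ * (C₁ * (2 : ℝ≥0∞) ^ (s * M) * ((level d M).card : ℝ≥0∞) ^ τ)) := by
          gcongr
          exact h₁ M
      _ = ‖c‖ₑ * (A * C₂ * C₁ * ((2 : ℝ≥0∞) ^ (s * M) * ((level d M).card : ℝ≥0∞) ^ τ)) := by ring
      _ ≤ ENNReal.ofReal c * (ENNReal.ofReal Λ * (ENNReal.ofReal (2 ^ (s * M)) *
          ENNReal.ofReal (κ ^ τ))) := by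
          rw [hce, hκe, h2e]
          gcongr
      _ = 1 := by
          rw [← ENNReal.ofReal_mul (by positivity), ← ENNReal.ofReal_mul (by positivity),
            ← ENNReal.ofReal_mul (by positivity), hc, inv_mul_cancel₀ (by positivity),
            ENNReal.ofReal_one]
  have hmem : fooling c M G ∈ unitBall N :=
    ⟨u, ⟨hNu.trans_lt ENNReal.one_lt_top, hu⟩, hNu, hrep⟩
  have hzero : ∑ i, (w i : ℂ) * fooling c M G (x i) = 0 := by
    refine Finset.sum_eq_zero fun i _ => ?_
    have : fooling c M G (x i) = 0 := by
      rw [fooling, Finset.sum_eq_zero, mul_zero]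
      exact fun l _ => Finset.sum_eq_zero fun k hk => (Finset.mem_filter.1 hk).2 i
    rw [this, mul_zero]
  have hworst : ‖∫ x in unitCube d, fooling c M G x‖ₑ ≤
      worstCaseError (fun f => ∑ i, (w i : ℂ) * f (x i)) (unitBall N) := by
    have := le_iSup₂ (f := fun f (_ : f ∈ unitBall N) =>
      ‖(∫ x in unitCube d, f x) - ∑ i, (w i : ℂ) * f (x i)‖ₑ) (fooling c M G) hmem
    simp only [hzero, sub_zero] at this
    exact this
  refine le_trans ?_ (mul_le_mul_right hworst _)
  have hG2 : ∀ l ∈ level d M, (2 : ℝ) ^ M / 2 ≤ (G l).card := fun l hl => by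
    have h5 := card_filter_bumpTensor_eq_zero l fun j => (x j : Pt d)
    rw [mem_level.1 hl] at h5
    change 2 ^ M ≤ (G l).card + n at h5
    have h6 : 2 ^ M ≤ 2 * (G l).card := by omega
    rw [div_le_iff₀ two_pos, mul_comm]
    exact_mod_cast h6
  have hsum := mul_card_level_le_sum hG2 (pow_nonneg hβ.le d)
  have hint : ∫ x in unitCube d, fooling c M G x =
      ((c * ∑ l ∈ level d M, ((G l).card : ℝ) * (((2 : ℝ) ^ M)⁻¹ * β ^ d) : ℝ) : ℂ) :=
    (setIntegral_unitCube hsupp).trans (integral_fooling hGsub)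
  have hS : 0 ≤ ∑ l ∈ level d M, ((G l).card : ℝ) * (((2 : ℝ) ^ M)⁻¹ * β ^ d) :=
    (div_nonneg (mul_nonneg hcard0.le (pow_nonneg hβ.le d)) two_pos.le).trans hsum
  have hcst : 0 ≤ C₃ * (2 * Λ / β ^ d) :=
    mul_nonneg hC₃.le (div_nonneg (mul_nonneg two_pos.le hΛ0.le) (pow_nonneg hβ.le d))
  rw [hint, ← ofReal_norm, Complex.norm_real, Real.norm_of_nonneg (mul_nonneg hc0.le hS),
    ← ENNReal.ofReal_mul hcst]
  refine ENNReal.ofReal_le_ofReal ?_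
  rw [inv_mul_rpow_one_sub hΛ0.ne' (Real.rpow_pos_of_pos two_pos _).ne' hcard0
    (pow_pos hβ d).ne', ← hc]
  exact mul_le_mul_of_nonneg_left (mul_le_mul_of_nonneg_left hsum hc0.le) hcst

end MixedSmoothness

end

theorem theorem1p1 (d : ℕ) (hd : 1 ≤ d) (p θ : ℝ≥0∞) (hp : 1 ≤ p) (hθ : 1 ≤ θ)
    (s : ℝ) (L : ℕ) (hL : s < (L : ℝ) + 1) (K : LocalMeanKernel L) :
    -- Frolov's rule uses of the order of `n` nodes
    SameOrder (fun n => ((frolovNodes d n).encard : ℝ≥0∞)) (fun n => (n : ℝ≥0∞)) ∧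
    -- the Besov case
    ((1 / p).toReal < s →
      (∀ u ∈ supportedSpace (besovNorm K d s p θ), ∃ f, IsContinuousRep u f) ∧
      SameOrder (optimalError (unitBall (besovNorm K d s p θ))) (rate d s θ) ∧
      Lesssim (fun n => worstCaseError (frolovRule d n) (unitBall (besovNorm K d s p θ)))
        (rate d s θ)) ∧
    -- the Triebel-Lizorkin case
    (p ≠ ⊤ → max (1 / p).toReal (1 / θ).toReal < s →
      (∀ u ∈ supportedSpace (triebelLizorkinNorm K d s p θ), ∃ f, IsContinuousRep u f) ∧
      SameOrder (optimalError (unitBall (triebelLizorkinNorm K d s p θ))) (rate d s θ) ∧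
      Lesssim
        (fun n => worstCaseError (frolovRule d n) (unitBall (triebelLizorkinNorm K d s p θ)))
        (rate d s θ)) := by
  refine ⟨sameOrder_frolovNodes hd, fun hs => ?_, fun hpt hs => ?_⟩
  · have hs0 : 0 < s := ENNReal.toReal_nonneg.trans_lt hs
    have h := dominatesBesov_besovNorm K d θ hp hs
    exact ⟨h.exists_isContinuousRep hd hθ, ⟨h.lesssim_optimalError hd hθ,
      (controlledByMeans_besovNorm K d s p hθ).lesssim_rate hd hθ hs0 hL⟩,
      h.lesssim_frolovRule hd hθ⟩
  · have hs0 : 0 < s := (ENNReal.toReal_nonneg.trans (le_max_left _ _)).trans_lt hs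
    have h := dominatesBesov_triebelLizorkinNorm K d hp hθ hpt hs
    exact ⟨h.exists_isContinuousRep hd hθ, ⟨h.lesssim_optimalError hd hθ,
      (controlledByMeans_triebelLizorkinNorm K d s p hθ).lesssim_rate hd hθ hs0 hL⟩,
      h.lesssim_frolovRule hd hθ⟩
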